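/- Let $n\ge 1$, $G=\mathrm{SL}(n+1,\mathbb R)$, with matrix rows and columns indexed by $0,1,\dots,n$, and let $\mathfrak h$ be the Cartan subalgebra of $\mathfrak{sl}(n+1,\mathbb R)$ consisting of the diagonal matrices of trace zero. Put $$H_C=\mathrm{diag}\bigl(\tfrac n2,\tfrac n2-1,\dots,\tfrac n2-n\bigr),\qquad H_k=\mathrm{diag}\bigl(n,\underbrace{-\tfrac nk,\dots,-\tfrac nk}_{k},0,\dots,0\bigr)\quad(1\le k\le n),$$ and for $\mathbf x=(x_1,\dots,x_n)\in\mathbb R^n$ let $u(\mathbf x)\in G$ be the identity matrix with its first row replaced by $(1,x_1,\dots,x_n)$. For $1\le m\le n$ let $$G_m=\Bigl\{\begin{pmatrix}C&D\\0&I_{n-m}\end{pmatrix}\in G: C\in\mathrm{SL}(m+1,\mathbb R),\ D\in\mathrm{Mat}_{m+1,n-m}(\mathbb R)\Bigr\},$$ $$Q=\Bigl\{\begin{pmatrix}A&0\\w&1\end{pmatrix}: A\in\mathrm{SL}(n,\mathbb R),\ w\in\mathbb R^n\Bigr\},\qquad Q_m=Q\cap G_m .$$ Let $\rho:G\to\mathrm{GL}(V)$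 be a continuous representation on a finite-dimensional real vector space, write $gv=\rho(g)v$, and for $H\in\mathfrak h$ let $H\cdot v=\frac{d}{dt}\big|_{t=0}\rho(\exp tH)v$. For $\mu\in\mathfrak h^*$ let $V_\mu=\{w\in V: H\cdot w=\mu(H)w\ \ \forall H\in\mathfrak h\}$; then $V=\bigoplus_\mu V_\mu$. For $w=\sum_\mu w_\mu$ with $w_\mu\in V_\mu$ let $\Lambda_w=\{\mu\in\mathfrak h^*: w_\mu\ne0\}$. Let $v\in V\setminus\{0\}$ satisfy $H_C\cdot v=bv$ for some $b\in\mathbb R$, let $\mathbf x\in(\mathbb R\setminus\{0\})^n$, and for $1\le k\le n$ put $$S_k=\{\mu\in\Lambda_{u(\mathbf x)v}:\ \mu(H_k)-(\mu(H_C)-b)\ge 0\},\qquad S=\bigcap_{k=1}^n S_k .$$ Then: 1. $\mu(H_C)-b\ge0$ for all $\mu\in\Lambda_{u(\mathbf x)v}$. 2. (a) $S_n\ne\emptyset$. (b) If $\mu(H_n)-(\mu(H_C)-b)=0$ and $\mu(H_C)-b=0$ for all $\mu\in S_n$, then $v$ is fixed by $G$. 3. $S\neq\emptyset$. 4. Suppose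 $1\le j<n$ and $j\le n_0\le n$ are such that $\mu(H_k)-(\mu(H_C)-b)=0$ for all $\mu\in S$ and for $k=j$ and $k=n_0$. Then (a) $v$ is fixed by $Q_{n_0}$; (b) if moreover $\mu(H_C)-b=0$ for all $\mu\in S$, then $v$ is fixed by $G_{n_0}$. -/

import Mathlib

open Matrix

namespace SLRep

/-- The Cartan subalgebra `𝔥` of `𝔰𝔩(n+1, ℝ)`: the diagonal matrices of trace zero. -/
def cartan (n : ℕ) : Submodule ℝ (Matrix (Fin (n + 1)) (Fin (n + 1)) ℝ) where
  carrier := {H | (∀ i j, i ≠ j → H i j = 0) ∧ H.trace = 0}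
  add_mem' := by
    rintro a b ⟨ha, ha'⟩ ⟨hb, hb'⟩
    refine ⟨fun i j hij => ?_, ?_⟩
    · simp [ha i j hij, hb i j hij]
    · simp [ha', hb']
  zero_mem' := by simp
  smul_mem' := by
    rintro c a ⟨ha, ha'⟩
    refine ⟨fun i j hij => ?_, ?_⟩
    · simp [ha i j hij]
    · simp [ha']

/-- The group element `exp H ∈ SL(n+1, ℝ)` for `H ∈ 𝔥`. -/
noncomputable def expCartan {n : ℕ} (H : cartan n) : SpecialLinearGroup (Fin (n + 1)) ℝ :=
  ⟨diagonal fun i => Real.exp ((H : Matrix (Fin (n + 1)) (Fin (n + 1)) ℝ) i i), by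
    rw [det_diagonal, ← Real.exp_sum]
    have h : ∑ i, (H : Matrix (Fin (n + 1)) (Fin (n + 1)) ℝ) i i = 0 := H.2.2
    rw [h, Real.exp_zero]⟩

/-- `expCartan H` is the matrix exponential of `H`. -/
theorem coe_expCartan {n : ℕ} (H : cartan n) :
    (expCartan H : Matrix (Fin (n + 1)) (Fin (n + 1)) ℝ) =
      NormedSpace.exp (H : Matrix (Fin (n + 1)) (Fin (n + 1)) ℝ) := by
  have h : (H : Matrix (Fin (n + 1)) (Fin (n + 1)) ℝ) =
      diagonal fun i => (H : Matrix (Fin (n + 1)) (Fin (n + 1)) ℝ) i i := by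
    ext i j
    by_cases hij : i = j
    · subst hij; simp
    · rw [diagonal_apply_ne _ hij, H.2.1 i j hij]
  conv_rhs => rw [h]
  rw [Matrix.exp_diagonal]
  have h2 : NormedSpace.exp (fun i => (H : Matrix (Fin (n + 1)) (Fin (n + 1)) ℝ) i i) =
      fun i => Real.exp ((H : Matrix (Fin (n + 1)) (Fin (n + 1)) ℝ) i i) := by
    rw [Pi.exp_def, Real.exp_eq_exp_ℝ]
  rw [h2]
  rfl

/-- `H_C = diag(n/2, n/2 - 1, …, n/2 - n)`. -/
noncomputable def HC (n : ℕ) : cartan n :=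
  ⟨diagonal fun i : Fin (n + 1) => (n : ℝ) / 2 - (i : ℕ), by
    refine ⟨fun i j hij => diagonal_apply_ne _ hij, ?_⟩
    rw [trace_diagonal, Fin.sum_univ_eq_sum_range (fun i => (n : ℝ) / 2 - (i : ℝ)) (n + 1)]
    have h : ∀ m : ℕ, ∑ i ∈ Finset.range m, ((n : ℝ) / 2 - i) = m * (n - m + 1) / 2 := by
      intro m
      induction m with
      | zero => simp
      | succ k ih => rw [Finset.sum_range_succ, ih]; push_cast; ring
    rw [h]; push_cast; ring⟩

/-- `H_k = diag(n, -n/k, …, -n/k, 0, …, 0)` with `k` entries `-n/k`, for `1 ≤ k ≤ n`. -/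
noncomputable def Hk (n k : ℕ) (hk : 1 ≤ k ∧ k ≤ n) : cartan n :=
  ⟨diagonal fun i : Fin (n + 1) =>
      if (i : ℕ) = 0 then (n : ℝ) else if (i : ℕ) ≤ k then -((n : ℝ) / k) else 0, by
    refine ⟨fun i j hij => diagonal_apply_ne _ hij, ?_⟩
    obtain ⟨h1, h2⟩ := hk
    rw [trace_diagonal, Fin.sum_univ_eq_sum_range (fun i => if i = 0 then (n : ℝ) else
      if i ≤ k then -((n : ℝ) / k) else 0) (n + 1), Finset.sum_range_succ']
    have hs : (Finset.range n).filter (fun i => i + 1 ≤ k) = Finset.range k := by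
      ext i; simp only [Finset.mem_filter, Finset.mem_range]; omega
    have hk0 : (k : ℝ) ≠ 0 := by positivity
    simp only [Nat.add_eq_zero_iff, one_ne_zero, and_false, if_false, if_true]
    rw [← Finset.sum_filter, hs, Finset.sum_const, Finset.card_range, nsmul_eq_mul]
    field_simp
    ring⟩

/-- The unipotent element `u(x)`: the identity matrix with first row replaced by
`(1, x₁, …, xₙ)`. -/
def unip {n : ℕ} (x : Fin n → ℝ) : SpecialLinearGroup (Fin (n + 1)) ℝ :=
  ⟨Matrix.of (Fin.cons (Fin.cons 1 x : Fin (n + 1) → ℝ)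
      fun i : Fin n => (1 : Matrix (Fin (n + 1)) (Fin (n + 1)) ℝ) i.succ), by
    rw [det_of_isUpperTriangular]
    · rw [Fin.prod_univ_succ]; simp
    · intro i j hij
      refine Fin.cases (fun h => ?_) (fun i h => ?_) i hij
      · exact absurd h (Fin.not_lt_zero _)
      · exact one_apply_ne (ne_of_gt h)⟩

/-- `G_m`: the matrices `(C D; 0 I)` in `SL(n+1, ℝ)` with `C ∈ SL(m+1, ℝ)`, `I` the identity of
size `n - m`, and `D` arbitrary (`det C = 1` is then automatic). -/
def subG (n m : ℕ) : Set (SpecialLinearGroup (Fin (n + 1)) ℝ) :=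
  {g | ∀ i j : Fin (n + 1), m < (i : ℕ) → g i j = if i = j then 1 else 0}

/-- `Q`: the matrices `(A 0; w 1)` in `SL(n+1, ℝ)` with `A ∈ SL(n, ℝ)` and `w ∈ ℝⁿ`
(`det A = 1` is then automatic). -/
def subQ (n : ℕ) : Set (SpecialLinearGroup (Fin (n + 1)) ℝ) :=
  {g | ∀ i : Fin (n + 1), g i (Fin.last n) = if i = Fin.last n then 1 else 0}

section Rep

variable {n : ℕ} {V : Type*} [NormedAddCommGroup V] [NormedSpace ℝ V]

/-- `H · v = w` for the derived action of `H ∈ 𝔥`: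
`w` is the derivative at `t = 0` of `t ↦ ρ(exp(tH)) v`. -/
def ActsTo (ρ : Representation ℝ (SpecialLinearGroup (Fin (n + 1)) ℝ) V)
    (H : cartan n) (v w : V) : Prop :=
  HasDerivAt (fun t : ℝ => ρ (expCartan (t • H)) v) w 0

/-- The weight space `V_μ = {v | H · v = μ(H) v for all H ∈ 𝔥}`. -/
def weightSpace (ρ : Representation ℝ (SpecialLinearGroup (Fin (n + 1)) ℝ) V)
    (μ : Module.Dual ℝ (cartan n)) : Submodule ℝ V where
  carrier := {v | ∀ H : cartan n, ActsTo ρ H v (μ H • v)}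
  add_mem' := by
    intro a b ha hb H
    have h := (ha H).add (hb H)
    rw [← smul_add] at h
    refine h.congr_of_eventuallyEq (Filter.Eventually.of_forall fun t => ?_)
    simp
  zero_mem' := by
    intro H
    simpa [ActsTo] using hasDerivAt_const (0 : ℝ) (0 : V)
  smul_mem' := by
    intro c a ha H
    have h := (ha H).const_smul c
    rw [smul_comm] at h
    refine h.congr_of_eventuallyEq (Filter.Eventually.of_forall fun t => ?_)
    simp

/-- `Λ_w`: the set of weights `μ` with `w_μ ≠ 0`, where `w = ∑ w_μ` is the decomposition of `w`
into weight vectors `w_μ ∈ V_μ`. -/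
def weightsOf (ρ : Representation ℝ (SpecialLinearGroup (Fin (n + 1)) ℝ) V) (w : V) :
    Set (Module.Dual ℝ (cartan n)) :=
  {μ | ∃ c : Module.Dual ℝ (cartan n) →₀ V,
    (∀ ν, c ν ∈ weightSpace ρ ν) ∧ (c.sum fun _ y => y) = w ∧ c μ ≠ 0}

/-- `S_k = {μ ∈ Λ_{u(x)v} : μ(H_k) - (μ(H_C) - b) ≥ 0}`. -/
def setSk (ρ : Representation ℝ (SpecialLinearGroup (Fin (n + 1)) ℝ) V) (x : Fin n → ℝ)
    (v : V) (b : ℝ) (k : ℕ) (hk : 1 ≤ k ∧ k ≤ n) : Set (Module.Dual ℝ (cartan n)) :=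
  {μ | μ ∈ weightsOf ρ (ρ (unip x) v) ∧ 0 ≤ μ (Hk n k hk) - (μ (HC n) - b)}

/-- `S = ⋂_{k=1}^n S_k`. -/
def setS (ρ : Representation ℝ (SpecialLinearGroup (Fin (n + 1)) ℝ) V) (x : Fin n → ℝ)
    (v : V) (b : ℝ) : Set (Module.Dual ℝ (cartan n)) :=
  ⋂ (k : ℕ) (hk : 1 ≤ k ∧ k ≤ n), setSk ρ x v b k hk

end Rep

end SLRep

/-! Write α_k = e_0 − e_k, let C_k be the sum of the coroots of α_1, …, α_k (`corootSum`), so that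
H_k = (n/k) C_k, and put d(μ) = μ(H_C) − b. The element u(x) is the product of the commuting root
elements of α_1, …, α_n; `partialUnip` keeps the first m factors. Since α_k(H_C) = k > 0, applying
u(x) can only raise H_C, which is item 1.

The engine is a computation in SL₂. Up to root elements of −α, the element u_α(t) is a Weyl element,
so a weight κ of u_{−α}(1/t) y yields a weight s_α κ + jα, j ≥ 0, of u_α(t) y
(`exists_weightProj_reflection_ne_zero`, `exists_lift`). This is applied with α = α_{m+1} and y =
`partialUnip x m v`, by induction on m. The diagonal element L_m = (1, …, 1, −(m+1), 0, …, 0)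
(`levelElt`) is killed by α_1, …, α_m and has α_{m+1}(L_m) = m + 2. Hence the part v₀ of v with
maximal L_m contributes weights to y that u_{−α} cannot cancel (`exists_top_level`). The quantities
(m+1) μ(C_k) − k μ(H_C), k ≤ m, are constant on α_{m+1}-strings, while a lift turns C_m − H_C into
C_{m+1} − H_C plus j. So the inequalities `Admissible` pass from rank m to m + 1, and one last lift
lands in S, which is contained in S_n.

For rigidity, equalities for all lifted weights force equalities one rank lower, so v₀ is fixed by a
smaller block of root subgroups. Then each α_{m+1}-string through a weight of v₀ meets y only there,
SL₂ theory adds the new root subgroups, and v₀ can be split off without creating new weights in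
`partialUnip x (m+1) v` (`supp_sub_cut_subset`, `mem_of_level_induction`). For the full block there
is one obstruction, a weight of y exactly one step α_{m+1} below the top level; `false_of_neg_level`
excludes it by transporting a weight of v by a Coxeter element. Finally, elimination shows that the
root subgroups generate G_m and Q_m.

The decomposition into weight spaces is derived from continuity: root subgroups act by polynomials
in t, hence the torus acts by finite sums of real exponentials and is diagonalizable. -/

/-! ### Continuous one-parameter groups in a Banach algebra. -/

/-- Continuity upgrades to differentiability by integrating: γ(t) ∫₀^ε γ = ∫_t^{t+ε} γ, and the
integral on the left is invertible for a suitable ε. The equation γ' = γX then gives the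
exponential. -/
theorem exists_exp_of_continuous_hom {A : Type*} [NormedRing A] [NormedAlgebra ℝ A]
    [CompleteSpace A] (γ : ℝ → A) (hγ : Continuous γ) (h0 : γ 0 = 1)
    (hadd : ∀ s t, γ (s + t) = γ s * γ t) :
    ∃ X : A, ∀ t : ℝ, γ t = NormedSpace.exp (t • X) := by
  have hinterval : ∀ a b, IntervalIntegrable γ MeasureTheory.volume a b :=
    fun a b => hγ.intervalIntegrable a b
  set Γ : ℝ → A := fun t => ∫ s in (0 : ℝ)..t, γ s with hΓ
  have hΓ' : ∀ t, HasDerivAt Γ (γ t) t := fun t =>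
    intervalIntegral.integral_hasDerivAt_right (hinterval 0 t)
      (hγ.stronglyMeasurableAtFilter _ _) hγ.continuousAt
  -- Γ(t)/t tends to 1 and the units are open.
  obtain ⟨ε, hε⟩ : ∃ ε : ℝ, IsUnit (Γ ε) := by
    have h1 : Filter.Tendsto (fun t : ℝ => t⁻¹ • Γ t) (nhdsWithin 0 {0}ᶜ) (nhds 1) := by
      have := (hΓ' 0).tendsto_slope_zero
      simpa [hΓ, h0] using this
    have h2 : ∀ᶠ t in nhdsWithin (0 : ℝ) {0}ᶜ, IsUnit (t⁻¹ • Γ t) :=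
      h1 (Units.isOpen.mem_nhds isUnit_one)
    obtain ⟨t, ht, ht0⟩ := (h2.and self_mem_nhdsWithin).exists
    have ht0 : t ≠ 0 := ht0
    refine ⟨t, ?_⟩
    have := ht.smul (Units.mk0 t ht0)
    simpa [Units.smul_def, smul_smul, ht0] using this
  obtain ⟨u, hu⟩ := hε
  have hmul : ∀ t, γ t = (Γ (t + ε) - Γ t) * (u⁻¹ : Aˣ) := by
    intro t
    have h1 : Γ (t + ε) - Γ t = γ t * Γ ε := by
      simp only [hΓ]
      rw [intervalIntegral.integral_interval_sub_left (hinterval _ _) (hinterval _ _)]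
      have := intervalIntegral.integral_comp_add_left (a := 0) (b := ε) γ t
      simp only [add_zero] at this
      rw [← this]
      simp_rw [hadd]
      exact (ContinuousLinearMap.mul ℝ A (γ t)).intervalIntegral_comp_comm (hinterval 0 ε)
    rw [h1, ← hu, mul_assoc, Units.mul_inv, mul_one]
  -- Differentiating `hmul` at 0 forces this value.
  set X : A := (γ ε - 1) * (u⁻¹ : Aˣ) with hX
  have hd : ∀ t, HasDerivAt γ (γ t * X) t := by
    intro t
    have h1 : HasDerivAt (fun t => (Γ (t + ε) - Γ t) * ((u⁻¹ : Aˣ) : A))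
        ((γ (t + ε) - γ t) * (u⁻¹ : Aˣ)) t :=
      (((hΓ' (t + ε)).comp_add_const t ε).sub (hΓ' t)).mul_const _
    have h2 : (fun t => (Γ (t + ε) - Γ t) * ((u⁻¹ : Aˣ) : A)) = γ := by
      funext t; exact (hmul t).symm
    rw [h2] at h1
    convert h1 using 1
    rw [hX, hadd, ← mul_assoc, mul_sub, mul_one]
  refine ⟨X, fun t => ?_⟩
  have he : ∀ t : ℝ, HasDerivAt (fun t : ℝ => NormedSpace.exp (t • (-X)))
      ((-X) * NormedSpace.exp (t • (-X))) t := fun t => hasDerivAt_exp_smul_const' (-X) t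
  have hc : ∀ t : ℝ, HasDerivAt (fun t => γ t * NormedSpace.exp (t • (-X))) 0 t := by
    intro t
    have := (hd t).mul (he t)
    exact this.congr_deriv (by rw [neg_mul, mul_neg, mul_assoc, add_neg_cancel])
  have hconst := is_const_of_deriv_eq_zero (fun t => (hc t).differentiableAt)
    (fun t => (hc t).deriv) t 0
  simp only [zero_smul, NormedSpace.exp_zero, h0, mul_one] at hconst
  have h3 : NormedSpace.exp (t • (-X)) * NormedSpace.exp (t • X) = 1 := by
    rw [smul_neg]
    let _ : NormedAlgebra ℚ A := NormedAlgebra.restrictScalars ℚ ℝ A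
    rw [← NormedSpace.exp_add_of_commute (by simp)]
    simp
  calc γ t = γ t * (NormedSpace.exp (t • (-X)) * NormedSpace.exp (t • X)) := by rw [h3, mul_one]
    _ = _ := by rw [← mul_assoc, hconst, one_mul]

namespace SLRep

/-! ### Roots, coroots, root elements and Weyl elements of SL(n+1). -/

section Group

theorem special_ext {ι : Type*} [Fintype ι] [DecidableEq ι] {g h : Matrix.SpecialLinearGroup ι ℝ}
    (e : (g : Matrix ι ι ℝ) = (h : Matrix ι ι ℝ)) : g = h := Subtype.ext e

variable {n : ℕ}

/-- The linear form `H ↦ H i i - H j j` on the Cartan subalgebra. -/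
def root (i j : Fin (n + 1)) : Module.Dual ℝ (cartan n) where
  toFun H := (H : Matrix (Fin (n + 1)) (Fin (n + 1)) ℝ) i i -
    (H : Matrix (Fin (n + 1)) (Fin (n + 1)) ℝ) j j
  map_add' H K := by simp; ring
  map_smul' c H := by simp; ring

theorem root_apply (i j : Fin (n + 1)) (H : cartan n) :
    root i j H = (H : Matrix (Fin (n + 1)) (Fin (n + 1)) ℝ) i i -
      (H : Matrix (Fin (n + 1)) (Fin (n + 1)) ℝ) j j := rfl

theorem root_swap (i j : Fin (n + 1)) : root j i = -root i j := by
  ext H; simp [root_apply]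

/-- The diagonal matrix `e_i - e_j`. -/
def coroot (i j : Fin (n + 1)) : cartan n :=
  ⟨diagonal (Pi.single i 1 - Pi.single j 1),
    fun _ _ hab => diagonal_apply_ne _ hab, by simp [trace_diagonal]⟩

theorem coroot_diag (i j a : Fin (n + 1)) :
    (coroot i j : Matrix (Fin (n + 1)) (Fin (n + 1)) ℝ) a a =
      (Pi.single i 1 : Fin (n + 1) → ℝ) a - (Pi.single j 1 : Fin (n + 1) → ℝ) a := by
  simp [coroot]

theorem coroot_swap (i j : Fin (n + 1)) : coroot j i = -coroot i j := by
  apply Subtype.ext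
  simp only [coroot, Submodule.coe_neg, diagonal_neg]
  congr 1
  ext a; simp

theorem cartan_ext {H K : cartan n} (h : ∀ i, (H : Matrix (Fin (n + 1)) (Fin (n + 1)) ℝ) i i =
    (K : Matrix (Fin (n + 1)) (Fin (n + 1)) ℝ) i i) : H = K := by
  apply Subtype.ext
  ext i j
  by_cases hij : i = j
  · subst hij; exact h i
  · rw [H.2.1 i j hij, K.2.1 i j hij]

theorem coe_expCartan_diagonal (H : cartan n) :
    (expCartan H : Matrix (Fin (n + 1)) (Fin (n + 1)) ℝ) =
      diagonal fun i => Real.exp ((H : Matrix (Fin (n + 1)) (Fin (n + 1)) ℝ) i i) := rfl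

theorem expCartan_add (H K : cartan n) : expCartan (H + K) = expCartan H * expCartan K := by
  apply special_ext
  rw [Matrix.SpecialLinearGroup.coe_mul]
  simp [coe_expCartan_diagonal, Real.exp_add]

theorem expCartan_zero : expCartan (0 : cartan n) = 1 := by
  apply special_ext
  simp [coe_expCartan_diagonal]

/-- The root element `1 + t E_{ij}` of `SL(n+1, ℝ)` (equal to `1` if `i = j`). -/
def rootElt (i j : Fin (n + 1)) (t : ℝ) : Matrix.SpecialLinearGroup (Fin (n + 1)) ℝ :=
  if h : i ≠ j then Matrix.SpecialLinearGroup.transvection h t else 1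

theorem coe_rootElt {i j : Fin (n + 1)} (h : i ≠ j) (t : ℝ) :
    (rootElt i j t : Matrix (Fin (n + 1)) (Fin (n + 1)) ℝ) = 1 + single i j t := by
  rw [rootElt, dif_pos h, Matrix.SpecialLinearGroup.transvection_coe]

theorem rootElt_self (i : Fin (n + 1)) (t : ℝ) : rootElt i i t = 1 := by
  simp [rootElt]

theorem rootElt_zero (i j : Fin (n + 1)) : rootElt i j 0 = 1 := by
  unfold rootElt
  split_ifs <;> simp

theorem rootElt_add (i j : Fin (n + 1)) (s t : ℝ) :
    rootElt i j (s + t) = rootElt i j s * rootElt i j t := by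
  unfold rootElt
  split_ifs with h
  · exact Matrix.SpecialLinearGroup.transvection_add h s t
  · simp

theorem rootElt_inv (i j : Fin (n + 1)) (t : ℝ) : (rootElt i j t)⁻¹ = rootElt i j (-t) := by
  rw [inv_eq_iff_mul_eq_one, ← rootElt_add, add_neg_cancel, rootElt_zero]

theorem continuous_rootElt (i j : Fin (n + 1)) : Continuous (rootElt i j) := by
  by_cases h : i = j
  · subst h; simpa [funext (rootElt_self i)] using continuous_const
  · refine Continuous.subtype_mk (f := fun t => (rootElt i j t).1) ?_ fun t => (rootElt i j t).2
    refine continuous_pi fun a => continuous_pi fun b => ?_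
    simp only [coe_rootElt h, Matrix.add_apply, single_apply]
    split_ifs <;> fun_prop

theorem expCartan_mul_rootElt (H : cartan n) (i j : Fin (n + 1)) (t : ℝ) :
    expCartan H * rootElt i j t = rootElt i j (Real.exp (root i j H) * t) * expCartan H := by
  by_cases h : i = j
  · subst h; simp [rootElt_self]
  apply special_ext
  rw [Matrix.SpecialLinearGroup.coe_mul, Matrix.SpecialLinearGroup.coe_mul, coe_rootElt h, coe_rootElt h,
    coe_expCartan_diagonal]
  ext a b
  rw [diagonal_mul, mul_diagonal, Matrix.add_apply, Matrix.add_apply, single_apply, single_apply, root_apply]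
  by_cases hab : i = a ∧ j = b
  · obtain ⟨rfl, rfl⟩ := hab
    simp [one_apply_ne h, Real.exp_sub]
    field_simp
  · rw [if_neg hab, if_neg hab]
    by_cases h2 : a = b
    · subst h2; ring
    · simp [one_apply_ne h2]

/-- A representative in `SL(n+1, ℝ)` of the reflection attached to the root `(i, j)`. -/
noncomputable def weylElt (i j : Fin (n + 1)) (t : ℝ) : Matrix.SpecialLinearGroup (Fin (n + 1)) ℝ :=
  rootElt i j t * rootElt j i (-t⁻¹) * rootElt i j t

theorem coe_weylElt {i j : Fin (n + 1)} (h : i ≠ j) {t : ℝ} (ht : t ≠ 0) :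
    (weylElt i j t : Matrix (Fin (n + 1)) (Fin (n + 1)) ℝ) =
      1 - single i i 1 - single j j 1 + single i j t - single j i t⁻¹ := by
  rw [weylElt, Matrix.SpecialLinearGroup.coe_mul, Matrix.SpecialLinearGroup.coe_mul, coe_rootElt h,
    coe_rootElt h.symm]
  simp only [mul_add, add_mul, single_mul_single_same, one_mul, mul_one,
    single_mul_single_of_ne _ _ _ _ h.symm]
  have e1 : t * -t⁻¹ = -1 := by field_simp
  have e2 : -t⁻¹ * t = -1 := by field_simp
  rw [e1, e2]
  ext a b
  simp only [Matrix.add_apply, Matrix.sub_apply, single_apply]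
  split_ifs <;> simp <;> ring

theorem weylElt_mul_expCartan {i j : Fin (n + 1)} (h : i ≠ j) {t : ℝ} (ht : t ≠ 0)
    (H : cartan n) :
    weylElt i j t * expCartan H = expCartan (H - root i j H • coroot i j) * weylElt i j t := by
  apply special_ext
  rw [Matrix.SpecialLinearGroup.coe_mul, Matrix.SpecialLinearGroup.coe_mul, coe_weylElt h ht,
    coe_expCartan_diagonal, coe_expCartan_diagonal]
  ext a b
  rw [diagonal_mul, mul_diagonal]
  simp only [AddSubgroupClass.coe_sub, SetLike.val_smul, Matrix.sub_apply, Matrix.smul_apply, coroot_diag,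
    root_apply, Matrix.add_apply, single_apply, one_apply, smul_eq_mul, Pi.single_apply]
  have h' := Ne.symm h
  by_cases ha : a = i
  · subst ha
    by_cases hb : b = j
    · subst hb; simp [h, h']; ring
    · by_cases hab : a = b
      · subst hab; simp [h, h']
      · simp [h, h', hab, Ne.symm hb]
  · by_cases ha' : a = j
    · subst ha'
      by_cases hb : b = i
      · subst hb; simp [h, h']; ring
      · by_cases hab : a = b
        · subst hab; simp [h, h']
        · simp [h, h', hab, Ne.symm hb]
    · simp only [Ne.symm ha, Ne.symm ha', ha, ha', false_and, if_false]
      by_cases hab : a = b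
      · subst hab; simp
      · simp [hab]

theorem expCartan_coroot_mul_weylElt {i j : Fin (n + 1)} (h : i ≠ j) (τ : ℝ) :
    expCartan (τ • coroot i j) * weylElt i j 1 = weylElt i j (Real.exp τ) := by
  apply special_ext
  rw [Matrix.SpecialLinearGroup.coe_mul, coe_weylElt h one_ne_zero, coe_weylElt h (Real.exp_ne_zero _),
    coe_expCartan_diagonal]
  ext a b
  rw [diagonal_mul]
  simp only [SetLike.val_smul, Matrix.sub_apply, Matrix.smul_apply, coroot_diag,
    Matrix.add_apply, single_apply, one_apply, smul_eq_mul, Pi.single_apply]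
  have h' := Ne.symm h
  by_cases ha : a = i
  · subst ha
    by_cases hb : b = j
    · subst hb; simp [h, h']
    · by_cases hab : a = b
      · subst hab; simp [h, h']
      · simp [h, h', hab, Ne.symm hb]
  · by_cases ha' : a = j
    · subst ha'
      by_cases hb : b = i
      · subst hb; simp [h, h', Real.exp_neg]
      · by_cases hab : a = b
        · subst hab; simp [h, h']
        · simp [h, h', hab, Ne.symm hb]
    · simp [Ne.symm ha, Ne.symm ha', ha, ha']

theorem rootElt_eq_mul_weylElt_mul {i j : Fin (n + 1)} {t : ℝ} :
    rootElt i j t = rootElt j i t⁻¹ * weylElt j i (-t⁻¹) * rootElt j i t⁻¹ := by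
  have h1 : rootElt j i (-t⁻¹) = (rootElt j i t⁻¹)⁻¹ := (rootElt_inv _ _ _).symm
  rw [weylElt, h1, inv_neg, inv_inv, neg_neg]
  group

end Group

/-! ### Nilpotent generators of the root subgroups. -/

section Generators

variable {n : ℕ} {V : Type*} [NormedAddCommGroup V] [NormedSpace ℝ V] [FiniteDimensional ℝ V]
  (ρ : Representation ℝ (Matrix.SpecialLinearGroup (Fin (n + 1)) ℝ) V)

theorem exp_eq_sum_of_pow_eq_zero {A : Type*} [NormedRing A] [NormedAlgebra ℝ A]
    {X : A} {N : ℕ} (hX : X ^ N = 0) :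
    NormedSpace.exp X = ∑ k ∈ Finset.range N, ((k.factorial : ℝ)⁻¹) • X ^ k := by
  rw [NormedSpace.exp_eq_tsum ℝ]
  refine tsum_eq_sum fun k hk => ?_
  rw [pow_eq_zero_of_le (by simpa using hk) hX, smul_zero]

/-- The bound N + 2 in place of N guarantees that the constant and linear terms can always be split
off. -/
theorem exists_generator
    (hρ : ∀ w : V, Continuous fun g => ρ g w) {i j : Fin (n + 1)} (hij : i ≠ j) :
    ∃ (X : Module.End ℝ V) (N : ℕ),
      (∀ t : ℝ, ρ (rootElt i j t) = ∑ k ∈ Finset.range (N + 2), (t ^ k / k.factorial) • X ^ k) ∧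
      (∀ H : cartan n,
        ρ (expCartan H) * X = Real.exp (root i j H) • (X * ρ (expCartan H))) ∧
      ∀ v, (∀ t, ρ (rootElt i j t) v = v) → X v = 0 := by
  set Φ : Module.End ℝ V ≃ₐ[ℝ] (V →L[ℝ] V) := Module.End.toContinuousLinearMap V with hΦ
  have hΦa : ∀ f v, Φ f v = f v := fun f v => rfl
  set γ : ℝ → (V →L[ℝ] V) := fun t => Φ (ρ (rootElt i j t)) with hγ
  obtain ⟨X, hX⟩ := exists_exp_of_continuous_hom γ
    (continuous_clm_apply.2 fun w => (hρ w).comp (continuous_rootElt i j))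
    (by simp [hγ, rootElt_zero]) (fun s t => by simp [hγ, rootElt_add])
  have hd : HasDerivAt γ X 0 := by
    have := hasDerivAt_exp_smul_const X (0 : ℝ)
    rw [zero_smul, NormedSpace.exp_zero, one_mul] at this
    rwa [funext hX]
  have hconj : ∀ H : cartan n, Φ (ρ (expCartan H)) * X =
      Real.exp (root i j H) • (X * Φ (ρ (expCartan H))) := by
    intro H
    have h1 : HasDerivAt (fun t => Φ (ρ (expCartan H)) * γ t) (Φ (ρ (expCartan H)) * X) 0 :=
      hd.const_mul _
    have h2 : HasDerivAt (fun t => γ (Real.exp (root i j H) * t) * Φ (ρ (expCartan H)))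
        ((Real.exp (root i j H) • X) * Φ (ρ (expCartan H))) 0 := by
      refine HasDerivAt.mul_const ?_ _
      have h3 : HasDerivAt (fun t : ℝ => Real.exp (root i j H) * t) (Real.exp (root i j H)) 0 := by
        simpa using (hasDerivAt_id (0 : ℝ)).const_mul (Real.exp (root i j H))
      exact HasDerivAt.scomp (0 : ℝ) (by simpa using hd) h3
    have h4 : (fun t => Φ (ρ (expCartan H)) * γ t) =
        fun t => γ (Real.exp (root i j H) * t) * Φ (ρ (expCartan H)) := by
      funext t
      simp only [hγ, ← map_mul, expCartan_mul_rootElt]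
    rw [h4] at h1
    rw [h1.unique h2, smul_mul_assoc]
  -- Conjugation by a torus element A multiplies X^N by q^N with q > 1, but multiplies norms by at
  -- most ‖A‖‖A⁻¹‖; once q^N exceeds this bound, X^N = 0.
  obtain ⟨N, hN⟩ : ∃ N, X ^ N = 0 := by
    set A := Φ (ρ (expCartan (coroot i j)))
    set B := Φ (ρ (expCartan (-coroot i j)))
    have hAB : A * B = 1 := by
      simp only [A, B, ← map_mul, ← expCartan_add, add_neg_cancel, expCartan_zero, map_one]
    set q := Real.exp (root i j (coroot i j)) with hq
    have hq1 : 1 < q := by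
      rw [hq, Real.one_lt_exp_iff, root_apply, coroot_diag, coroot_diag]
      simp [hij, hij.symm]
    obtain ⟨N, hN⟩ := pow_unbounded_of_one_lt (‖A‖ * ‖B‖) hq1
    refine ⟨N, ?_⟩
    have h1 : ∀ k : ℕ, A * X ^ k = q ^ k • (X ^ k * A) := by
      intro k
      induction k with
      | zero => simp
      | succ k ih =>
        rw [pow_succ, ← mul_assoc, ih, smul_mul_assoc, mul_assoc, hconj, mul_smul_comm, smul_smul,
          ← mul_assoc, ← pow_succ]
    have h2 : q ^ N • X ^ N = A * X ^ N * B := by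
      rw [h1, smul_mul_assoc, mul_assoc, hAB, mul_one]
    have h3 : q ^ N * ‖X ^ N‖ ≤ ‖A‖ * ‖B‖ * ‖X ^ N‖ := by
      calc q ^ N * ‖X ^ N‖ = ‖q ^ N • X ^ N‖ := by
            rw [norm_smul, Real.norm_of_nonneg (by positivity)]
        _ = ‖A * X ^ N * B‖ := by rw [h2]
        _ ≤ ‖A‖ * ‖X ^ N‖ * ‖B‖ :=
            (norm_mul_le _ _).trans (by gcongr; exact norm_mul_le _ _)
        _ = _ := by ring
    by_contra h
    exact absurd (le_of_mul_le_mul_right h3 (norm_pos_iff.2 h)) (not_le.2 hN)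
  refine ⟨Φ.symm X, N, fun t => ?_, fun H => ?_, fun v hv => ?_⟩
  · apply Φ.injective
    change γ t = _
    rw [hX, exp_eq_sum_of_pow_eq_zero (N := N + 2)
      (by rw [smul_pow, pow_add X, hN, zero_mul, smul_zero]), map_sum]
    refine Finset.sum_congr rfl fun k _ => ?_
    rw [map_smul, map_pow, AlgEquiv.apply_symm_apply, smul_pow, smul_smul, div_eq_inv_mul]
  · apply Φ.injective
    simp only [map_mul, map_smul, AlgEquiv.apply_symm_apply, hconj]
  · have h1 : HasDerivAt (fun t => γ t v) (X v) 0 := 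
      (ContinuousLinearMap.apply ℝ V v).hasFDerivAt.comp_hasDerivAt (0 : ℝ) hd
    have h2 : (fun t => γ t v) = fun _ => v := funext hv
    rw [h2] at h1
    exact h1.unique (hasDerivAt_const _ _)

end Generators

/-! ### Diagonalizing one-parameter groups made of real exponentials. -/

section Eigen

variable {n : ℕ} {V : Type*} [AddCommGroup V] [Module ℝ V]

theorem rep_expCartan_add
    {ρ : Representation ℝ (Matrix.SpecialLinearGroup (Fin (n + 1)) ℝ) V} (H K : cartan n) :
    ρ (expCartan (H + K)) = ρ (expCartan H) * ρ (expCartan K) := by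
  rw [expCartan_add, map_mul]

/-- A semisimplicity criterion: a one-parameter group that is a finite combination of real
exponentials is diagonalizable, with the eigenvectors of its value at `1`. -/
theorem exists_eigen_decomposition {A : ℝ → Module.End ℝ V} {ι : Type*} {s : Finset ι} {e : ι → ℝ}
    {Q : ι → Module.End ℝ V} (hA : ∀ τ, A τ = ∑ a ∈ s, Real.exp (τ * e a) • Q a)
    (h0 : A 0 = 1) (hadd : ∀ σ τ, A (σ + τ) = A σ * A τ) :
    (∃ (S : Finset ℝ) (L : ℝ → Polynomial ℝ), ∀ v : V,
      ∑ l ∈ S, Polynomial.aeval (A 1) (L l) v = v ∧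
      ∀ l ∈ S, A 1 (Polynomial.aeval (A 1) (L l) v) = l • Polynomial.aeval (A 1) (L l) v) ∧
    ∀ (v : V) (l : ℝ), v ≠ 0 → A 1 v = l • v → ∃ c : ℝ, ∀ τ, A τ v = Real.exp (τ * c) • v := by
  classical
  have hpow : ∀ k : ℕ, A 1 ^ k = A k := by
    intro k
    induction k with
    | zero => simp [h0]
    | succ k ih => rw [pow_succ, ih, ← hadd]; push_cast; rfl
  have hp : ∀ p : Polynomial ℝ,
      Polynomial.aeval (A 1) p = ∑ a ∈ s, p.eval (Real.exp (e a)) • Q a := by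
    intro p
    induction p using Polynomial.induction_on' with
    | add p q hp hq => simp only [map_add, hp, hq, Polynomial.eval_add, add_smul,
        Finset.sum_add_distrib]
    | monomial k c =>
      rw [Polynomial.aeval_monomial, hpow, hA, Algebra.algebraMap_eq_smul_one, smul_mul_assoc,
        one_mul, Finset.smul_sum]
      refine Finset.sum_congr rfl fun a _ => ?_
      rw [smul_smul, Polynomial.eval_monomial, Real.exp_nat_mul]
  have hzero : ∀ p : Polynomial ℝ, (∀ a ∈ s, p.eval (Real.exp (e a)) = 0) →
      Polynomial.aeval (A 1) p = 0 := by
    intro p h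
    rw [hp]
    exact Finset.sum_eq_zero fun a ha => by rw [h a ha, zero_smul]
  have hev : ∀ (p : Polynomial ℝ) (v : V) (l : ℝ), A 1 v = l • v →
      Polynomial.aeval (A 1) p v = p.eval l • v := by
    intro p v l h
    by_cases hv : v = 0
    · simp [hv]
    · exact Module.End.aeval_apply_of_hasEigenvector ⟨Module.End.mem_eigenspace_iff.2 h, hv⟩
  refine ⟨?_, ?_⟩
  -- The extra node 1 only keeps the set nonempty, as the partition of unity by Lagrange polynomials
  -- requires.
  · set S : Finset ℝ := insert 1 (s.image fun a => Real.exp (e a)) with hS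
    have hinj : Set.InjOn (id : ℝ → ℝ) S := Function.injective_id.injOn
    refine ⟨S, fun l => Lagrange.basis S id l, fun v => ⟨?_, fun l hl => ?_⟩⟩
    · rw [← LinearMap.sum_apply, ← map_sum, Lagrange.sum_basis hinj ⟨1, by simp [hS]⟩, map_one,
        Module.End.one_apply]
    · have h1 := hzero ((Polynomial.X - Polynomial.C l) * Lagrange.basis S id l) (by
        intro a ha
        rw [Polynomial.eval_mul]
        by_cases hal : Real.exp (e a) = l
        · simp [hal]
        · have := Lagrange.eval_basis_of_ne (v := id) (s := S) (i := l) (j := Real.exp (e a))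
            (Ne.symm hal) (Finset.mem_insert_of_mem
              (Finset.mem_image_of_mem (fun a => Real.exp (e a)) ha))
          rw [show Polynomial.eval (Real.exp (e a)) (Lagrange.basis S id l) = 0 from this,
            mul_zero])
      have h2 := congrArg (fun f : Module.End ℝ V => f v) h1
      simp only [map_mul, map_sub, Polynomial.aeval_X, Polynomial.aeval_C, Module.End.mul_apply,
        LinearMap.sub_apply, Module.algebraMap_end_apply, LinearMap.zero_apply] at h2
      exact sub_eq_zero.1 h2
  · intro v l hv h
    have h1 := hzero (∏ a ∈ s, (Polynomial.X - Polynomial.C (Real.exp (e a)))) (by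
      intro a ha
      rw [Polynomial.eval_prod]
      exact Finset.prod_eq_zero ha (by simp))
    have h2 := hev (∏ a ∈ s, (Polynomial.X - Polynomial.C (Real.exp (e a)))) v l h
    rw [h1, LinearMap.zero_apply, eq_comm, smul_eq_zero, or_iff_left hv, Polynomial.eval_prod,
      Finset.prod_eq_zero_iff] at h2
    obtain ⟨a, ha, hl⟩ := h2
    have hl : l = Real.exp (e a) := by
      simpa [sub_eq_zero] using hl
    refine ⟨e a, fun τ => ?_⟩
    set S : Finset ℝ := s.image e
    have hinj : Set.InjOn Real.exp S := Real.exp_injective.injOn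
    -- With this p, A τ = p(A 1), so an eigenvector of A 1 is an eigenvector of the whole group.
    set p := Lagrange.interpolate S Real.exp fun c => Real.exp (τ * c)
    have hpe : ∀ b ∈ s, p.eval (Real.exp (e b)) = Real.exp (τ * e b) := fun b hb =>
      Lagrange.eval_interpolate_at_node _ hinj (Finset.mem_image_of_mem e hb)
    have h3 : A τ = Polynomial.aeval (A 1) p := by
      rw [hA, hp]
      exact Finset.sum_congr rfl fun b hb => by rw [hpe b hb]
    rw [h3, hev p v l h, hl, hpe a ha]

end Eigen

/-! ### Weight vectors as eigenvectors of the torus. -/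

section Weights

variable {n : ℕ} {V : Type*} [NormedAddCommGroup V] [NormedSpace ℝ V] [FiniteDimensional ℝ V]
  {ρ : Representation ℝ (Matrix.SpecialLinearGroup (Fin (n + 1)) ℝ) V}

theorem actsTo_smul_iff {H : cartan n} {v : V} {c : ℝ} :
    ActsTo ρ H v (c • v) ↔ ∀ t : ℝ, ρ (expCartan (t • H)) v = Real.exp (t * c) • v := by
  constructor
  · intro h
    have hd : ∀ t : ℝ, HasDerivAt (fun t : ℝ => ρ (expCartan (t • H)) v)
        (c • ρ (expCartan (t • H)) v) t := by
      intro t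
      have h1 : HasDerivAt (fun s : ℝ => ρ (expCartan ((s - t) • H)) v) (c • v) t :=
        HasDerivAt.comp_sub_const t t (by simpa [ActsTo] using h)
      have h2 := (LinearMap.toContinuousLinearMap (ρ (expCartan (t • H)))).hasFDerivAt.comp_hasDerivAt
        t h1
      have h3 : (fun t : ℝ => ρ (expCartan (t • H)) v) =
          ⇑(LinearMap.toContinuousLinearMap (ρ (expCartan (t • H)))) ∘
            fun s : ℝ => ρ (expCartan ((s - t) • H)) v := by
        funext s
        simp only [Function.comp, LinearMap.coe_toContinuousLinearMap', ← Module.End.mul_apply,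
          ← rep_expCartan_add, ← add_smul, add_sub_cancel]
      rw [h3]
      refine h2.congr_deriv ?_
      simp
    have hc : ∀ t : ℝ, HasDerivAt
        (fun t : ℝ => Real.exp (-(t * c)) • ρ (expCartan (t • H)) v) 0 t := by
      intro t
      have h1 : HasDerivAt (fun t : ℝ => Real.exp (-(t * c))) (Real.exp (-(t * c)) * -(1 * c)) t :=
        ((hasDerivAt_id t).mul_const c).neg.exp
      refine (h1.smul (hd t)).congr_deriv ?_
      rw [smul_smul, ← add_smul]
      simp
    intro t
    have h1 := is_const_of_deriv_eq_zero (fun t => (hc t).differentiableAt)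
      (fun t => (hc t).deriv) t 0
    simp only [zero_smul, zero_mul, neg_zero, Real.exp_zero, one_smul, expCartan_zero, map_one,
      Module.End.one_apply] at h1
    rw [← h1, smul_smul, ← Real.exp_add, add_neg_cancel, Real.exp_zero, one_smul, h1]
  · intro h
    have h1 : HasDerivAt (fun t : ℝ => Real.exp (t * c)) (Real.exp (0 * c) * (1 * c)) 0 :=
      ((hasDerivAt_id (0 : ℝ)).mul_const c).exp
    have h2 := h1.smul_const v
    simp only [zero_mul, Real.exp_zero, one_mul] at h2
    unfold ActsTo
    rwa [funext h]

theorem mem_weightSpace_iff {μ : Module.Dual ℝ (cartan n)} {v : V} :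
    v ∈ weightSpace ρ μ ↔ ∀ H, ρ (expCartan H) v = Real.exp (μ H) • v := by
  constructor
  · intro h H
    simpa using actsTo_smul_iff.1 (h H) 1
  · intro h H
    exact actsTo_smul_iff.2 fun t => by simpa using h (t • H)

/-- Weight spaces lie in joint generalized eigenspaces of a commuting family, and distinct weights
have distinct characters because the real exponential is injective. -/
theorem iSupIndep_weightSpace : iSupIndep (weightSpace ρ) := by
  have h := Module.End.independent_iInf_maxGenEigenspace_of_forall_mapsTo
    (fun H : cartan n => ρ (expCartan H)) fun H K φ =>
      Module.End.mapsTo_maxGenEigenspace_of_comm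
        (show Commute (ρ (expCartan K)) (ρ (expCartan H)) by
          rw [Commute, SemiconjBy, ← rep_expCartan_add, ← rep_expCartan_add, add_comm K H]) φ
  have hinj : Function.Injective
      fun (μ : Module.Dual ℝ (cartan n)) (H : cartan n) => Real.exp (μ H) := by
    intro μ ν e
    ext1 H
    exact Real.exp_injective (congrFun e H)
  refine (h.comp hinj).mono fun μ v hv => ?_
  refine (Submodule.mem_iInf _).2 fun H => ?_
  exact (Module.End.genEigenspace _ _).monotone (by simp : (1 : ℕ∞) ≤ ⊤)
    (Module.End.mem_eigenspace_iff.2 (mem_weightSpace_iff.1 hv H))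

/-- The torus element is w(e^τ) w(1)⁻¹, and w(t) is a product of three root elements with parameters
t, −1/t, t. Each factor acts polynomially in its parameter, so only integral powers of e^τ occur. -/
theorem rep_expCartan_coroot_eq_sum (hρ : ∀ w : V, Continuous fun g => ρ g w)
    {i j : Fin (n + 1)} (hij : i ≠ j) :
    ∃ (ι : Type) (s : Finset ι) (e : ι → ℝ) (Q : ι → Module.End ℝ V),
      ∀ τ : ℝ, ρ (expCartan (τ • coroot i j)) = ∑ a ∈ s, Real.exp (τ * e a) • Q a := by
  obtain ⟨X, N, hX, -⟩ := exists_generator ρ hρ hij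
  obtain ⟨Y, M, hY, -⟩ := exists_generator ρ hρ hij.symm
  refine ⟨ℕ × ℕ × ℕ, Finset.range (N + 2) ×ˢ Finset.range (M + 2) ×ˢ Finset.range (N + 2),
    fun a => (a.1 : ℝ) - a.2.1 + a.2.2,
    fun a => ((a.1.factorial : ℝ)⁻¹ * ((-1) ^ a.2.1 * (a.2.1.factorial : ℝ)⁻¹) *
      (a.2.2.factorial : ℝ)⁻¹) • (X ^ a.1 * Y ^ a.2.1 * X ^ a.2.2 * ρ (weylElt i j 1)⁻¹), ?_⟩
  intro τ
  have h1 : expCartan (τ • coroot i j) = weylElt i j (Real.exp τ) * (weylElt i j 1)⁻¹ := by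
    rw [← expCartan_coroot_mul_weylElt hij, mul_inv_cancel_right]
  have h2 : ∀ (f g h : ℕ → Module.End ℝ V) (W : Module.End ℝ V),
      (∑ k ∈ Finset.range (N + 2), f k) * (∑ k ∈ Finset.range (M + 2), g k) * (∑ k ∈ Finset.range (N + 2), h k) * W =
      ∑ a ∈ Finset.range (N + 2) ×ˢ Finset.range (M + 2) ×ˢ Finset.range (N + 2),
        f a.1 * g a.2.1 * h a.2.2 * W := by
    intro f g h W
    rw [Finset.sum_product, Finset.sum_mul, Finset.sum_mul, Finset.sum_mul]
    refine Finset.sum_congr rfl fun a _ => ?_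
    rw [Finset.sum_product, Finset.mul_sum (Finset.range (M + 2)) g, Finset.sum_mul_sum, Finset.sum_mul]
    refine Finset.sum_congr rfl fun b _ => ?_
    rw [Finset.sum_mul]
  rw [h1, weylElt, map_mul, map_mul, map_mul, hX, hY, h2]
  refine Finset.sum_congr rfl fun a _ => ?_
  simp only [smul_mul_assoc, mul_smul_comm, smul_smul]
  congr 1
  rw [mul_add, mul_sub, Real.exp_add, Real.exp_sub, mul_comm τ, mul_comm τ, mul_comm τ,
    Real.exp_nat_mul, Real.exp_nat_mul, Real.exp_nat_mul, neg_pow, inv_pow]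
  field_simp

end Weights

/-! ### The weight decomposition and its projections. -/

section Decomposition

variable {n : ℕ} {V : Type*} [NormedAddCommGroup V] [NormedSpace ℝ V]
  {ρ : Representation ℝ (Matrix.SpecialLinearGroup (Fin (n + 1)) ℝ) V}

theorem cartan_eq_sum_coroot (H : cartan n) :
    H = ∑ k : Fin n, (-(H : Matrix (Fin (n + 1)) (Fin (n + 1)) ℝ) k.succ k.succ) •
      coroot 0 k.succ := by
  have htr := H.2.2
  rw [trace, Fin.sum_univ_succ] at htr
  apply cartan_ext
  intro a
  have h1 : ∀ a : Fin (n + 1), ((∑ k : Fin n,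
      (-(H : Matrix (Fin (n + 1)) (Fin (n + 1)) ℝ) k.succ k.succ) • coroot 0 k.succ : cartan n) :
      Matrix (Fin (n + 1)) (Fin (n + 1)) ℝ) a a =
      ∑ k : Fin n, (-(H : Matrix (Fin (n + 1)) (Fin (n + 1)) ℝ) k.succ k.succ) *
        ((Pi.single 0 1 : Fin (n + 1) → ℝ) a - (Pi.single k.succ 1 : Fin (n + 1) → ℝ) a) := by
    intro a
    rw [Submodule.coe_sum, Matrix.sum_apply]
    refine Finset.sum_congr rfl fun k _ => ?_
    rw [Submodule.coe_smul, Matrix.smul_apply, coroot_diag, smul_eq_mul]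
  rw [h1]
  refine Fin.cases ?_ (fun i => ?_) a
  · simp only [Pi.single_eq_same, Pi.single_eq_of_ne (Fin.succ_ne_zero _).symm, sub_zero, mul_one,
      Finset.sum_neg_distrib]
    simp only [diag_apply] at htr
    linarith
  · rw [Finset.sum_eq_single i]
    · simp
    · intro k _ hk
      simp [Ne.symm hk]
    · simp

theorem rep_expCartan_sum {v : V} {c : Fin n → ℝ}
    (h : ∀ k τ, ρ (expCartan (τ • coroot 0 k.succ)) v = Real.exp (τ * c k) • v) (t : Fin n → ℝ)
    (F : Finset (Fin n)) :
    ρ (expCartan (∑ k ∈ F, t k • coroot 0 k.succ)) v = Real.exp (∑ k ∈ F, t k * c k) • v := by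
  classical
  induction F using Finset.induction_on with
  | empty => simp [expCartan_zero]
  | insert k F hk ih =>
    rw [Finset.sum_insert hk, Finset.sum_insert hk, rep_expCartan_add, Module.End.mul_apply, ih,
      map_smul, h, smul_smul, Real.exp_add, mul_comm]

theorem mem_iSup_weightSpace [FiniteDimensional ℝ V] {v : V}
    (h : ∀ k : Fin n, ∃ c : ℝ, ∀ τ : ℝ,
      ρ (expCartan (τ • coroot 0 k.succ)) v = Real.exp (τ * c) • v) :
    v ∈ ⨆ μ, weightSpace ρ μ := by
  choose c hc using h
  set μ : Module.Dual ℝ (cartan n) := ∑ k : Fin n, (-(c k)) •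
    ((Matrix.entryLinearMap ℝ ℝ k.succ k.succ).comp (cartan n).subtype) with hμ
  refine Submodule.mem_iSup_of_mem μ (mem_weightSpace_iff.2 fun H => ?_)
  have h1 := rep_expCartan_sum hc
    (fun k => -(H : Matrix (Fin (n + 1)) (Fin (n + 1)) ℝ) k.succ k.succ) Finset.univ
  rw [← cartan_eq_sum_coroot] at h1
  rw [h1]
  congr 2
  simp [hμ, LinearMap.sum_apply, mul_comm]

/-- The coroots e_0 − e_k are diagonalized one at a time. The projections for a new one are
polynomials in its action, so they commute with the torus and preserve the eigenvectors already
found. -/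
theorem iSup_weightSpace_eq_top [FiniteDimensional ℝ V]
    (hρ : ∀ w : V, Continuous fun g => ρ g w) : ⨆ μ, weightSpace ρ μ = ⊤ := by
  classical
  have key : ∀ F : Finset (Fin n), Submodule.span ℝ {v : V | ∀ k ∈ F, ∃ c : ℝ, ∀ τ : ℝ,
      ρ (expCartan (τ • coroot 0 k.succ)) v = Real.exp (τ * c) • v} = ⊤ := by
    intro F
    induction F using Finset.induction_on with
    | empty => simp
    | insert k F hk ih =>
      rw [eq_top_iff, ← ih, Submodule.span_le]
      intro v hv
      set A : ℝ → Module.End ℝ V := fun τ => ρ (expCartan (τ • coroot 0 k.succ)) with hA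
      obtain ⟨ι, s, e, Q, hQ⟩ := rep_expCartan_coroot_eq_sum hρ (Fin.succ_ne_zero k).symm
      obtain ⟨⟨S, L, hL⟩, hc⟩ := exists_eigen_decomposition (A := A) hQ
        (by simp [hA, expCartan_zero]) (fun σ τ => by
          simp only [hA, add_smul, rep_expCartan_add])
      rw [SetLike.mem_coe, ← (hL v).1]
      refine Submodule.sum_mem _ fun l hl => Submodule.subset_span fun k' hk' => ?_
      rcases Finset.mem_insert.1 hk' with rfl | hk'
      · by_cases h0 : Polynomial.aeval (A 1) (L l) v = 0
        · exact ⟨0, fun τ => by simp [h0]⟩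
        · exact hc _ l h0 ((hL v).2 l hl)
      · obtain ⟨c, hc⟩ := hv k' hk'
        refine ⟨c, fun τ => ?_⟩
        have hcomm : Commute (ρ (expCartan (τ • coroot 0 k'.succ))) (A 1) := by
          simp only [hA]
          rw [Commute, SemiconjBy, ← rep_expCartan_add, ← rep_expCartan_add, add_comm (τ • _)]
        have h2 : Commute (ρ (expCartan (τ • coroot 0 k'.succ)))
            (Polynomial.aeval (A 1) (L l)) := by
          refine Polynomial.induction_on' (motive := fun p => Commute _ (Polynomial.aeval (A 1) p))
            (L l) (fun p q hp hq => by rw [map_add]; exact hp.add_right hq) fun j a => ?_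
          rw [Polynomial.aeval_monomial]
          exact (Algebra.commute_algebraMap_right a _).mul_right (hcomm.pow_right j)
        rw [← Module.End.mul_apply, h2.eq, Module.End.mul_apply, hc, map_smul]
  rw [eq_top_iff, ← key Finset.univ, Submodule.span_le]
  exact fun v hv => mem_iSup_weightSpace fun k => hv k (Finset.mem_univ k)

open Classical in
theorem isInternal_weightSpace [FiniteDimensional ℝ V]
    (hρ : ∀ w : V, Continuous fun g => ρ g w) : DirectSum.IsInternal (weightSpace ρ) :=
  DirectSum.isInternal_submodule_of_iSupIndep_of_iSup_eq_top iSupIndep_weightSpace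
    (iSup_weightSpace_eq_top hρ)

open Classical in
/-- The projection of `V` onto the weight space of weight `μ`. -/
noncomputable def weightProj
    (ρ : Representation ℝ (Matrix.SpecialLinearGroup (Fin (n + 1)) ℝ) V)
    (μ : Module.Dual ℝ (cartan n)) : V →ₗ[ℝ] V :=
  if h : DirectSum.IsInternal (weightSpace ρ) then
    (weightSpace ρ μ).subtype ∘ₗ DirectSum.component ℝ _ (fun μ => weightSpace ρ μ) μ ∘ₗ
      (LinearEquiv.ofBijective (DirectSum.coeLinearMap (weightSpace ρ)) h).symm.toLinearMap
  else 0

open Classical in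
/-- The sum of the weight components of a vector with weight in `P`. -/
noncomputable def cut
    (ρ : Representation ℝ (Matrix.SpecialLinearGroup (Fin (n + 1)) ℝ) V)
    (P : Set (Module.Dual ℝ (cartan n))) : V →ₗ[ℝ] V :=
  if h : DirectSum.IsInternal (weightSpace ρ) then
    DirectSum.coeLinearMap (weightSpace ρ) ∘ₗ
      DFinsupp.filterLinearMap ℝ (fun μ => weightSpace ρ μ) (· ∈ P) ∘ₗ
      (LinearEquiv.ofBijective (DirectSum.coeLinearMap (weightSpace ρ)) h).symm.toLinearMap
  else 0

variable [FiniteDimensional ℝ V] (hρ : ∀ w : V, Continuous fun g => ρ g w)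
include hρ

open Classical in
theorem weightProj_coe (x : DirectSum (Module.Dual ℝ (cartan n)) fun μ => weightSpace ρ μ)
    (μ : Module.Dual ℝ (cartan n)) :
    weightProj ρ μ (DirectSum.coeLinearMap (weightSpace ρ) x) = x μ := by
  have h := isInternal_weightSpace hρ
  rw [weightProj, dif_pos h]
  have : (LinearEquiv.ofBijective (DirectSum.coeLinearMap (weightSpace ρ)) h).symm
      (DirectSum.coeLinearMap (weightSpace ρ) x) = x :=
    (LinearEquiv.ofBijective (DirectSum.coeLinearMap (weightSpace ρ)) h).symm_apply_apply x
  simp only [LinearMap.comp_apply, LinearEquiv.coe_coe, this]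
  rfl

open Classical in
theorem exists_coe_eq (v : V) :
    ∃ x, DirectSum.coeLinearMap (weightSpace ρ) x = v :=
  (isInternal_weightSpace hρ).2 v

theorem weightProj_mem (μ : Module.Dual ℝ (cartan n)) (v : V) :
    weightProj ρ μ v ∈ weightSpace ρ μ := by
  obtain ⟨x, rfl⟩ := exists_coe_eq hρ v
  rw [weightProj_coe hρ]
  exact (x μ).2

theorem weightProj_of_mem {μ : Module.Dual ℝ (cartan n)} {v : V} (hv : v ∈ weightSpace ρ μ) :
    weightProj ρ μ v = v := by
  classical
  have := weightProj_coe hρ (DirectSum.lof ℝ _ (fun μ => weightSpace ρ μ) μ ⟨v, hv⟩) μ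
  rwa [DirectSum.coeLinearMap_lof, DirectSum.lof_apply] at this

theorem weightProj_of_mem_of_ne {μ ν : Module.Dual ℝ (cartan n)} {v : V}
    (hv : v ∈ weightSpace ρ μ) (h : ν ≠ μ) : weightProj ρ ν v = 0 := by
  classical
  have := weightProj_coe hρ (DirectSum.lof ℝ _ (fun μ => weightSpace ρ μ) μ ⟨v, hv⟩) ν
  rwa [DirectSum.coeLinearMap_lof, DirectSum.lof_eq_of,
    DirectSum.of_eq_of_ne _ _ _ h, ZeroMemClass.coe_zero] at this

theorem eq_of_weightProj_eq {v w : V} (h : ∀ μ, weightProj ρ μ v = weightProj ρ μ w) : v = w := by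
  obtain ⟨x, rfl⟩ := exists_coe_eq hρ v
  obtain ⟨y, rfl⟩ := exists_coe_eq hρ w
  congr 1
  refine DFinsupp.ext fun μ => Subtype.ext ?_
  simpa only [weightProj_coe hρ] using h μ

theorem finite_support_weightProj (v : V) : {μ | weightProj ρ μ v ≠ 0}.Finite := by
  classical
  obtain ⟨x, rfl⟩ := exists_coe_eq hρ v
  refine (DFinsupp.support x).finite_toSet.subset fun μ hμ => ?_
  simpa [weightProj_coe hρ] using hμ

open Classical in
theorem weightProj_cut (P : Set (Module.Dual ℝ (cartan n))) (μ : Module.Dual ℝ (cartan n))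
    (v : V) : weightProj ρ μ (cut ρ P v) = if μ ∈ P then weightProj ρ μ v else 0 := by
  have h := isInternal_weightSpace hρ
  obtain ⟨x, rfl⟩ := exists_coe_eq hρ v
  rw [cut, dif_pos h]
  have : (LinearEquiv.ofBijective (DirectSum.coeLinearMap (weightSpace ρ)) h).symm
      (DirectSum.coeLinearMap (weightSpace ρ) x) = x :=
    (LinearEquiv.ofBijective (DirectSum.coeLinearMap (weightSpace ρ)) h).symm_apply_apply x
  simp only [LinearMap.comp_apply, LinearEquiv.coe_coe, this, weightProj_coe hρ]
  change ((DFinsupp.filter (· ∈ P) x) μ : V) = _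
  rw [DFinsupp.filter_apply]
  split_ifs <;> rfl

theorem mem_of_weightProj_mem (F : Submodule ℝ V) {v : V} (h : ∀ μ, weightProj ρ μ v ∈ F) :
    v ∈ F := by
  classical
  obtain ⟨x, rfl⟩ := exists_coe_eq hρ v
  rw [DirectSum.coeLinearMap_eq_dfinsuppSum]
  refine Submodule.dfinsuppSum_mem _ _ _ fun μ _ => ?_
  have := h μ
  rwa [weightProj_coe hρ] at this

theorem mem_weightsOf_iff {μ : Module.Dual ℝ (cartan n)} {w : V} :
    μ ∈ weightsOf ρ w ↔ weightProj ρ μ w ≠ 0 := by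
  classical
  constructor
  · rintro ⟨c, hc, rfl, h0⟩
    rw [Finsupp.sum, map_sum, Finset.sum_eq_single μ]
    · rwa [weightProj_of_mem hρ (hc μ)]
    · exact fun ν _ hν => weightProj_of_mem_of_ne hρ (hc ν) hν.symm
    · intro h
      rw [Finsupp.notMem_support_iff.1 h, map_zero]
  · intro h
    refine ⟨Finsupp.onFinset (finite_support_weightProj hρ w).toFinset
      (fun ν => weightProj ρ ν w) fun ν hν => by simpa using hν, fun ν => ?_, ?_, h⟩
    · exact weightProj_mem hρ ν w
    · rw [Finsupp.onFinset_sum _ (fun _ => rfl)]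
      refine eq_of_weightProj_eq hρ fun ν => ?_
      rw [map_sum]
      by_cases hν : weightProj ρ ν w = 0
      · rw [hν]
        refine Finset.sum_eq_zero fun κ _ => ?_
        by_cases e : ν = κ
        · subst e; rw [weightProj_of_mem hρ (weightProj_mem hρ _ _), hν]
        · exact weightProj_of_mem_of_ne hρ (weightProj_mem hρ _ _) e
      · rw [Finset.sum_eq_single ν]
        · exact weightProj_of_mem hρ (weightProj_mem hρ _ _)
        · exact fun κ _ hκ => weightProj_of_mem_of_ne hρ (weightProj_mem hρ _ _) hκ.symm
        · intro hn
          exact absurd (by simpa using hν) hn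

end Decomposition

/-! ### Action of root and Weyl elements on weights; SL₂ theory. -/

section RootAction

variable {n : ℕ} {V : Type*} [NormedAddCommGroup V] [NormedSpace ℝ V]
  {ρ : Representation ℝ (Matrix.SpecialLinearGroup (Fin (n + 1)) ℝ) V}

theorem root_coroot {i j : Fin (n + 1)} (hij : i ≠ j) : root i j (coroot i j) = 2 := by
  rw [root_apply, coroot_diag, coroot_diag]
  simp [hij, hij.symm]
  norm_num

theorem root_ne_zero {i j : Fin (n + 1)} (hij : i ≠ j) : root i j ≠ 0 := by
  intro h
  have := root_coroot hij
  rw [h] at this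
  simp at this

/-- The reflection of weights attached to the root `(i, j)`. -/
def reflection (i j : Fin (n + 1)) (μ : Module.Dual ℝ (cartan n)) : Module.Dual ℝ (cartan n) :=
  μ - μ (coroot i j) • root i j

theorem reflection_swap (i j : Fin (n + 1)) (μ : Module.Dual ℝ (cartan n)) :
    reflection j i μ = reflection i j μ := by
  rw [reflection, reflection, coroot_swap, root_swap]
  simp

theorem reflection_reflection {i j : Fin (n + 1)} (hij : i ≠ j) (μ : Module.Dual ℝ (cartan n)) :
    reflection i j (reflection i j μ) = μ := by
  simp only [reflection, LinearMap.sub_apply, LinearMap.smul_apply, root_coroot hij]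
  ext H
  simp
  ring

/-- The subspace of vectors fixed by the one-parameter group of the root `(i, j)`. -/
def rootFixed (ρ : Representation ℝ (Matrix.SpecialLinearGroup (Fin (n + 1)) ℝ) V)
    (i j : Fin (n + 1)) : Submodule ℝ V where
  carrier := {v | ∀ t, ρ (rootElt i j t) v = v}
  add_mem' ha hb t := by rw [map_add, ha t, hb t]
  zero_mem' t := map_zero _
  smul_mem' c v hv t := by rw [map_smul, hv t]

variable [FiniteDimensional ℝ V] (hρ : ∀ w : V, Continuous fun g => ρ g w)
include hρ

theorem weightProj_map {T : V →ₗ[ℝ] V}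
    {f : Module.Dual ℝ (cartan n) → Module.Dual ℝ (cartan n)} (hf : Function.Injective f)
    (hT : ∀ μ, ∀ v ∈ weightSpace ρ μ, T v ∈ weightSpace ρ (f μ))
    (μ : Module.Dual ℝ (cartan n)) (v : V) :
    weightProj ρ (f μ) (T v) = T (weightProj ρ μ v) := by
  refine mem_of_weightProj_mem hρ
    (LinearMap.eqLocus (weightProj ρ (f μ) ∘ₗ T) (T ∘ₗ weightProj ρ μ)) fun ν => ?_
  have h := weightProj_mem hρ ν v
  rw [LinearMap.mem_eqLocus, LinearMap.comp_apply, LinearMap.comp_apply]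
  by_cases e : μ = ν
  · subst e
    rw [weightProj_of_mem hρ (hT _ _ h), weightProj_of_mem hρ h]
  · rw [weightProj_of_mem_of_ne hρ (hT _ _ h) (hf.ne e), weightProj_of_mem_of_ne hρ h e, map_zero]

theorem exists_raising {i j : Fin (n + 1)} (hij : i ≠ j) :
    ∃ (X : Module.End ℝ V) (N : ℕ),
      (∀ t : ℝ, ρ (rootElt i j t) = ∑ k ∈ Finset.range (N + 2), (t ^ k / k.factorial) • X ^ k) ∧
      (∀ (k : ℕ) μ v, weightProj ρ μ ((X ^ k) v) =
        (X ^ k) (weightProj ρ (μ - (k : ℝ) • root i j) v)) ∧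
      ∀ v, v ∈ rootFixed ρ i j ↔ X v = 0 := by
  obtain ⟨X, N, hX, hH, h0⟩ := exists_generator ρ hρ hij
  refine ⟨X, N, hX, fun k μ v => ?_, fun v => ⟨h0 v, fun hv t => ?_⟩⟩
  · have hf : Function.Injective fun μ : Module.Dual ℝ (cartan n) => μ + (k : ℝ) • root i j :=
      add_left_injective _
    have := weightProj_map hρ (T := X ^ k) hf (fun μ v hv => ?_) (μ - (k : ℝ) • root i j) v
    · simpa using this
    · induction k generalizing μ v with
      | zero => simpa using hv
      | succ k ih =>
        rw [pow_succ', Module.End.mul_apply]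
        have h1 := mem_weightSpace_iff.1 (ih (add_left_injective _) μ v hv)
        refine mem_weightSpace_iff.2 fun H => ?_
        rw [← Module.End.mul_apply, hH, LinearMap.smul_apply, Module.End.mul_apply, h1, map_smul,
          smul_smul, ← Real.exp_add]
        congr 2
        simp
        ring
  · rw [hX, LinearMap.sum_apply, Finset.sum_range_succ']
    rw [Finset.sum_eq_zero]
    · simp
    · intro k _
      rw [LinearMap.smul_apply, pow_succ X, Module.End.mul_apply, hv, map_zero, smul_zero]

theorem weightProj_rootElt_congr {i j : Fin (n + 1)} (hij : i ≠ j) (t : ℝ)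
    {μ : Module.Dual ℝ (cartan n)} {v w : V}
    (h : ∀ k : ℕ, weightProj ρ (μ - (k : ℝ) • root i j) v =
      weightProj ρ (μ - (k : ℝ) • root i j) w) :
    weightProj ρ μ (ρ (rootElt i j t) v) = weightProj ρ μ (ρ (rootElt i j t) w) := by
  obtain ⟨X, N, hX, hw, -⟩ := exists_raising hρ hij
  simp only [hX, LinearMap.sum_apply, LinearMap.smul_apply, map_sum, map_smul, hw, h]

theorem exists_weightProj_ne_zero {i j : Fin (n + 1)} (hij : i ≠ j) (t : ℝ)
    {μ : Module.Dual ℝ (cartan n)} {v : V} (h : weightProj ρ μ (ρ (rootElt i j t) v) ≠ 0) :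
    ∃ k : ℕ, weightProj ρ (μ - (k : ℝ) • root i j) v ≠ 0 := by
  by_contra! h0
  refine h ?_
  rw [weightProj_rootElt_congr hρ hij t (w := 0) (fun k => by rw [h0, map_zero]), map_zero,
    map_zero]

theorem weightProj_rootElt_eq {i j : Fin (n + 1)} (hij : i ≠ j) (t : ℝ)
    {μ : Module.Dual ℝ (cartan n)} {v : V}
    (h : ∀ k : ℕ, 1 ≤ k → weightProj ρ (μ - (k : ℝ) • root i j) v = 0) :
    weightProj ρ μ (ρ (rootElt i j t) v) = weightProj ρ μ v := by
  obtain ⟨X, N, hX, hw, -⟩ := exists_raising hρ hij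
  rw [hX, LinearMap.sum_apply, map_sum, Finset.sum_range_succ', Finset.sum_eq_zero]
  · simp
  · intro k _
    rw [LinearMap.smul_apply, map_smul, hw, h _ (by omega), map_zero, smul_zero]

/-- Under these vanishing assumptions only the linear term of the exponential reaches μ, so the
component there is t X v_{μ−α}; it vanishes exactly when X kills v_{μ−α}. -/
theorem weightProj_sub_mem_rootFixed {i j : Fin (n + 1)} (hij : i ≠ j) {t : ℝ} (ht : t ≠ 0)
    {μ : Module.Dual ℝ (cartan n)} {v : V} (h0 : weightProj ρ μ v = 0)
    (h : ∀ k : ℕ, 2 ≤ k → weightProj ρ (μ - (k : ℝ) • root i j) v = 0)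
    (h1 : weightProj ρ μ (ρ (rootElt i j t) v) = 0) :
    weightProj ρ (μ - root i j) v ∈ rootFixed ρ i j := by
  obtain ⟨X, N, hX, hw, hf⟩ := exists_raising hρ hij
  rw [hf]
  rw [hX, LinearMap.sum_apply, map_sum, Finset.sum_range_succ', Finset.sum_range_succ',
    Finset.sum_eq_zero] at h1
  · simp only [LinearMap.smul_apply, map_smul, hw] at h1
    simpa [h0, ht] using h1
  · intro k _
    rw [LinearMap.smul_apply, map_smul, hw, h _ (by omega), map_zero, smul_zero]

theorem weightProj_mem_rootFixed {i j : Fin (n + 1)} (hij : i ≠ j) {v : V}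
    (h : v ∈ rootFixed ρ i j) (μ : Module.Dual ℝ (cartan n)) :
    weightProj ρ μ v ∈ rootFixed ρ i j := by
  obtain ⟨X, N, hX, hw, hf⟩ := exists_raising hρ hij
  rw [hf] at h ⊢
  have := hw 1 (μ + root i j) v
  simpa [h] using this.symm

/-- For a weight vector a single parameter suffices: the component of weight μ + α of u(t)v is t X
v. -/
theorem mem_rootFixed_of_weight {i j : Fin (n + 1)} (hij : i ≠ j) {t : ℝ} (ht : t ≠ 0)
    {μ : Module.Dual ℝ (cartan n)} {v : V} (hv : v ∈ weightSpace ρ μ)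
    (h : ρ (rootElt i j t) v = v) : v ∈ rootFixed ρ i j := by
  have hr := root_ne_zero hij
  have key : ∀ c : ℝ, c ≠ 0 → weightProj ρ (μ + c • root i j) v = 0 := fun c hc =>
    weightProj_of_mem_of_ne hρ hv (by simpa using ⟨hc, hr⟩)
  have h1 := weightProj_sub_mem_rootFixed hρ hij ht (μ := μ + root i j) (v := v)
    (by simpa using key 1 one_ne_zero) (fun k hk => by
      have := key (1 - k) (by
        have : (2 : ℝ) ≤ k := by exact_mod_cast hk
        linarith)
      rw [← this]
      congr 2
      module) (by rw [h]; simpa using key 1 one_ne_zero)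
  rwa [add_sub_cancel_right, weightProj_of_mem hρ hv] at h1

theorem weightProj_weylElt {i j : Fin (n + 1)} (hij : i ≠ j) {t : ℝ} (ht : t ≠ 0)
    (μ : Module.Dual ℝ (cartan n)) (v : V) :
    weightProj ρ (reflection i j μ) (ρ (weylElt i j t) v) =
      ρ (weylElt i j t) (weightProj ρ μ v) := by
  refine weightProj_map hρ (f := reflection i j)
    (Function.LeftInverse.injective (reflection_reflection hij)) (fun μ v hv => ?_) μ v
  refine mem_weightSpace_iff.2 fun H => ?_
  have h1 : ρ (weylElt i j t) (ρ (expCartan (H - root i j H • coroot i j)) v) =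
      ρ (expCartan H) (ρ (weylElt i j t) v) := by
    rw [← Module.End.mul_apply, ← map_mul, weylElt_mul_expCartan hij ht, map_mul,
      Module.End.mul_apply]
    congr 3
    rw [map_sub, map_smul, root_coroot hij]
    module
  rw [← h1, mem_weightSpace_iff.1 hv, map_smul]
  congr 2
  simp [reflection, mul_comm]

/-- By the identity u_{−α}(−1/t) u_α(t) = w u_{−α}(1/t), the weight s_α μ occurs in u_{−α}(−1/t)
u_α(t) v. Since u_{−α} only subtracts multiples of α, it comes from some s_α μ + kα in u_α(t) v.
This is the only source of weights of u(x)v in the proof. -/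
theorem exists_weightProj_reflection_ne_zero {i j : Fin (n + 1)} (hij : i ≠ j) {t : ℝ}
    (ht : t ≠ 0) {μ : Module.Dual ℝ (cartan n)} {v : V}
    (h : weightProj ρ μ (ρ (rootElt j i t⁻¹) v) ≠ 0) :
    ∃ k : ℕ, weightProj ρ (reflection i j μ + (k : ℝ) • root i j) (ρ (rootElt i j t) v) ≠ 0 := by
  have ht' : -t⁻¹ ≠ 0 := neg_ne_zero.2 (inv_ne_zero ht)
  have h1 : weightProj ρ (reflection i j μ)
      (ρ (rootElt j i (-t⁻¹)) (ρ (rootElt i j t) v)) ≠ 0 := by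
    have e : ρ (rootElt j i (-t⁻¹)) (ρ (rootElt i j t) v) =
        ρ (weylElt j i (-t⁻¹)) (ρ (rootElt j i t⁻¹) v) := by
      rw [← rootElt_inv, rootElt_eq_mul_weylElt_mul (i := i) (j := j) (t := t), map_mul, map_mul,
        Module.End.mul_apply, Module.End.mul_apply, ← Module.End.mul_apply, ← map_mul,
        inv_mul_cancel, map_one, Module.End.one_apply]
    rw [e, ← reflection_swap, weightProj_weylElt hρ hij.symm ht']
    intro h2
    refine h ?_
    have := congrArg (ρ (weylElt j i (-t⁻¹))⁻¹) h2
    rwa [← Module.End.mul_apply, ← map_mul, inv_mul_cancel, map_one, Module.End.one_apply,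
      map_zero] at this
  obtain ⟨k, hk⟩ := exists_weightProj_ne_zero hρ hij.symm _ h1
  refine ⟨k, ?_⟩
  rwa [root_swap i j, smul_neg, sub_neg_eq_add] at hk

/-- A highest weight vector for SL₂ has nonnegative weight, and weight zero means trivial
representation. Both follow by reflecting: a weight of u_{−α} v would otherwise give a second weight
of v. -/
theorem coroot_nonneg_of_mem_rootFixed {i j : Fin (n + 1)} (hij : i ≠ j)
    {μ : Module.Dual ℝ (cartan n)} {v : V} (hv : v ∈ weightSpace ρ μ) (hv0 : v ≠ 0)
    (h : v ∈ rootFixed ρ i j) :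
    0 ≤ μ (coroot i j) ∧ (μ (coroot i j) = 0 → v ∈ rootFixed ρ j i) := by
  have hr := root_ne_zero hij
  have key : ∀ c : ℝ, c ≠ 0 → weightProj ρ (μ + c • root i j) v = 0 := fun c hc =>
    weightProj_of_mem_of_ne hρ hv (by simpa using ⟨hc, hr⟩)
  have key' : ∀ c : ℝ, weightProj ρ (μ + c • root i j) v ≠ 0 → c = 0 := fun c hc => by
    by_contra h0; exact hc (key c h0)
  constructor
  · have h1 : weightProj ρ μ (ρ (rootElt j i (1 : ℝ)⁻¹) v) ≠ 0 := by
      rw [weightProj_rootElt_eq hρ hij.symm, weightProj_of_mem hρ hv]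
      · exact hv0
      · intro k hk
        have := key k (by positivity)
        rwa [root_swap i j, smul_neg, sub_neg_eq_add]
    obtain ⟨k, hk⟩ := exists_weightProj_reflection_ne_zero hρ hij one_ne_zero h1
    rw [h 1] at hk
    have := key' (-μ (coroot i j) + k) (by
      convert hk using 3
      rw [reflection]; module)
    have h2 : (0 : ℝ) ≤ k := k.cast_nonneg
    linarith
  · intro h0
    have h1 : weightProj ρ (μ - root i j) v = 0 := by
      have := key (-1) (by norm_num)
      rw [← this]
      congr 2
      module
    have h2 : weightProj ρ (μ - root i j) (ρ (rootElt j i (1 : ℝ)⁻¹) v) = 0 := by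
      by_contra h3
      obtain ⟨k, hk⟩ := exists_weightProj_reflection_ne_zero hρ hij one_ne_zero h3
      rw [h 1] at hk
      have := key' (1 + k) (by
        convert hk using 3
        rw [reflection, LinearMap.sub_apply, h0, root_coroot hij]; module)
      have h2 : (0 : ℝ) ≤ k := k.cast_nonneg
      linarith
    have h4 := weightProj_sub_mem_rootFixed hρ hij.symm (inv_ne_zero one_ne_zero) h1
      (fun k hk => by
        have := key (k - 1) (by
          have : (2 : ℝ) ≤ k := by exact_mod_cast hk
          linarith)
        rw [← this, root_swap i j]
        congr 2
        module) h2
    rwa [root_swap i j, sub_neg_eq_add, sub_add_cancel, weightProj_of_mem hρ hv] at h4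

end RootAction

/-! ### Values of the roots e_0 − e_k on H_C, on coroot sums and on the level elements. -/

section Pairings

variable (n : ℕ)

/-- The natural number `k` as a row index of `SL(n+1, ℝ)`; meaningful for `k ≤ n`. -/
def nth (k : ℕ) : Fin (n + 1) := Fin.ofNat (n + 1) k

theorem nth_zero : nth n 0 = 0 := rfl

variable {n}

theorem val_nth {k : ℕ} (hk : k ≤ n) : (nth n k : ℕ) = k :=
  Nat.mod_eq_of_lt (Nat.lt_succ_of_le hk)

theorem nth_val (i : Fin (n + 1)) : nth n i = i :=
  Fin.ext (val_nth (Nat.le_of_lt_succ i.2))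

theorem nth_ne {i j : ℕ} (hi : i ≤ n) (hj : j ≤ n) (h : i ≠ j) : nth n i ≠ nth n j := by
  intro e
  have := congrArg Fin.val e
  rw [val_nth hi, val_nth hj] at this
  exact h this

theorem zero_ne_nth {k : ℕ} (h1 : 1 ≤ k) (hk : k ≤ n) : (0 : Fin (n + 1)) ≠ nth n k :=
  nth_ne (i := 0) (Nat.zero_le n) hk (by omega)

variable (n)

/-- The root `e_0 - e_k`. -/
def firstRoot (k : ℕ) : Module.Dual ℝ (cartan n) := root 0 (nth n k)

/-- The coroot `e_0 - e_k`. -/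
def firstCoroot (k : ℕ) : cartan n := coroot 0 (nth n k)

/-- The sum of the coroots `e_0 - e_i` over `1 ≤ i ≤ k`. -/
def corootSum : ℕ → cartan n
  | 0 => 0
  | k + 1 => corootSum k + firstCoroot n (k + 1)

/-- An element of the Cartan subalgebra killed by the roots `e_0 - e_k`, `1 ≤ k ≤ m`. -/
def levelElt (m : ℕ) : cartan n := ((m : ℝ) + 1) • firstCoroot n (m + 1) - corootSum n m

variable {n}

theorem corootSum_zero : corootSum n 0 = 0 := rfl

theorem corootSum_succ (k : ℕ) : corootSum n (k + 1) = corootSum n k + firstCoroot n (k + 1) := rfl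

theorem root_eq_firstRoot_sub (i j : ℕ) :
    root (nth n i) (nth n j) = firstRoot n j - firstRoot n i := by
  ext H; simp [firstRoot, root_apply]

theorem firstRoot_firstCoroot {m k : ℕ} (hm : 1 ≤ m) (hmn : m ≤ n) (hk : 1 ≤ k) (hkn : k ≤ n) :
    firstRoot n m (firstCoroot n k) = if k = m then 2 else 1 := by
  rw [firstRoot, firstCoroot, root_apply, coroot_diag, coroot_diag]
  have h1 := zero_ne_nth hm hmn
  have h2 := zero_ne_nth hk hkn
  split_ifs with h
  · subst h
    simp [h1, h1.symm]; norm_num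
  · have h3 := nth_ne hmn hkn (Ne.symm h)
    simp [h1.symm, h2, h3]

theorem firstRoot_corootSum {m k : ℕ} (hm : 1 ≤ m) (hmn : m ≤ n) (hkn : k ≤ n) :
    firstRoot n m (corootSum n k) = k + if m ≤ k then 1 else 0 := by
  induction k with
  | zero => simp [corootSum_zero]; omega
  | succ k ih =>
    rw [corootSum_succ, map_add, ih (by omega), firstRoot_firstCoroot hm hmn (by omega) hkn]
    by_cases h1 : m ≤ k
    · rw [if_pos h1, if_neg (by omega), if_pos (by omega)]; push_cast; ring
    · by_cases h2 : k + 1 = m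
      · rw [if_neg h1, if_pos h2, if_pos (by omega)]; push_cast; ring
      · rw [if_neg h1, if_neg h2, if_neg (by omega)]; push_cast; ring

theorem firstRoot_HC {m : ℕ} (hmn : m ≤ n) : firstRoot n m (HC n) = m := by
  rw [firstRoot, root_apply]
  simp [HC, val_nth hmn]

theorem corootSum_diag {k : ℕ} (hk : k ≤ n) (a : Fin (n + 1)) :
    (corootSum n k : Matrix (Fin (n + 1)) (Fin (n + 1)) ℝ) a a =
      if (a : ℕ) = 0 then (k : ℝ) else if (a : ℕ) ≤ k then -1 else 0 := by
  induction k with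
  | zero =>
    rw [corootSum_zero]
    by_cases h : (a : ℕ) = 0 <;> simp [h]
  | succ k ih =>
    rw [corootSum_succ, Submodule.coe_add, Matrix.add_apply, ih (by omega), firstCoroot,
      coroot_diag, Pi.single_apply, Pi.single_apply]
    have e1 : a = 0 ↔ (a : ℕ) = 0 := Fin.ext_iff
    have e2 : a = nth n (k + 1) ↔ (a : ℕ) = k + 1 := by rw [Fin.ext_iff, val_nth hk]
    simp only [e1, e2]
    split_ifs <;> first | omega | (push_cast; ring)

theorem Hk_eq {k : ℕ} (hk : 1 ≤ k ∧ k ≤ n) : Hk n k hk = ((n : ℝ) / k) • corootSum n k := by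
  have hk0 : (k : ℝ) ≠ 0 := by have := hk.1; positivity
  apply cartan_ext
  intro a
  rw [Submodule.coe_smul, Matrix.smul_apply, corootSum_diag hk.2]
  simp only [Hk, diagonal_apply_eq, smul_eq_mul]
  split_ifs <;> (field_simp; try simp)

theorem firstRoot_levelElt {m k : ℕ} (hk : 1 ≤ k) (hkm : k ≤ m) (hm : m + 1 ≤ n) :
    firstRoot n k (levelElt n m) = 0 := by
  rw [levelElt, map_sub, map_smul, firstRoot_corootSum hk (by omega) (by omega),
    firstRoot_firstCoroot hk (by omega) (by omega) hm, if_neg (by omega), if_pos hkm]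
  simp

theorem firstRoot_succ_levelElt {m : ℕ} (hm : m + 1 ≤ n) :
    firstRoot n (m + 1) (levelElt n m) = m + 2 := by
  rw [levelElt, map_sub, map_smul, firstRoot_corootSum (by omega) hm (by omega),
    firstRoot_firstCoroot (by omega) hm (by omega) hm, if_pos rfl, if_neg (by omega), smul_eq_mul]
  ring

theorem apply_levelElt (m : ℕ) (μ : Module.Dual ℝ (cartan n)) :
    μ (levelElt n m) = ((m : ℝ) + 1) * μ (firstCoroot n (m + 1)) - μ (corootSum n m) := by
  rw [levelElt, map_sub, map_smul, smul_eq_mul]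

end Pairings

/-! ### Partial products of u(x), top levels and lifting of weights. -/

section Unipotent

variable {n : ℕ} {V : Type*} [NormedAddCommGroup V] [NormedSpace ℝ V]
  (ρ : Representation ℝ (Matrix.SpecialLinearGroup (Fin (n + 1)) ℝ) V)

/-- The set of weights occurring in a vector. -/
def supp (v : V) : Set (Module.Dual ℝ (cartan n)) := {μ | weightProj ρ μ v ≠ 0}

/-- The product of the root elements of `e_0 - e_k`, `1 ≤ k ≤ m`, with parameters `x k`. -/
noncomputable def partialUnip (x : ℕ → ℝ) : ℕ → V →ₗ[ℝ] V
  | 0 => LinearMap.id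
  | m + 1 => ρ (rootElt 0 (nth n (m + 1)) (x (m + 1))) ∘ₗ partialUnip x m

variable {ρ}

theorem mem_supp {v : V} {μ : Module.Dual ℝ (cartan n)} :
    μ ∈ supp ρ v ↔ weightProj ρ μ v ≠ 0 := Iff.rfl

theorem partialUnip_zero (x : ℕ → ℝ) (v : V) : partialUnip ρ x 0 v = v := rfl

theorem partialUnip_succ (x : ℕ → ℝ) (m : ℕ) (v : V) :
    partialUnip ρ x (m + 1) v =
      ρ (rootElt 0 (nth n (m + 1)) (x (m + 1))) (partialUnip ρ x m v) := rfl

theorem partialUnip_eq_self {x : ℕ → ℝ} {m : ℕ} {v : V}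
    (h : ∀ k, 1 ≤ k → k ≤ m → v ∈ rootFixed ρ 0 (nth n k)) : partialUnip ρ x m v = v := by
  induction m with
  | zero => rfl
  | succ m ih =>
    rw [partialUnip_succ, ih fun k h1 h2 => h k h1 (by omega), h (m + 1) (by omega) le_rfl]

variable [FiniteDimensional ℝ V] (hρ : ∀ w : V, Continuous fun g => ρ g w)
include hρ

theorem finite_supp (v : V) : (supp ρ v).Finite := finite_support_weightProj hρ v

theorem supp_nonempty {v : V} (hv : v ≠ 0) : (supp ρ v).Nonempty := by
  by_contra h
  refine hv (eq_of_weightProj_eq hρ fun μ => ?_)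
  rw [map_zero]
  by_contra h1
  exact h ⟨μ, h1⟩

theorem supp_cut (P : Set (Module.Dual ℝ (cartan n))) (v : V) :
    supp ρ (cut ρ P v) = supp ρ v ∩ P := by
  classical
  ext μ
  rw [Set.mem_inter_iff, mem_supp, mem_supp, weightProj_cut hρ]
  split_ifs with h <;> simp [h]

theorem supp_rootElt {m : ℕ} (hm : 1 ≤ m) (hmn : m ≤ n) {t : ℝ} {v : V}
    {μ : Module.Dual ℝ (cartan n)} (h : μ ∈ supp ρ (ρ (rootElt 0 (nth n m) t) v)) :
    ∃ k : ℕ, μ - (k : ℝ) • firstRoot n m ∈ supp ρ v :=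
  exists_weightProj_ne_zero hρ (zero_ne_nth hm hmn) t h

theorem le_of_mem_supp_partialUnip {x : ℕ → ℝ} {m : ℕ} (hm : m ≤ n) {v : V} {b : ℝ}
    (hb : ∀ ν ∈ supp ρ v, b ≤ ν (HC n)) :
    ∀ μ ∈ supp ρ (partialUnip ρ x m v), b ≤ μ (HC n) := by
  induction m with
  | zero => exact hb
  | succ m ih =>
    intro μ hμ
    obtain ⟨k, hk⟩ := supp_rootElt hρ (by omega) hm hμ
    have := ih (by omega) _ hk
    rw [LinearMap.sub_apply, LinearMap.smul_apply, firstRoot_HC hm, smul_eq_mul] at this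
    have h2 : (0 : ℝ) ≤ k * ((m + 1 : ℕ) : ℝ) := by positivity
    linarith

/-- The first m root elements preserve the eigenspaces of any Z killed by their roots; Z will be the
level element. -/
theorem partialUnip_cut {x : ℕ → ℝ} {m : ℕ} (hm : m ≤ n) {Z : cartan n}
    (hZ : ∀ k, 1 ≤ k → k ≤ m → firstRoot n k Z = 0) (z : ℝ) (v : V) :
    partialUnip ρ x m (cut ρ {μ | μ Z = z} v) = cut ρ {μ | μ Z = z} (partialUnip ρ x m v) := by
  classical
  induction m with
  | zero => rfl
  | succ m ih =>
    rw [partialUnip_succ, partialUnip_succ, ih (by omega) fun k h1 h2 => hZ k h1 (by omega)]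
    refine eq_of_weightProj_eq hρ fun μ => ?_
    rw [weightProj_cut hρ]
    have h0 := zero_ne_nth (n := n) (k := m + 1) (by omega) hm
    have hz : ∀ k : ℕ, (μ - (k : ℝ) • root 0 (nth n (m + 1))) Z = μ Z := by
      intro k
      have := hZ (m + 1) (by omega) le_rfl
      rw [firstRoot] at this
      simp [this]
    split_ifs with h
    · refine weightProj_rootElt_congr hρ h0 _ fun k => ?_
      rw [weightProj_cut hρ, if_pos]
      rw [Set.mem_ofPred_eq, hz]
      exact h
    · rw [weightProj_rootElt_congr hρ h0 _ (w := 0) fun k => ?_, map_zero, map_zero]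
      rw [weightProj_cut hρ, if_neg, map_zero]
      rw [Set.mem_ofPred_eq, hz]
      exact h

/-- At the maximal level nothing can be cancelled: the opposite root element strictly lowers the
level, so no higher component flows into the top one. -/
theorem exists_top_level {m : ℕ} (hm : m + 1 ≤ n) (x : ℕ → ℝ) {v : V} (hv : v ≠ 0) :
    ∃ z : ℝ, cut ρ {μ | μ (levelElt n m) = z} v ≠ 0 ∧
      (∀ μ ∈ supp ρ (partialUnip ρ x m v), μ (levelElt n m) ≤ z) ∧
      ∀ μ ∈ supp ρ (partialUnip ρ x m (cut ρ {μ | μ (levelElt n m) = z} v)),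
        μ (levelElt n m) = z ∧ μ ∈ supp ρ (partialUnip ρ x m v) ∧
        ∀ t, μ ∈ supp ρ (ρ (rootElt (nth n (m + 1)) 0 t) (partialUnip ρ x m v)) := by
  classical
  obtain ⟨ν, hν, hmax⟩ := Set.exists_max_image (supp ρ v) (fun μ => μ (levelElt n m))
    (finite_supp hρ v) (supp_nonempty hρ hv)
  set z := ν (levelElt n m) with hz
  have hcut := fun z v => partialUnip_cut hρ (x := x) (show m ≤ n by omega) (Z := levelElt n m)
    (fun k h1 h2 => firstRoot_levelElt h1 h2 hm) z v
  have hle : ∀ μ ∈ supp ρ (partialUnip ρ x m v), μ (levelElt n m) ≤ z := by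
    intro μ hμ
    have h1 : μ ∈ supp ρ (cut ρ {κ | κ (levelElt n m) = μ (levelElt n m)}
        (partialUnip ρ x m v)) := by
      rw [supp_cut hρ]; exact ⟨hμ, rfl⟩
    rw [← hcut] at h1
    have h2 : cut ρ {κ | κ (levelElt n m) = μ (levelElt n m)} v ≠ 0 := by
      intro h
      rw [h, map_zero] at h1
      exact h1 (map_zero _)
    obtain ⟨κ, hκ⟩ := supp_nonempty hρ h2
    rw [supp_cut hρ] at hκ
    rw [← hκ.2]
    exact hmax κ hκ.1
  refine ⟨z, fun h => ?_, hle, fun μ hμ => ?_⟩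
  · have : ν ∈ supp ρ (cut ρ {μ | μ (levelElt n m) = z} v) := by
      rw [supp_cut hρ]; exact ⟨hν, rfl⟩
    rw [h] at this
    exact this (map_zero _)
  · rw [hcut, supp_cut hρ] at hμ
    refine ⟨hμ.2, hμ.1, fun t => ?_⟩
    rw [mem_supp, weightProj_rootElt_eq hρ (zero_ne_nth (by omega) hm).symm]
    · exact hμ.1
    · intro k hk
      by_contra h
      have h1 := hle _ h
      rw [root_swap 0, smul_neg, sub_neg_eq_add, LinearMap.add_apply, LinearMap.smul_apply,
        show root 0 (nth n (m + 1)) (levelElt n m) = m + 2 from firstRoot_succ_levelElt hm,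
        hμ.2, smul_eq_mul] at h1
      have h2 : (0 : ℝ) < k * (m + 2) := by positivity
      linarith

/-- Weights of `n y`, with `n` in the opposite root subgroup, produce weights of `u y`. -/
theorem exists_lift {m : ℕ} (hm : m + 1 ≤ n) {t : ℝ} (ht : t ≠ 0) {y : V}
    {κ : Module.Dual ℝ (cartan n)} (h : κ ∈ supp ρ (ρ (rootElt (nth n (m + 1)) 0 t⁻¹) y)) :
    ∃ j : ℕ, ∃ μ ∈ supp ρ (ρ (rootElt 0 (nth n (m + 1)) t) y),
      μ = reflection 0 (nth n (m + 1)) κ + (j : ℝ) • firstRoot n (m + 1) ∧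
      (∀ k : ℕ, k ≤ m → ((m : ℝ) + 1) * μ (corootSum n k) - k * μ (HC n) =
        (m + 1) * κ (corootSum n k) - k * κ (HC n)) ∧
      μ (corootSum n (m + 1)) - μ (HC n) = κ (corootSum n m) - κ (HC n) + j ∧
      μ (HC n) = κ (HC n) - (m + 1) * κ (firstCoroot n (m + 1)) + (m + 1) * j := by
  obtain ⟨j, hj⟩ := exists_weightProj_reflection_ne_zero hρ
    (zero_ne_nth (by omega) hm) ht h
  refine ⟨j, _, hj, rfl, ?_⟩
  -- The new weight lies on the α_{m+1}-string of κ, so all relations reduce to the values of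
  -- α_{m+1}: k on C_k for k ≤ m, m + 2 on C_{m+1}, and m + 1 on H_C.
  have e : ∀ H, (reflection 0 (nth n (m + 1)) κ + (j : ℝ) • root 0 (nth n (m + 1))) H =
      κ H + (j - κ (firstCoroot n (m + 1))) * firstRoot n (m + 1) H := by
    intro H
    simp [reflection, firstCoroot, firstRoot]
    ring
  simp only [e, firstRoot_HC hm]
  refine ⟨fun k hk => ?_, ?_, ?_⟩
  · rw [firstRoot_corootSum (by omega) hm (by omega), if_neg (by omega)]
    push_cast; ring
  · rw [firstRoot_corootSum (by omega) hm (by omega), if_pos le_rfl, corootSum_succ, map_add]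
    push_cast; ring
  · push_cast; ring

end Unipotent

/-! ### Propagated inequalities, the Coxeter element and commutation rules. -/

section Admissible

variable {n : ℕ}

/-- The inequalities on a weight of `u v` that are propagated from rank to rank. -/
def Admissible (b : ℝ) (m : ℕ) (μ : Module.Dual ℝ (cartan n)) : Prop :=
  μ (HC n) - b ≤ μ (corootSum n m) ∧
    ∀ k : ℕ, k ≤ m → k * (μ (HC n) - b) ≤ ((m : ℝ) + 1) * μ (corootSum n k)

/-- Since d ≥ 0, the inequality with factor m + 1 gives μ(C_k) ≥ 0, so it persists with the larger
factor m + 2. -/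
theorem admissible_succ {b : ℝ} {m : ℕ} {μ : Module.Dual ℝ (cartan n)} (h0 : b ≤ μ (HC n))
    (h1 : μ (HC n) - b ≤ μ (corootSum n (m + 1)))
    (h2 : ∀ k : ℕ, k ≤ m → k * (μ (HC n) - b) ≤ ((m : ℝ) + 1) * μ (corootSum n k)) :
    Admissible b (m + 1) μ := by
  have hm : (0 : ℝ) < (m : ℝ) + 1 := by positivity
  have hd : 0 ≤ μ (HC n) - b := by linarith
  refine ⟨h1, fun k hk => ?_⟩
  rcases Nat.lt_or_ge k (m + 1) with h | h
  · have h3 := h2 k (by omega)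
    have h4 : 0 ≤ (k : ℝ) * (μ (HC n) - b) := by positivity
    have h5 : 0 ≤ μ (corootSum n k) := by
      by_contra hneg
      have := mul_neg_of_pos_of_neg hm (not_le.1 hneg)
      linarith
    push_cast
    linarith
  · obtain rfl : k = m + 1 := by omega
    push_cast
    have := mul_le_mul_of_nonneg_left h1 hm.le
    linarith

/-- The composite of the reflections in the roots `e_0 - e_k`, `1 ≤ k ≤ m`. -/
def coxeter (n : ℕ) : ℕ → Module.Dual ℝ (cartan n) → Module.Dual ℝ (cartan n)
  | 0, ν => ν
  | m + 1, ν => reflection 0 (nth n (m + 1)) (coxeter n m ν)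

theorem coxeter_succ_apply (m : ℕ) (ν : Module.Dual ℝ (cartan n)) (H : cartan n) :
    coxeter n (m + 1) ν H =
      coxeter n m ν H - coxeter n m ν (firstCoroot n (m + 1)) * firstRoot n (m + 1) H := rfl

theorem firstCoroot_zero : firstCoroot n 0 = 0 := by
  rw [firstCoroot, nth_zero]
  exact cartan_ext fun i => by rw [coroot_diag]; simp

/-- In coordinates this is a cyclic permutation: entry 0 becomes ν_m and entry k becomes ν_{k−1} for
1 ≤ k ≤ m. -/
theorem coxeter_firstCoroot {m k : ℕ} (hm : m ≤ n) (hk : 1 ≤ k) (hkn : k ≤ n)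
    (ν : Module.Dual ℝ (cartan n)) :
    coxeter n m ν (firstCoroot n k) =
      (if k ≤ m then ν (firstCoroot n (k - 1)) else ν (firstCoroot n k)) -
        ν (firstCoroot n m) := by
  induction m generalizing k with
  | zero => rw [if_neg (by omega), firstCoroot_zero, map_zero, sub_zero]; rfl
  | succ m ih =>
    rw [coxeter_succ_apply, ih (by omega) hk hkn, ih (by omega) (by omega) hm,
      firstRoot_firstCoroot (by omega) hm hk hkn, if_neg (show ¬ m + 1 ≤ m by omega)]
    by_cases h1 : k ≤ m
    · rw [if_pos h1, if_neg (by omega), if_pos (by omega)]; ring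
    · by_cases h2 : k = m + 1
      · subst h2
        rw [if_neg h1, if_pos le_rfl, if_pos rfl, Nat.add_sub_cancel]; ring
      · rw [if_neg h1, if_neg h2, if_neg (by omega)]; ring

theorem coxeter_corootSum {m k : ℕ} (hm : m ≤ n) (hk : k + 1 ≤ m)
    (ν : Module.Dual ℝ (cartan n)) :
    coxeter n m ν (corootSum n (k + 1)) =
      ν (corootSum n k) - (k + 1) * ν (firstCoroot n m) := by
  induction k with
  | zero =>
    rw [corootSum_succ, map_add, coxeter_firstCoroot hm (by omega) (by omega), if_pos hk,
      corootSum_zero, Nat.sub_self, firstCoroot_zero]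
    simp
  | succ k ih =>
    rw [corootSum_succ, map_add, ih (by omega), coxeter_firstCoroot hm (by omega) (by omega),
      if_pos hk, Nat.add_sub_cancel, corootSum_succ, map_add]
    push_cast; ring

theorem coxeter_HC {m : ℕ} (hm : m ≤ n) (ν : Module.Dual ℝ (cartan n)) :
    coxeter n m ν (HC n) = ν (HC n) - (m + 1) * ν (firstCoroot n m) + ν (corootSum n m) := by
  induction m with
  | zero => simp [firstCoroot_zero, corootSum_zero, coxeter]
  | succ m ih =>
    rw [coxeter_succ_apply, ih (by omega), coxeter_firstCoroot (by omega) (by omega) hm,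
      firstRoot_HC hm, if_neg (by omega), corootSum_succ, map_add]
    push_cast; ring

theorem rootElt_mul_comm_of_chain {i o k : Fin (n + 1)} (hi : i ≠ o) (hk : k ≠ o) (hik : i ≠ k)
    (s t : ℝ) :
    rootElt i o s * rootElt o k t = rootElt o k t * (rootElt i k (s * t) * rootElt i o s) := by
  apply special_ext
  simp only [Matrix.SpecialLinearGroup.coe_mul, coe_rootElt hi, coe_rootElt hk.symm,
    coe_rootElt hik, mul_add, add_mul, one_mul, mul_one, single_mul_single_same,
    single_mul_single_of_ne _ _ _ _ hik.symm]
  abel_nf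
  simp

theorem rootElt_comm {p q i j : Fin (n + 1)} (hpq : p ≠ q) (hij : i ≠ j) (hqi : q ≠ i)
    (hjp : j ≠ p) (s t : ℝ) : rootElt p q s * rootElt i j t = rootElt i j t * rootElt p q s := by
  apply special_ext
  simp only [Matrix.SpecialLinearGroup.coe_mul, coe_rootElt hpq, coe_rootElt hij, mul_add,
    add_mul, one_mul, mul_one, single_mul_single_of_ne _ _ _ _ hqi,
    single_mul_single_of_ne _ _ _ _ hjp]
  abel

end Admissible

theorem rep_mul_apply {G V : Type*} [Group G] [AddCommGroup V] [Module ℝ V]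
    (ρ : Representation ℝ G V) (g h : G) (v : V) : ρ (g * h) v = ρ g (ρ h v) := by
  rw [map_mul, Module.End.mul_apply]

/-! ### Existence of admissible weights. -/

section Existence

variable {n : ℕ} {V : Type*} [NormedAddCommGroup V] [NormedSpace ℝ V] [FiniteDimensional ℝ V]
  {ρ : Representation ℝ (Matrix.SpecialLinearGroup (Fin (n + 1)) ℝ) V}
  (hρ : ∀ w : V, Continuous fun g => ρ g w) {x : ℕ → ℝ} (hx : ∀ k, 1 ≤ k → k ≤ n → x k ≠ 0)
include hρ

/-- Moving the opposite root element past u_{0q} creates a root element of e_p − e_q with q < p. All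
these roots are negative on H_C, so components with H_C ≥ b are untouched. -/
theorem exists_eq_partialUnip {p : ℕ} (hp : p ≤ n) (x : ℕ → ℝ) (s : ℝ) {b : ℝ} {v : V}
    (hb : ∀ ν ∈ supp ρ v, ν (HC n) ≤ b) {m : ℕ} (hm : m < p) :
    ∃ w : V, ρ (rootElt (nth n p) 0 s) (partialUnip ρ x m v) = partialUnip ρ x m w ∧
      (∀ ν ∈ supp ρ w, ν (HC n) ≤ b) ∧
      ∀ ν, b ≤ ν (HC n) → weightProj ρ ν w = weightProj ρ ν v := by
  have key : ∀ (q : ℕ), q < p → ∀ (a : ℝ) (w : V), (∀ ν ∈ supp ρ w, ν (HC n) ≤ b) →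
      ∀ ν : Module.Dual ℝ (cartan n), b ≤ ν (HC n) →
        weightProj ρ ν (ρ (rootElt (nth n p) (nth n q) a) w) = weightProj ρ ν w := by
    intro q hq a w hw ν hν
    refine weightProj_rootElt_eq hρ (nth_ne hp (by omega) (by omega)) a fun k hk => ?_
    by_contra h
    have h1 := hw _ h
    rw [root_eq_firstRoot_sub, LinearMap.sub_apply, LinearMap.smul_apply, LinearMap.sub_apply,
      firstRoot_HC hp, firstRoot_HC (by omega), smul_eq_mul] at h1
    have h2 : (q : ℝ) < p := by exact_mod_cast hq
    have h3 : (1 : ℝ) ≤ k := by exact_mod_cast hk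
    have h4 : 0 < (k : ℝ) * ((p : ℝ) - q) := mul_pos (by linarith) (by linarith)
    linarith
  have key' : ∀ (q : ℕ), q < p → ∀ (a : ℝ) (w : V), (∀ ν ∈ supp ρ w, ν (HC n) ≤ b) →
      ∀ ν ∈ supp ρ (ρ (rootElt (nth n p) (nth n q) a) w), ν (HC n) ≤ b := by
    intro q hq a w hw ν hν
    by_contra h
    rw [mem_supp, key q hq a w hw ν (not_le.1 h).le] at hν
    exact h (hw ν hν)
  induction m with
  | zero =>
    refine ⟨_, rfl, key' 0 hm s v hb, key 0 hm s v hb⟩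
  | succ m ih =>
    obtain ⟨w, hw, hwb, hwv⟩ := ih (by omega)
    refine ⟨ρ (rootElt (nth n p) (nth n (m + 1)) (s * x (m + 1))) w, ?_, key' _ hm _ w hwb,
      fun ν hν => (key _ hm _ w hwb ν hν).trans (hwv ν hν)⟩
    have hcomm : ∀ i, i ≤ m → ∀ (a : ℝ) (w : V),
        ρ (rootElt (nth n p) (nth n (m + 1)) a) (partialUnip ρ x i w) =
          partialUnip ρ x i (ρ (rootElt (nth n p) (nth n (m + 1)) a) w) := by
      intro i hi a w
      induction i with
      | zero => rfl
      | succ i ih2 =>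
        rw [partialUnip_succ, partialUnip_succ, ← ih2 (by omega), ← rep_mul_apply,
          ← rep_mul_apply, rootElt_comm]
        · exact nth_ne hp (by omega) (by omega)
        · exact zero_ne_nth (by omega) (by omega)
        · exact (zero_ne_nth (by omega) (by omega)).symm
        · exact nth_ne (by omega) hp (by omega)
    rw [partialUnip_succ, partialUnip_succ, ← hcomm m le_rfl, ← hw, ← rep_mul_apply,
      rootElt_mul_comm_of_chain, rep_mul_apply, rep_mul_apply]
    · exact (zero_ne_nth (by omega) hp).symm
    · exact (zero_ne_nth (by omega) (by omega)).symm
    · exact nth_ne hp (by omega) (by omega)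

include hx

/-- Each lift reflects and then adds multiples of a root. Iterating yields the Coxeter image of ν up
to such errors; the closure conditions on T are what absorbs them, since s_{m+1} sends α_m to α_m −
α_{m+1} and fixes α_i − α_{i+1} for i < m. -/
theorem exists_mem_supp_of_coxeter_mem {m : ℕ} (hm : m ≤ n) {b : ℝ}
    {T : Set (Module.Dual ℝ (cartan n))}
    (hT : 1 ≤ m → ∀ μ ∈ T, μ + firstRoot n m ∈ T)
    (hT' : ∀ i, 1 ≤ i → i < m → ∀ μ ∈ T, μ + (firstRoot n i - firstRoot n (i + 1)) ∈ T)
    {v : V} (hb : ∀ ν ∈ supp ρ v, ν (HC n) ≤ b) {ν : Module.Dual ℝ (cartan n)}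
    (hν : ν ∈ supp ρ v) (hνb : ν (HC n) = b) (hνT : coxeter n m ν ∈ T) :
    ∃ μ ∈ supp ρ (partialUnip ρ x m v), μ ∈ T := by
  induction m generalizing T v with
  | zero => exact ⟨ν, hν, hνT⟩
  | succ m ih =>
    have hs : ∀ μ κ : Module.Dual ℝ (cartan n), reflection 0 (nth n (m + 1)) (μ + κ) =
        reflection 0 (nth n (m + 1)) μ +
          (κ - κ (firstCoroot n (m + 1)) • firstRoot n (m + 1)) := by
      intro μ κ
      simp only [reflection, firstCoroot, firstRoot, LinearMap.add_apply]
      module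
    obtain ⟨w, hw, hwb, hwv⟩ := exists_eq_partialUnip hρ hm x (x (m + 1))⁻¹ hb (Nat.lt_succ_self m)
    obtain ⟨κ, hκ, hκT⟩ := ih (by omega) (T := {μ | reflection 0 (nth n (m + 1)) μ ∈ T})
      (fun h1 μ hμ => by
        rw [Set.mem_ofPred_eq, hs, firstRoot_firstCoroot h1 (by omega) (by omega) hm,
          if_neg (by omega), one_smul]
        exact hT' m h1 (by omega) _ hμ)
      (fun i h1 h2 μ hμ => by
        rw [Set.mem_ofPred_eq, hs, LinearMap.sub_apply,
          firstRoot_firstCoroot h1 (by omega) (by omega) hm, if_neg (by omega),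
          firstRoot_firstCoroot (by omega) (by omega) (by omega) hm, if_neg (by omega), sub_self,
          zero_smul, sub_zero]
        exact hT' i h1 (by omega) _ hμ)
      hwb (v := w) (by rw [mem_supp, hwv ν hνb.ge]; exact hν) hνT
    rw [← hw] at hκ
    obtain ⟨j, μ, hμ, e, -⟩ := exists_lift hρ hm (hx _ (by omega) hm) hκ
    refine ⟨μ, hμ, ?_⟩
    rw [e]
    clear e hμ
    induction j with
    | zero => simpa using hκT
    | succ j ih2 =>
      have := hT (by omega) _ ih2
      convert this using 1
      push_cast
      module

/-- Induction on the rank: an admissible weight of the top level part is lifted by one reflection.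
-/
theorem exists_admissible {m : ℕ} (hm : m ≤ n) {b : ℝ} {v : V} (hv : v ≠ 0)
    (hb : ∀ ν ∈ supp ρ v, ν (HC n) = b) :
    ∃ μ ∈ supp ρ (partialUnip ρ x m v), Admissible b m μ := by
  induction m generalizing v with
  | zero =>
    obtain ⟨μ, hμ⟩ := supp_nonempty hρ hv
    refine ⟨μ, hμ, ?_, fun k hk => ?_⟩
    · simp [hb μ hμ, corootSum_zero]
    · obtain rfl : k = 0 := by omega
      simp [corootSum_zero]
  | succ m ih =>
    obtain ⟨z, h0, -, h2⟩ := exists_top_level hρ hm x hv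
    obtain ⟨κ, hκ, ha⟩ := ih (by omega) h0
      (fun ν hν => hb ν (by rw [supp_cut hρ] at hν; exact hν.1))
    obtain ⟨j, μ, hμ, -, e1, e2, -⟩ := exists_lift hρ hm (hx _ (by omega) hm) ((h2 κ hκ).2.2 _)
    refine ⟨μ, hμ, admissible_succ
      (le_of_mem_supp_partialUnip hρ hm (fun ν hν => (hb ν hν).ge) μ hμ) ?_ fun k hk => ?_⟩
    · have := ha.1
      have : (0 : ℝ) ≤ j := j.cast_nonneg
      linarith
    · have := ha.2 k hk
      have := e1 k hk
      linarith

/-- Refines `exists_admissible` by remembering the starting weight ν and the total excess β, the sum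
of the integers j of all lifts. If β ≤ 1, the levels of ν met on the way are constrained, which
makes ν(C_j)/(j+1) almost minimal at j = m. -/
theorem exists_admissible_chain {m : ℕ} (hm : m ≤ n) {b : ℝ} {v : V} (hv : v ≠ 0)
    (hb : ∀ ν ∈ supp ρ v, ν (HC n) = b) :
    ∃ ν ∈ supp ρ v, ∃ μ ∈ supp ρ (partialUnip ρ x m v), Admissible b m μ ∧
      ∃ β : ℕ, μ (corootSum n m) - (μ (HC n) - b) = β ∧
        (β = 0 → ∀ j : ℕ, j < m →
          ((j : ℝ) + 1) * ν (corootSum n m) ≤ (m + 1) * ν (corootSum n j)) ∧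
        (β = 1 → ∀ j : ℕ, j < m →
          ((j : ℝ) + 1) * (ν (corootSum n m) - 1) ≤ (m + 1) * ν (corootSum n j)) := by
  induction m generalizing v with
  | zero =>
    obtain ⟨μ, hμ⟩ := supp_nonempty hρ hv
    refine ⟨μ, hμ, μ, hμ, ⟨?_, fun k hk => ?_⟩, 0, ?_, fun _ j hj => absurd hj (by omega),
      fun _ j hj => absurd hj (by omega)⟩
    · simp [hb μ hμ, corootSum_zero]
    · obtain rfl : k = 0 := by omega
      simp [corootSum_zero]
    · simp [hb μ hμ, corootSum_zero]
  | succ m ih =>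
    obtain ⟨z, h0, -, h2⟩ := exists_top_level hρ hm x hv
    obtain ⟨ν, hν, κ, hκ, ha, β, hβ, hβ0, hβ1⟩ := ih (by omega) h0
      (fun ν hν => hb ν (by rw [supp_cut hρ] at hν; exact hν.1))
    rw [supp_cut hρ] at hν
    have hz : ν (levelElt n m) = z := hν.2
    have hz' := (h2 κ hκ).1
    rw [apply_levelElt] at hz hz'
    obtain ⟨j, μ, hμ, -, e1, e2, e3⟩ := exists_lift hρ hm (hx _ (by omega) hm) ((h2 κ hκ).2.2 _)
    have hd := le_of_mem_supp_partialUnip hρ hm (fun ν hν => (hb ν hν).ge) μ hμ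
    have hj : (0 : ℝ) ≤ j := j.cast_nonneg
    have hβn : (0 : ℝ) ≤ β := β.cast_nonneg
    have hm1 : (0 : ℝ) < (m : ℝ) + 1 := by positivity
    refine ⟨ν, hν.1, μ, hμ, admissible_succ hd ?_ fun k hk => ?_, β + j, ?_, ?_⟩
    · linarith
    · have := ha.2 k hk
      have := e1 k hk
      linarith
    · push_cast
      linarith
    -- This is d(μ) ≥ 0 rewritten with the formula for μ(H_C) and the level z of κ.
    have hbound : -z ≥ β - (m + 1) * j := by linarith
    have hC : ν (corootSum n (m + 1)) = ν (corootSum n m) + ν (firstCoroot n (m + 1)) := by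
      rw [corootSum_succ, map_add]
    constructor
    · intro h i hi
      obtain ⟨rfl, rfl⟩ : β = 0 ∧ j = 0 := by omega
      have hz0 : ((m : ℝ) + 1) * ν (corootSum n (m + 1)) ≤ (m + 2) * ν (corootSum n m) := by
        rw [hC]; push_cast at hbound; linarith
      rcases Nat.lt_or_ge i m with him | him
      · have h3 := hβ0 rfl i him
        refine le_of_mul_le_mul_left ?_ hm1
        push_cast
        have h4 := mul_le_mul_of_nonneg_left h3 (show (0 : ℝ) ≤ m + 2 by positivity)
        have h5 := mul_le_mul_of_nonneg_left hz0 (show (0 : ℝ) ≤ i + 1 by positivity)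
        linarith
      · obtain rfl : i = m := by omega
        push_cast
        linarith
    · intro h i hi
      rcases Nat.eq_zero_or_pos β with hb0 | hb0
      · obtain ⟨rfl, rfl⟩ : β = 0 ∧ j = 1 := by omega
        have hz0 : ((m : ℝ) + 1) * (ν (corootSum n (m + 1)) - 1) ≤
            (m + 2) * ν (corootSum n m) := by
          rw [hC]; push_cast at hbound; linarith
        rcases Nat.lt_or_ge i m with him | him
        · have h3 := hβ0 rfl i him
          refine le_of_mul_le_mul_left ?_ hm1
          push_cast
          have h4 := mul_le_mul_of_nonneg_left h3 (show (0 : ℝ) ≤ m + 2 by positivity)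
          have h5 := mul_le_mul_of_nonneg_left hz0 (show (0 : ℝ) ≤ i + 1 by positivity)
          linarith
        · obtain rfl : i = m := by omega
          push_cast
          linarith
      · obtain ⟨rfl, rfl⟩ : β = 1 ∧ j = 0 := by omega
        have hz0 : ((m : ℝ) + 1) * ν (corootSum n (m + 1)) + 1 ≤
            (m + 2) * ν (corootSum n m) := by
          rw [hC]; push_cast at hbound; linarith
        rcases Nat.lt_or_ge i m with him | him
        · have h3 := hβ1 rfl i him
          refine le_of_mul_le_mul_left ?_ hm1
          push_cast
          have h4 := mul_le_mul_of_nonneg_left h3 (show (0 : ℝ) ≤ m + 2 by positivity)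
          have h5 := mul_le_mul_of_nonneg_left hz0 (show (0 : ℝ) ≤ i + 1 by positivity)
          linarith
        · obtain rfl : i = m := by omega
          push_cast
          linarith

end Existence

/-! ### Vectors fixed by blocks of root subgroups. -/

section Fixed

variable {n : ℕ} {V : Type*} [NormedAddCommGroup V] [NormedSpace ℝ V]
  {ρ : Representation ℝ (Matrix.SpecialLinearGroup (Fin (n + 1)) ℝ) V}

/-- The commutator of the root elements for (i, o) and (o, k) is a root element for (i, k). -/
theorem mem_rootFixed_of_chain {i o k : Fin (n + 1)} (hi : i ≠ o) (hk : k ≠ o) (hik : i ≠ k)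
    {v : V} (h1 : v ∈ rootFixed ρ i o) (h2 : v ∈ rootFixed ρ o k) : v ∈ rootFixed ρ i k := by
  intro t
  have e := congrArg (fun g => ρ g v) (rootElt_mul_comm_of_chain hi hk hik t 1)
  simp only [rep_mul_apply, mul_one] at e
  rw [h2 1, h1 t] at e
  have e2 := congrArg (ρ (rootElt o k (-1))) e
  rw [← rep_mul_apply, ← rootElt_add, neg_add_cancel, rootElt_zero, map_one,
    Module.End.one_apply, h2] at e2
  exact e2.symm

variable (ρ) in
/-- The vectors fixed by the root subgroups of `(i, k)`, for `i ≤ l` and `k ≤ m`. -/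
def blockFixed (l m : ℕ) : Submodule ℝ V :=
  ⨅ (i : ℕ) (k : ℕ) (_ : i ≤ l) (_ : k ≤ m) (_ : i ≠ k), rootFixed ρ (nth n i) (nth n k)

theorem mem_blockFixed {l m : ℕ} {v : V} : v ∈ blockFixed ρ l m ↔
    ∀ i k, i ≤ l → k ≤ m → i ≠ k → v ∈ rootFixed ρ (nth n i) (nth n k) := by
  simp only [blockFixed, Submodule.mem_iInf]

theorem mem_blockFixed_succ_right {l m : ℕ} (hl : l ≤ n) (hm : m + 1 ≤ n) {v : V}
    (h : v ∈ blockFixed ρ l m)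
    (h0 : v ∈ rootFixed ρ 0 (nth n (m + 1))) : v ∈ blockFixed ρ l (m + 1) := by
  rw [mem_blockFixed] at h ⊢
  intro i k hi hk hik
  rcases Nat.lt_or_ge k (m + 1) with hkm | hkm
  · exact h i k hi (by omega) hik
  obtain rfl : k = m + 1 := by omega
  rcases Nat.eq_zero_or_pos i with rfl | hi0
  · exact h0
  · exact mem_rootFixed_of_chain (zero_ne_nth hi0 (by omega)).symm
      (zero_ne_nth (by omega) hm).symm (nth_ne (by omega) hm hik)
      (h i 0 hi (by omega) (by omega)) h0

theorem mem_blockFixed_succ_left {l m : ℕ} (hl : l + 1 ≤ n) (hm : m ≤ n) {v : V}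
    (h : v ∈ blockFixed ρ l m)
    (h0 : v ∈ rootFixed ρ (nth n (l + 1)) 0) : v ∈ blockFixed ρ (l + 1) m := by
  rw [mem_blockFixed] at h ⊢
  intro i k hi hk hik
  rcases Nat.lt_or_ge i (l + 1) with hil | hil
  · exact h i k (by omega) hk hik
  obtain rfl : i = l + 1 := by omega
  rcases Nat.eq_zero_or_pos k with rfl | hk0
  · exact h0
  · exact mem_rootFixed_of_chain (zero_ne_nth (by omega) hl).symm
      (zero_ne_nth hk0 (by omega)).symm (nth_ne hl (by omega) hik)
      h0 (h 0 k (by omega) hk (by omega))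

theorem partialUnip_eq_self_of_mem_blockFixed {x : ℕ → ℝ} {l m : ℕ} {v : V}
    (h : v ∈ blockFixed ρ l m) : partialUnip ρ x m v = v :=
  partialUnip_eq_self fun k h1 h2 => mem_blockFixed.1 h 0 k (by omega) h2 (by omega)

variable [FiniteDimensional ℝ V] (hρ : ∀ w : V, Continuous fun g => ρ g w)
include hρ

theorem weightProj_mem_blockFixed {l m : ℕ} (hl : l ≤ n) (hm : m ≤ n) {v : V}
    (h : v ∈ blockFixed ρ l m) (μ : Module.Dual ℝ (cartan n)) :
    weightProj ρ μ v ∈ blockFixed ρ l m :=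
  mem_blockFixed.2 fun i k hi hk hik => weightProj_mem_rootFixed hρ
    (nth_ne (by omega) (by omega) hik) (mem_blockFixed.1 h i k hi hk hik) μ

theorem firstCoroot_nonneg_of_mem_blockFixed {l m : ℕ} (hm : m ≤ n) {v : V}
    (h : v ∈ blockFixed ρ l m) {μ : Module.Dual ℝ (cartan n)} (hμ : μ ∈ supp ρ v) {k : ℕ}
    (hk : k ≤ m) : 0 ≤ μ (firstCoroot n k) := by
  rcases Nat.eq_zero_or_pos k with rfl | hk0
  · rw [firstCoroot_zero, map_zero]
  · have h0 := zero_ne_nth (n := n) hk0 (by omega)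
    exact (coroot_nonneg_of_mem_rootFixed hρ h0 (weightProj_mem hρ μ v) hμ
      (weightProj_mem_rootFixed hρ h0 (mem_blockFixed.1 h 0 k (by omega) hk (by omega)) μ)).1

theorem firstCoroot_eq_zero_of_mem_blockFixed {l m : ℕ} (hlm : l ≤ m) (hm : m ≤ n) {v : V}
    (h : v ∈ blockFixed ρ l m) {μ : Module.Dual ℝ (cartan n)} (hμ : μ ∈ supp ρ v) {k : ℕ}
    (hk : k ≤ l) : μ (firstCoroot n k) = 0 := by
  refine le_antisymm ?_ (firstCoroot_nonneg_of_mem_blockFixed hρ hm h hμ (by omega))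
  rcases Nat.eq_zero_or_pos k with rfl | hk0
  · rw [firstCoroot_zero, map_zero]
  · have h0 := zero_ne_nth (n := n) hk0 (by omega)
    have := (coroot_nonneg_of_mem_rootFixed hρ h0.symm (weightProj_mem hρ μ v) hμ
      (weightProj_mem_rootFixed hρ h0.symm
        (mem_blockFixed.1 h k 0 hk (by omega) (by omega)) μ)).1
    rw [coroot_swap 0, map_neg] at this
    rw [firstCoroot]
    linarith

theorem corootSum_nonneg_of_mem_blockFixed {l m : ℕ} (hm : m ≤ n) {v : V}
    (h : v ∈ blockFixed ρ l m) {μ : Module.Dual ℝ (cartan n)} (hμ : μ ∈ supp ρ v) {k : ℕ}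
    (hk : k ≤ m) : 0 ≤ μ (corootSum n k) := by
  induction k with
  | zero => rw [corootSum_zero, map_zero]
  | succ k ih =>
    rw [corootSum_succ, map_add]
    exact add_nonneg (ih (by omega)) (firstCoroot_nonneg_of_mem_blockFixed hρ hm h hμ hk)

theorem corootSum_eq_zero_of_mem_blockFixed {l m : ℕ} (hlm : l ≤ m) (hm : m ≤ n) {v : V}
    (h : v ∈ blockFixed ρ l m) {μ : Module.Dual ℝ (cartan n)} (hμ : μ ∈ supp ρ v) {k : ℕ}
    (hk : k ≤ l) : μ (corootSum n k) = 0 := by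
  induction k with
  | zero => rw [corootSum_zero, map_zero]
  | succ k ih =>
    rw [corootSum_succ, map_add, ih (by omega),
      firstCoroot_eq_zero_of_mem_blockFixed hρ hlm hm h hμ hk, add_zero]

/-- If `y` meets the string of `ν` only in `ν`, and the string of `u y` avoids the upper half,
then the component of `y` of weight `ν` is fixed by the root subgroup of `u`. -/
theorem weightProj_mem_rootFixed_of_string {m : ℕ} (h1m : 1 ≤ m) (hm : m ≤ n) {t : ℝ}
    (ht : t ≠ 0) {y : V} {ν : Module.Dual ℝ (cartan n)}
    (hy : ∀ c : ℝ, c ≠ 0 → weightProj ρ (ν + c • firstRoot n m) y = 0)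
    (hs : ∀ c : ℝ, -ν (firstCoroot n m) ≤ c →
      ν + c • firstRoot n m ∈ supp ρ (ρ (rootElt 0 (nth n m) t) y) → c = 0) :
    weightProj ρ ν y ∈ rootFixed ρ 0 (nth n m) := by
  have h0 := zero_ne_nth (n := n) h1m hm
  by_cases hp : weightProj ρ ν y = 0
  · rw [hp]; exact Submodule.zero_mem _
  have hpw := weightProj_mem hρ ν y
  -- A lift of ν lies at position j − ν(α^∨) on the string, in the upper half; `hs` makes this 0, so
  -- ν(α^∨) = j.
  have ha : 0 ≤ ν (firstCoroot n m) := by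
    have h1 : weightProj ρ ν (ρ (rootElt (nth n m) 0 t⁻¹) y) ≠ 0 := by
      rw [weightProj_rootElt_eq hρ h0.symm]
      · exact hp
      · intro k hk
        rw [root_swap 0, smul_neg, sub_neg_eq_add]
        exact hy k (by positivity)
    obtain ⟨j, hj⟩ := exists_weightProj_reflection_ne_zero hρ h0 ht h1
    have hj0 : (0 : ℝ) ≤ j := j.cast_nonneg
    have := hs (-ν (firstCoroot n m) + j) (by linarith) (by
      rw [mem_supp]
      convert hj using 3
      simp only [reflection, firstCoroot, firstRoot]
      module)
    linarith
  refine mem_rootFixed_of_weight hρ h0 ht hpw (eq_of_weightProj_eq hρ fun κ => ?_)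
  have hself : weightProj ρ ν (ρ (rootElt 0 (nth n m) t) (weightProj ρ ν y)) =
      weightProj ρ ν (weightProj ρ ν y) := by
    refine weightProj_rootElt_eq hρ h0 t fun k hk => weightProj_of_mem_of_ne hρ hpw ?_
    have hk' : (k : ℝ) ≠ 0 := by positivity
    simpa using ⟨by omega, root_ne_zero h0⟩
  by_cases hκ : κ = ν
  · rw [hκ, hself]
  rw [weightProj_of_mem_of_ne hρ hpw hκ]
  by_contra hne
  obtain ⟨k, hk⟩ := exists_weightProj_ne_zero hρ h0 t hne
  have hkν : κ - (k : ℝ) • firstRoot n m = ν := by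
    by_contra h
    exact hk (weightProj_of_mem_of_ne hρ hpw h)
  have hκ' : κ = ν + (k : ℝ) • firstRoot n m := by rw [← hkν]; module
  have h2 : weightProj ρ κ (ρ (rootElt 0 (nth n m) t) (weightProj ρ ν y)) =
      weightProj ρ κ (ρ (rootElt 0 (nth n m) t) y) := by
    refine weightProj_rootElt_congr hρ h0 t fun i => ?_
    have e : κ - (i : ℝ) • root 0 (nth n m) = ν + ((k : ℝ) - i) • firstRoot n m := by
      rw [hκ', firstRoot]; module
    rw [e]
    by_cases hki : (k : ℝ) - i = 0
    · rw [hki, zero_smul, add_zero, weightProj_of_mem hρ hpw]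
    · rw [hy _ hki]
      refine weightProj_of_mem_of_ne hρ hpw ?_
      simpa using ⟨hki, root_ne_zero h0⟩
  rw [h2, hκ'] at hne
  have := hs k (by have : (0 : ℝ) ≤ k := k.cast_nonneg; linarith) hne
  rw [this, zero_smul, add_zero] at hκ'
  exact hκ hκ'

end Fixed

/-! ### Splitting off the top level. -/

section Levels

variable {n : ℕ} {V : Type*} [NormedAddCommGroup V] [NormedSpace ℝ V] [FiniteDimensional ℝ V]
  {ρ : Representation ℝ (Matrix.SpecialLinearGroup (Fin (n + 1)) ℝ) V}
  (hρ : ∀ w : V, Continuous fun g => ρ g w) {x : ℕ → ℝ}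
include hρ

/-- A step down the string violates H_C ≥ b, a step up violates the maximality of the level. -/
theorem weightProj_string_eq_zero {m : ℕ} (hm : m + 1 ≤ n) {b z : ℝ} {v : V}
    (hb : ∀ ν ∈ supp ρ v, ν (HC n) = b)
    (hz : ∀ μ ∈ supp ρ (partialUnip ρ x m v), μ (levelElt n m) ≤ z)
    {ν : Module.Dual ℝ (cartan n)} (hνz : ν (levelElt n m) = z) (hνb : ν (HC n) = b) {c : ℝ}
    (hc : c ≠ 0) : weightProj ρ (ν + c • firstRoot n (m + 1)) (partialUnip ρ x m v) = 0 := by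
  by_contra h
  have h1 := hz _ h
  have h2 := le_of_mem_supp_partialUnip hρ (by omega) (fun ν hν => (hb ν hν).ge) _ h
  simp only [LinearMap.add_apply, LinearMap.smul_apply, firstRoot_succ_levelElt hm,
    firstRoot_HC hm, hνz, hνb, smul_eq_mul] at h1 h2
  have hm0 : (0 : ℝ) ≤ m := m.cast_nonneg
  push_cast at h2
  rcases lt_or_gt_of_ne hc with h3 | h3
  · have := mul_neg_of_neg_of_pos h3 (show (0 : ℝ) < m + 1 by linarith)
    linarith
  · have := mul_pos h3 (show (0 : ℝ) < m + 2 by linarith)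
    linarith

/-- On a string through a weight of v₀, `partialUnip x m v` has no component outside v₀, so the
contributions of v₀ and of v − v₀ never meet and cannot cancel. -/
theorem supp_sub_cut_subset {m : ℕ} (hm : m + 1 ≤ n) {b z : ℝ} {v : V}
    (hb : ∀ ν ∈ supp ρ v, ν (HC n) = b)
    (hz : ∀ μ ∈ supp ρ (partialUnip ρ x m v), μ (levelElt n m) ≤ z)
    (hf : partialUnip ρ x m (cut ρ {μ | μ (levelElt n m) = z} v) =
      cut ρ {μ | μ (levelElt n m) = z} v) :
    supp ρ (partialUnip ρ x (m + 1) (v - cut ρ {μ | μ (levelElt n m) = z} v)) ⊆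
      supp ρ (partialUnip ρ x (m + 1) v) := by
  classical
  intro μ hμ h0
  have hcut := partialUnip_cut hρ (x := x) (show m ≤ n by omega) (Z := levelElt n m)
    (fun k h1 h2 => firstRoot_levelElt h1 h2 hm) z v
  set v₀ := cut ρ {μ | μ (levelElt n m) = z} v with hv₀
  have h1 : μ ∈ supp ρ (ρ (rootElt 0 (nth n (m + 1)) (x (m + 1))) v₀) := by
    intro h2
    refine hμ ?_
    rw [map_sub, map_sub, h0, partialUnip_succ, hf, h2, sub_zero]
  obtain ⟨k, hk⟩ := supp_rootElt hρ (by omega) hm h1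
  rw [partialUnip_succ] at hμ
  obtain ⟨k', hk'⟩ := supp_rootElt hρ (by omega) hm hμ
  rw [hv₀, supp_cut hρ] at hk
  refine hk' ?_
  have e : μ - (k' : ℝ) • firstRoot n (m + 1) =
      (μ - (k : ℝ) • firstRoot n (m + 1)) + ((k : ℝ) - k') • firstRoot n (m + 1) := by module
  rw [e, map_sub, hcut, map_sub, weightProj_cut hρ]
  by_cases hkk : (k : ℝ) - k' = 0
  · rw [hkk, zero_smul, add_zero, if_pos hk.2, sub_self]
  · have h3 := weightProj_string_eq_zero hρ hm hb hz hk.2 (hb _ hk.1) hkk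
    rw [h3, ite_self, sub_zero]

/-- Induction on the number of weights of v. The condition Φ passes to v − v₀ because no weights are
created. -/
theorem mem_of_level_induction {m : ℕ} (hm : m + 1 ≤ n) {b : ℝ} (F : Submodule ℝ V)
    (Φ : Module.Dual ℝ (cartan n) → Prop)
    (H : ∀ v : V, v ≠ 0 → (∀ ν ∈ supp ρ v, ν (HC n) = b) →
      (∀ μ ∈ supp ρ (partialUnip ρ x (m + 1) v), Φ μ) →
      ∃ z : ℝ, cut ρ {μ | μ (levelElt n m) = z} v ≠ 0 ∧
        (∀ μ ∈ supp ρ (partialUnip ρ x m v), μ (levelElt n m) ≤ z) ∧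
        partialUnip ρ x m (cut ρ {μ | μ (levelElt n m) = z} v) =
          cut ρ {μ | μ (levelElt n m) = z} v ∧
        cut ρ {μ | μ (levelElt n m) = z} v ∈ F)
    {v : V} (hb : ∀ ν ∈ supp ρ v, ν (HC n) = b)
    (hΦ : ∀ μ ∈ supp ρ (partialUnip ρ x (m + 1) v), Φ μ) : v ∈ F := by
  classical
  induction hN : (supp ρ v).ncard using Nat.strong_induction_on generalizing v with
  | _ N ih =>
    by_cases hv : v = 0
    · rw [hv]; exact F.zero_mem
    obtain ⟨z, h0, hz, hf, hF⟩ := H v hv hb hΦ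
    set v₀ := cut ρ {μ | μ (levelElt n m) = z} v with hv₀
    have hsub : supp ρ (v - v₀) = supp ρ v \ {μ | μ (levelElt n m) = z} := by
      ext μ
      rw [Set.mem_sdiff, mem_supp, mem_supp, map_sub, hv₀, weightProj_cut hρ]
      split_ifs with h <;> simp [h]
    have hlt : (supp ρ (v - v₀)).ncard < N := by
      rw [← hN]
      refine Set.ncard_lt_ncard ?_ (finite_supp hρ v)
      rw [hsub]
      refine ⟨Set.sdiff_subset, fun hss => ?_⟩
      obtain ⟨ν, hν⟩ := supp_nonempty hρ h0
      rw [hv₀, supp_cut hρ] at hν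
      exact (hss hν.1).2 hν.2
    have h2 := ih _ hlt (v := v - v₀)
      (fun ν hν => hb ν (by rw [hsub] at hν; exact hν.1))
      (fun μ hμ => hΦ μ (supp_sub_cut_subset hρ hm hb hz hf hμ)) rfl
    have := F.add_mem h2 hF
    rwa [sub_add_cancel] at this

end Levels

/-! ### Rigidity for the full block. -/

section Rigidity

variable {n : ℕ} {V : Type*} [NormedAddCommGroup V] [NormedSpace ℝ V] [FiniteDimensional ℝ V]
  {ρ : Representation ℝ (Matrix.SpecialLinearGroup (Fin (n + 1)) ℝ) V}
  (hρ : ∀ w : V, Continuous fun g => ρ g w) {x : ℕ → ℝ} (hx : ∀ k, 1 ≤ k → k ≤ n → x k ≠ 0)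
include hρ hx

/-- Lifting κ − α_{m+1} in place of κ gains an extra 1 in C_{m+1} − H_C; this strict gain
contradicts the equality hypotheses below. -/
theorem exists_sub_firstRoot_lift {m : ℕ} (hm : m + 1 ≤ n) {y : V}
    {κ : Module.Dual ℝ (cartan n)}
    (h : κ - firstRoot n (m + 1) ∈ supp ρ (ρ (rootElt (nth n (m + 1)) 0 (x (m + 1))⁻¹) y)) :
    ∃ j : ℕ, ∃ μ ∈ supp ρ (ρ (rootElt 0 (nth n (m + 1)) (x (m + 1))) y),
      (∀ k : ℕ, k ≤ m → ((m : ℝ) + 1) * μ (corootSum n k) - k * μ (HC n) =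
        (m + 1) * κ (corootSum n k) - k * κ (HC n)) ∧
      μ (corootSum n (m + 1)) - μ (HC n) = κ (corootSum n m) - κ (HC n) + 1 + j := by
  obtain ⟨j, μ, hμ, -, e1, e2, -⟩ := exists_lift hρ hm (hx _ (by omega) hm) h
  refine ⟨j, μ, hμ, fun k hk => ?_, ?_⟩
  · rw [e1 k hk, LinearMap.sub_apply, LinearMap.sub_apply, firstRoot_HC hm,
      firstRoot_corootSum (by omega) hm (by omega), if_neg (by omega)]
    push_cast; ring
  · rw [e2, LinearMap.sub_apply, LinearMap.sub_apply, firstRoot_HC hm,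
      firstRoot_corootSum (by omega) hm (by omega), if_neg (by omega)]
    push_cast; ring

/-- A chain for the part of v at level −(m+2) has excess β ≤ 1. Its starting weight ν then has an
admissible Coxeter image with C_{m+1} = m + 2 > 0, and such a positive admissible weight persists in
`partialUnip x (m+1) v`, against the hypothesis. -/
theorem false_of_neg_level {m : ℕ} (hm : m + 1 ≤ n) {b : ℝ} {v : V}
    (hb : ∀ ν ∈ supp ρ v, ν (HC n) = b)
    (hΦ : ∀ μ ∈ supp ρ (partialUnip ρ x (m + 1) v), Admissible b (m + 1) μ →
      μ (corootSum n (m + 1)) = 0 ∧ μ (HC n) = b)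
    (hz : ∀ μ ∈ supp ρ (partialUnip ρ x m v), μ (levelElt n m) ≤ 0)
    (h0 : ∀ κ ∈ supp ρ (partialUnip ρ x m v), κ (levelElt n m) = 0 → Admissible b m κ →
      κ (corootSum n m) = κ (HC n) - b)
    {κ : Module.Dual ℝ (cartan n)} (hκ : κ ∈ supp ρ (partialUnip ρ x m v))
    (hκz : κ (levelElt n m) = -((m : ℝ) + 2)) : False := by
  have hm0 : (0 : ℝ) ≤ m := m.cast_nonneg
  have hd : ∀ μ ∈ supp ρ (partialUnip ρ x (m + 1) v), b ≤ μ (HC n) :=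
    le_of_mem_supp_partialUnip hρ hm fun ν hν => (hb ν hν).ge
  have hcut := partialUnip_cut hρ (x := x) (show m ≤ n by omega) (Z := levelElt n m)
    (fun k h1 h2 => firstRoot_levelElt h1 h2 hm) (-((m : ℝ) + 2)) v
  set v₁ := cut ρ {μ | μ (levelElt n m) = -((m : ℝ) + 2)} v with hv₁
  have hv₁0 : v₁ ≠ 0 := by
    intro h
    have h1 : κ ∈ supp ρ (partialUnip ρ x m v₁) := by
      rw [hcut, supp_cut hρ]; exact ⟨hκ, hκz⟩
    rw [h, map_zero] at h1
    exact h1 (map_zero _)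
  obtain ⟨ν, hν, μ, hμ, hadm, β, hβ, hβ0, hβ1⟩ := exists_admissible_chain hρ hx
    (show m ≤ n by omega) hv₁0 (fun ν hν => hb ν (by rw [hv₁, supp_cut hρ] at hν; exact hν.1))
  rw [hv₁, supp_cut hρ] at hν
  rw [hcut, supp_cut hρ] at hμ
  have hνz : ν (levelElt n m) = -((m : ℝ) + 2) := hν.2
  have hμz : μ (levelElt n m) = -((m : ℝ) + 2) := hμ.2
  -- Either μ survives in u_{−α} y and lifts, forcing level 0; or it is cancelled by μ + α, the only
  -- possible higher weight, and when β ≥ 1 that weight is admissible at level 0, where equality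
  -- gives β = 1.
  have hβ' : β = 0 ∨ β = 1 := by
    by_cases hn : μ ∈ supp ρ (ρ (rootElt (nth n (m + 1)) 0 (x (m + 1))⁻¹) (partialUnip ρ x m v))
    · exfalso
      obtain ⟨j, μ', hμ', -, e1, e2, e3⟩ := exists_lift hρ hm (hx _ (by omega) hm) hn
      have hj : (0 : ℝ) ≤ j := j.cast_nonneg
      have hβn : (0 : ℝ) ≤ β := β.cast_nonneg
      obtain ⟨e4, e5⟩ := hΦ μ' hμ' (admissible_succ (hd μ' hμ') (by linarith) fun k hk => by
        have := e1 k hk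
        have := hadm.2 k hk
        linarith)
      have hj0 : (j : ℝ) = 0 := by linarith
      have hβ0 : (β : ℝ) = 0 := by linarith
      rw [apply_levelElt] at hμz
      rw [hj0] at e3
      rw [hβ0] at hβ
      linarith
    · have hr : root (nth n (m + 1)) 0 = -firstRoot n (m + 1) := root_swap 0 _
      obtain ⟨k, hk, hks⟩ : ∃ k : ℕ, 1 ≤ k ∧
          μ + (k : ℝ) • firstRoot n (m + 1) ∈ supp ρ (partialUnip ρ x m v) := by
        by_contra! h
        refine hn ?_
        rw [mem_supp, weightProj_rootElt_eq hρ (zero_ne_nth (by omega) hm).symm]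
        · exact hμ.1
        · intro k hk
          rw [hr, smul_neg, sub_neg_eq_add]
          by_contra h2
          exact h k hk h2
      have hk1 := hz _ hks
      rw [LinearMap.add_apply, LinearMap.smul_apply, firstRoot_succ_levelElt hm, hμz,
        smul_eq_mul] at hk1
      have hk1' : k = 1 := by
        have : ((k : ℝ) - 1) * (m + 2) ≤ 0 := by linarith
        have h2 : (k : ℝ) - 1 ≤ 0 := nonpos_of_mul_nonpos_left this (by linarith)
        have h3 : (k : ℝ) ≤ 1 := by linarith
        have h4 : k ≤ 1 := by exact_mod_cast h3
        omega
      subst hk1'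
      rw [Nat.cast_one, one_smul] at hks
      rcases Nat.eq_zero_or_pos β with h | h
      · exact Or.inl h
      right
      have hβ1 : (1 : ℝ) ≤ β := by exact_mod_cast h
      have ec : ∀ k : ℕ, k ≤ m → (μ + firstRoot n (m + 1)) (corootSum n k) =
          μ (corootSum n k) + k := by
        intro k hk
        rw [LinearMap.add_apply, firstRoot_corootSum (by omega) hm (by omega), if_neg (by omega),
          add_zero]
      have eH : (μ + firstRoot n (m + 1)) (HC n) = μ (HC n) + (m + 1) := by
        rw [LinearMap.add_apply, firstRoot_HC hm]; push_cast; ring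
      have := h0 _ hks (by
        rw [LinearMap.add_apply, firstRoot_succ_levelElt hm, hμz]; ring) ⟨by
          rw [ec m le_rfl, eH]; linarith, fun k hk => by
          rw [ec k hk, eH]
          have := hadm.2 k hk
          linarith⟩
      rw [ec m le_rfl, eH] at this
      have h3 : (β : ℝ) = 1 := by linarith
      exact_mod_cast h3
  rw [apply_levelElt] at hνz
  have hgood : ∀ j : ℕ, j < m →
      ((j : ℝ) + 1) * (ν (corootSum n m) - 1) ≤ (m + 1) * ν (corootSum n j) := by
    intro j hj
    rcases hβ' with h | h
    · have := hβ0 h j hj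
      have hj0 : (0 : ℝ) ≤ j := j.cast_nonneg
      linarith
    · exact hβ1 h j hj
  have hH : coxeter n (m + 1) ν (HC n) = b + (m + 2) := by
    rw [coxeter_HC hm, hb ν hν.1, corootSum_succ, map_add]
    push_cast
    linarith
  have hC : coxeter n (m + 1) ν (corootSum n (m + 1)) = m + 2 := by
    rw [coxeter_corootSum hm le_rfl]
    linarith
  obtain ⟨μ', hμ', hT, hpos⟩ := exists_mem_supp_of_coxeter_mem hρ hx hm (b := b)
    (T := {μ | Admissible b (m + 1) μ ∧ 0 < μ (corootSum n (m + 1))})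
    (fun _ μ hμ => by
      obtain ⟨⟨h1, h2⟩, h3⟩ := hμ
      have ec : ∀ k : ℕ, k ≤ m + 1 → (μ + firstRoot n (m + 1)) (corootSum n k) =
          μ (corootSum n k) + k + if m + 1 ≤ k then 1 else 0 := by
        intro k hk
        rw [LinearMap.add_apply, firstRoot_corootSum (by omega) hm (by omega), add_assoc]
      have eH : (μ + firstRoot n (m + 1)) (HC n) = μ (HC n) + (m + 1) := by
        rw [LinearMap.add_apply, firstRoot_HC hm]; push_cast; ring
      refine ⟨⟨?_, fun k hk => ?_⟩, ?_⟩
      · rw [ec _ le_rfl, eH, if_pos le_rfl]; push_cast; linarith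
      · rw [ec k hk, eH]
        have h4 := h2 k hk
        have hk0 : (0 : ℝ) ≤ k := k.cast_nonneg
        push_cast at h4 ⊢
        split_ifs <;> linarith
      · rw [ec _ le_rfl, if_pos le_rfl]; push_cast; linarith)
    (fun i hi him μ hμ => by
      obtain ⟨⟨h1, h2⟩, h3⟩ := hμ
      have ec : ∀ k : ℕ, k ≤ m + 1 →
          (μ + (firstRoot n i - firstRoot n (i + 1))) (corootSum n k) =
          μ (corootSum n k) + if i = k then 1 else 0 := by
        intro k hk
        rw [LinearMap.add_apply, LinearMap.sub_apply, firstRoot_corootSum hi (by omega) (by omega),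
          firstRoot_corootSum (by omega) (by omega) (by omega)]
        by_cases h4 : i = k
        · subst h4
          rw [if_pos le_rfl, if_neg (by omega), if_pos rfl]; ring
        · rw [if_neg h4]
          by_cases h5 : i ≤ k
          · rw [if_pos h5, if_pos (by omega)]; ring
          · rw [if_neg h5, if_neg (by omega)]; ring
      have eH : (μ + (firstRoot n i - firstRoot n (i + 1))) (HC n) = μ (HC n) - 1 := by
        rw [LinearMap.add_apply, LinearMap.sub_apply, firstRoot_HC (by omega),
          firstRoot_HC (by omega)]
        push_cast; ring
      refine ⟨⟨?_, fun k hk => ?_⟩, ?_⟩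
      · rw [ec _ le_rfl, eH, if_neg (by omega)]; linarith
      · rw [ec k hk, eH]
        have h4 := h2 k hk
        have hk0 : (0 : ℝ) ≤ k := k.cast_nonneg
        push_cast at h4 ⊢
        split_ifs <;> linarith
      · rw [ec _ le_rfl, if_neg (by omega)]; linarith)
    (fun ν hν => (hb ν hν).le) hν.1 (hb ν hν.1) ⟨⟨by rw [hH, hC]; linarith, fun k hk => by
      rcases k with _ | k
      · simp [corootSum_zero]
      rw [hH, coxeter_corootSum hm hk]
      have hk0 : (0 : ℝ) ≤ k := k.cast_nonneg
      have h5 : ((k : ℝ) + 1) * (ν (corootSum n m) - 1) ≤ (m + 1) * ν (corootSum n k) := by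
        rcases Nat.lt_or_ge k m with h | h
        · exact hgood k h
        · obtain rfl : k = m := by omega
          have : (0 : ℝ) ≤ k + 1 := by linarith
          linarith
      have h6 : ((k : ℝ) + 1) * (ν (firstCoroot n (m + 1)) + 1) ≤ ν (corootSum n k) := by
        have hm1 : (0 : ℝ) < m + 1 := by linarith
        refine le_of_mul_le_mul_left ?_ hm1
        have e : ((m : ℝ) + 1) * ν (firstCoroot n (m + 1)) = ν (corootSum n m) - (m + 2) := by
          linarith
        calc ((m : ℝ) + 1) * ((k + 1) * (ν (firstCoroot n (m + 1)) + 1)) =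
            (k + 1) * ((m + 1) * ν (firstCoroot n (m + 1)) + (m + 1)) := by ring
          _ = (k + 1) * (ν (corootSum n m) - 1) := by rw [e]; ring
          _ ≤ _ := h5
      have h7 := mul_le_mul_of_nonneg_left h6 (show (0 : ℝ) ≤ m + 2 by linarith)
      push_cast
      linarith⟩, by rw [hC]; linarith⟩
  have := (hΦ μ' hμ' hT).1
  linarith

/-- The hypothesis must descend to the top level part v₀. Lifting gives only C_m = d on its
admissible weights; the case d > 0 would produce a weight one step below the top level and is
excluded by `false_of_neg_level`. -/
theorem mem_blockFixed_of_corootSum_eq_zero {m : ℕ} (hm : m ≤ n) {b : ℝ} {v : V}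
    (hb : ∀ ν ∈ supp ρ v, ν (HC n) = b)
    (hΦ : ∀ μ ∈ supp ρ (partialUnip ρ x m v), Admissible b m μ →
      μ (corootSum n m) = 0 ∧ μ (HC n) = b) : v ∈ blockFixed ρ m m := by
  induction m generalizing v with
  | zero => exact mem_blockFixed.2 fun i k hi hk hik => absurd hik (by omega)
  | succ m ih =>
    refine mem_of_level_induction hρ hm (blockFixed ρ (m + 1) (m + 1))
      (fun μ => Admissible b (m + 1) μ → μ (corootSum n (m + 1)) = 0 ∧ μ (HC n) = b)
      (fun v hv hb hΦ => ?_) hb hΦ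
    obtain ⟨z, h0, hz, htop⟩ := exists_top_level hρ hm x hv
    have hd : ∀ μ ∈ supp ρ (partialUnip ρ x (m + 1) v), b ≤ μ (HC n) :=
      le_of_mem_supp_partialUnip hρ hm fun ν hν => (hb ν hν).ge
    have hcut := partialUnip_cut hρ (x := x) (show m ≤ n by omega) (Z := levelElt n m)
      (fun k h1 h2 => firstRoot_levelElt h1 h2 hm) z v
    have hm0 : (0 : ℝ) ≤ m := m.cast_nonneg
    have hr : root (nth n (m + 1)) 0 = -firstRoot n (m + 1) := root_swap 0 _
    set v₀ := cut ρ {μ | μ (levelElt n m) = z} v with hv₀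
    have hb₀ : ∀ ν ∈ supp ρ v₀, ν (HC n) = b := fun ν hν =>
      hb ν (by rw [hv₀, supp_cut hρ] at hν; exact hν.1)
    have h1 : ∀ κ ∈ supp ρ (partialUnip ρ x m v₀), Admissible b m κ →
        κ (corootSum n m) = κ (HC n) - b ∧
          κ (HC n) - b = (m + 1) * κ (firstCoroot n (m + 1)) := by
      intro κ hκ hadm
      obtain ⟨j, μ, hμ, -, e1, e2, e3⟩ :=
        exists_lift hρ hm (hx _ (by omega) hm) ((htop κ hκ).2.2 _)
      have hj : (0 : ℝ) ≤ j := j.cast_nonneg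
      have ha1 := hadm.1
      obtain ⟨e4, e5⟩ := hΦ μ hμ (admissible_succ (hd μ hμ) (by linarith) fun k hk => by
        have := e1 k hk
        have := hadm.2 k hk
        linarith)
      have hj0 : (j : ℝ) = 0 := by linarith
      rw [hj0] at e2 e3
      exact ⟨by linarith, by linarith⟩
    have hz0 : z = 0 := by
      obtain ⟨κ, hκ, hadm⟩ := exists_admissible hρ hx (show m ≤ n by omega) h0 hb₀
      have h2 := h1 κ hκ hadm
      have h3 := (htop κ hκ).1
      rw [apply_levelElt] at h3
      linarith
    have h2 : ∀ κ ∈ supp ρ (partialUnip ρ x m v₀), Admissible b m κ →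
        κ (corootSum n m) = 0 ∧ κ (HC n) = b := by
      intro κ hκ hadm
      obtain ⟨e1, e2⟩ := h1 κ hκ hadm
      by_contra hne
      have hdκ : b < κ (HC n) := by
        refine lt_of_le_of_ne (le_of_mem_supp_partialUnip hρ (by omega)
          (fun ν hν => (hb₀ ν hν).ge) κ hκ) fun e => hne ⟨by linarith, e.symm⟩
      have ha : 0 < κ (firstCoroot n (m + 1)) := by
        by_contra h
        have := mul_nonpos_of_nonneg_of_nonpos (show (0 : ℝ) ≤ m + 1 by linarith) (not_lt.1 h)
        linarith
      have hκy : κ ∈ supp ρ (partialUnip ρ x m v) := (htop κ hκ).2.1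
      have hκz := (htop κ hκ).1
      have hup : ∀ k : ℕ, 1 ≤ k →
          weightProj ρ (κ + (k : ℝ) • firstRoot n (m + 1)) (partialUnip ρ x m v) = 0 := by
        intro k hk
        by_contra h
        have h3 := hz _ h
        rw [LinearMap.add_apply, LinearMap.smul_apply, firstRoot_succ_levelElt hm, hκz,
          smul_eq_mul] at h3
        have : (0 : ℝ) < k * (m + 2) := by positivity
        linarith
      -- Otherwise κ − α either occurs in u_{−α} y and lifts with the extra 1, or is absent there,
      -- so that the κ-component is killed by lowering and κ(α^∨) ≤ 0.
      have hlow : κ - firstRoot n (m + 1) ∈ supp ρ (partialUnip ρ x m v) := by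
        by_contra h
        have h : weightProj ρ (κ - firstRoot n (m + 1)) (partialUnip ρ x m v) = 0 := not_not.1 h
        by_cases hn : κ - firstRoot n (m + 1) ∈
            supp ρ (ρ (rootElt (nth n (m + 1)) 0 (x (m + 1))⁻¹) (partialUnip ρ x m v))
        · obtain ⟨j, μ, hμ, e3, e4⟩ := exists_sub_firstRoot_lift hρ hx hm hn
          have hj : (0 : ℝ) ≤ j := j.cast_nonneg
          obtain ⟨e5, e6⟩ := hΦ μ hμ (admissible_succ (hd μ hμ) (by linarith) fun k hk => by
            have := e3 k hk
            have := hadm.2 k hk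
            linarith)
          linarith
        · have h3 := weightProj_sub_mem_rootFixed hρ (zero_ne_nth (by omega) hm).symm
            (inv_ne_zero (hx _ (by omega) hm)) h (fun k hk => by
              have e : κ - firstRoot n (m + 1) - (k : ℝ) • root (nth n (m + 1)) 0 =
                  κ + ((k - 1 : ℕ) : ℝ) • firstRoot n (m + 1) := by
                rw [hr, Nat.cast_sub (by omega)]; push_cast; module
              rw [e]
              exact hup _ (by omega)) (not_not.1 hn)
          rw [hr, sub_neg_eq_add, sub_add_cancel] at h3
          have h4 := (coroot_nonneg_of_mem_rootFixed hρ (zero_ne_nth (by omega) hm).symm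
            (weightProj_mem hρ κ _) hκy h3).1
          rw [coroot_swap 0, map_neg] at h4
          rw [firstCoroot] at ha
          linarith
      refine false_of_neg_level hρ hx hm hb hΦ (hz0 ▸ hz) (fun κ hκ hκ0 hadm => (h1 κ ?_ hadm).1)
        hlow ?_
      · rw [hcut, supp_cut hρ]
        exact ⟨hκ, hκ0.trans hz0.symm⟩
      · rw [LinearMap.sub_apply, firstRoot_succ_levelElt hm, hκz, hz0]; ring
    have hfix := ih (by omega) hb₀ h2
    have hself : partialUnip ρ x m v₀ = v₀ := partialUnip_eq_self_of_mem_blockFixed hfix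
    refine ⟨z, h0, hz, hself, mem_of_weightProj_mem hρ _ fun ν => ?_⟩
    by_cases hν : ν ∈ supp ρ v₀
    swap
    · rw [not_not.1 hν]; exact Submodule.zero_mem _
    have hνc : ∀ k, k ≤ m → ν (corootSum n k) = 0 := fun k hk =>
      corootSum_eq_zero_of_mem_blockFixed hρ le_rfl (by omega) hfix hν hk
    have hνb := hb₀ ν hν
    have hν' := hν
    rw [hv₀, supp_cut hρ] at hν'
    have hνz : ν (levelElt n m) = z := hν'.2
    have ha : ν (firstCoroot n (m + 1)) = 0 := by
      have h3 := hνz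
      rw [apply_levelElt, hνc m le_rfl, hz0, sub_zero] at h3
      exact (mul_eq_zero.1 h3).resolve_left (by linarith)
    have hp : weightProj ρ ν v₀ = weightProj ρ ν (partialUnip ρ x m v) := by
      classical
      rw [← hself, hcut, weightProj_cut hρ, if_pos hν'.2]
    have hblock := weightProj_mem_blockFixed hρ (show m ≤ n by omega) (show m ≤ n by omega)
      hfix ν
    have h3 : weightProj ρ ν v₀ ∈ rootFixed ρ 0 (nth n (m + 1)) := by
      rw [hp]
      refine weightProj_mem_rootFixed_of_string hρ (by omega) hm (hx _ (by omega) hm)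
        (fun c hc => weightProj_string_eq_zero hρ hm hb hz hνz hνb hc) fun c hc hs => ?_
      rw [ha, neg_zero] at hc
      have eH : (ν + c • firstRoot n (m + 1)) (HC n) = b + c * (m + 1) := by
        rw [LinearMap.add_apply, LinearMap.smul_apply, firstRoot_HC hm, hνb, smul_eq_mul]
        push_cast; ring
      have h4 := (hΦ _ hs (admissible_succ (hd _ hs) (by
        rw [eH, LinearMap.add_apply, LinearMap.smul_apply,
          firstRoot_corootSum (by omega) hm hm, if_pos le_rfl, corootSum_succ, map_add,
          hνc m le_rfl, ha, smul_eq_mul]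
        push_cast; linarith) fun k hk => by
        rw [eH, LinearMap.add_apply, LinearMap.smul_apply,
          firstRoot_corootSum (by omega) hm (by omega), if_neg (by omega), hνc k hk, smul_eq_mul]
        linarith)).2
      rw [eH] at h4
      have h5 : c * ((m : ℝ) + 1) = 0 := by linarith
      exact (mul_eq_zero.1 h5).resolve_right (by linarith)
    have h4 := (coroot_nonneg_of_mem_rootFixed hρ (zero_ne_nth (by omega) hm)
      (weightProj_mem hρ ν v₀) hν h3).2 ha
    refine mem_blockFixed_succ_left hm hm (mem_blockFixed_succ_right (by omega) hm hblock h3) h4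

end Rigidity

/-! ### Rigidity for rectangular blocks. -/

section Stabilizer

variable {n : ℕ} {V : Type*} [NormedAddCommGroup V] [NormedSpace ℝ V] [FiniteDimensional ℝ V]
  {ρ : Representation ℝ (Matrix.SpecialLinearGroup (Fin (n + 1)) ℝ) V}
  (hρ : ∀ w : V, Continuous fun g => ρ g w) {x : ℕ → ℝ} (hx : ∀ k, 1 ≤ k → k ≤ n → x k ≠ 0)

theorem add_smul_firstRoot_HC {m : ℕ} (hm : m + 1 ≤ n) (ν : Module.Dual ℝ (cartan n)) (c : ℝ) :
    (ν + c • firstRoot n (m + 1)) (HC n) = ν (HC n) + c * (m + 1) := by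
  rw [LinearMap.add_apply, LinearMap.smul_apply, firstRoot_HC hm, smul_eq_mul]
  push_cast; ring

theorem add_smul_firstRoot_corootSum {m k : ℕ} (hm : m + 1 ≤ n) (hk : k ≤ m)
    (ν : Module.Dual ℝ (cartan n)) (c : ℝ) :
    (ν + c • firstRoot n (m + 1)) (corootSum n k) = ν (corootSum n k) + c * k := by
  rw [LinearMap.add_apply, LinearMap.smul_apply, firstRoot_corootSum (by omega) hm (by omega),
    if_neg (by omega), add_zero, smul_eq_mul]

theorem add_smul_firstRoot_corootSum_succ {m : ℕ} (hm : m + 1 ≤ n)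
    (ν : Module.Dual ℝ (cartan n)) (c : ℝ) :
    (ν + c • firstRoot n (m + 1)) (corootSum n (m + 1)) =
      ν (corootSum n m) + ν (firstCoroot n (m + 1)) + c * (m + 2) := by
  rw [LinearMap.add_apply, LinearMap.smul_apply, firstRoot_corootSum (by omega) hm hm,
    if_pos le_rfl, corootSum_succ, map_add, smul_eq_mul]
  push_cast; ring

include hρ

theorem weightProj_cut_eq_partialUnip {m : ℕ} (hm : m + 1 ≤ n) {z : ℝ} {v : V}
    (hself : partialUnip ρ x m (cut ρ {μ | μ (levelElt n m) = z} v) =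
      cut ρ {μ | μ (levelElt n m) = z} v) {ν : Module.Dual ℝ (cartan n)}
    (hνz : ν (levelElt n m) = z) :
    weightProj ρ ν (cut ρ {μ | μ (levelElt n m) = z} v) =
      weightProj ρ ν (partialUnip ρ x m v) := by
  classical
  rw [← hself, partialUnip_cut hρ (show m ≤ n by omega)
    (fun k h1 h2 => firstRoot_levelElt h1 h2 hm), weightProj_cut hρ]
  exact if_pos hνz

include hx

/-- For l ≤ m the invariant (m+1) C_l − l H_C carries the equality from rank m + 1 down to m. On the
string of a top weight ν the upper half is admissible, and the equality there reads c l = 0. -/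
theorem mem_blockFixed_of_corootSum_eq {m : ℕ} (hm : m ≤ n) {l : ℕ} (hl : 1 ≤ l) (hlm : l ≤ m)
    {b : ℝ} {v : V} (hb : ∀ ν ∈ supp ρ v, ν (HC n) = b)
    (hΦ : ∀ μ ∈ supp ρ (partialUnip ρ x m v), Admissible b m μ →
      ((m : ℝ) + 1) * μ (corootSum n l) = l * (μ (HC n) - b)) : v ∈ blockFixed ρ l m := by
  induction m generalizing v with
  | zero => omega
  | succ m ih =>
    have hm0 : (0 : ℝ) ≤ m := m.cast_nonneg
    rcases Nat.lt_or_ge m l with hml | hlm'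
    · obtain rfl : l = m + 1 := by omega
      refine mem_blockFixed_of_corootSum_eq_zero hρ hx hm hb fun μ hμ hadm => ?_
      have h1 := hΦ μ hμ hadm
      have h2 := le_of_mem_supp_partialUnip hρ hm (fun ν hν => (hb ν hν).ge) μ hμ
      have h3 := mul_le_mul_of_nonneg_left hadm.1 (show (0 : ℝ) ≤ m + 2 by linarith)
      push_cast at h1
      have h4 : μ (HC n) = b := by linarith
      rw [h4, sub_self, mul_zero] at h1
      exact ⟨(mul_eq_zero.1 h1).resolve_left (by linarith), h4⟩
    refine mem_of_level_induction hρ hm (blockFixed ρ l (m + 1))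
      (fun μ => Admissible b (m + 1) μ →
        (((m + 1 : ℕ) : ℝ) + 1) * μ (corootSum n l) = l * (μ (HC n) - b))
      (fun v hv hb hΦ => ?_) hb hΦ
    obtain ⟨z, h0, hz, htop⟩ := exists_top_level hρ hm x hv
    have hd : ∀ μ ∈ supp ρ (partialUnip ρ x (m + 1) v), b ≤ μ (HC n) :=
      le_of_mem_supp_partialUnip hρ hm fun ν hν => (hb ν hν).ge
    have hl0 : (1 : ℝ) ≤ l := by exact_mod_cast hl
    have hb₀ : ∀ ν ∈ supp ρ (cut ρ {μ | μ (levelElt n m) = z} v), ν (HC n) = b := fun ν hν =>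
      hb ν (by rw [supp_cut hρ] at hν; exact hν.1)
    have hfix := ih (by omega) hlm' hb₀ fun κ hκ hadm => by
      obtain ⟨j, μ, hμ, -, e1, e2, e3⟩ :=
        exists_lift hρ hm (hx _ (by omega) hm) ((htop κ hκ).2.2 _)
      have hj : (0 : ℝ) ≤ j := j.cast_nonneg
      have ha1 := hadm.1
      have hineq : ∀ k : ℕ, k ≤ m →
          k * (μ (HC n) - b) ≤ ((m : ℝ) + 1) * μ (corootSum n k) := fun k hk => by
        have := e1 k hk
        have := hadm.2 k hk
        linarith
      have h1 := hΦ μ hμ (admissible_succ (hd μ hμ) (by linarith) hineq)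
      have h2 := hineq l hlm'
      have h3 : 0 ≤ (l : ℝ) * (μ (HC n) - b) :=
        mul_nonneg (by linarith) (by have := hd μ hμ; linarith)
      push_cast at h1
      -- Equality with factor m + 2 and inequality with factor m + 1 leave only C_l = 0 and d = 0.
      have h4 : 0 ≤ μ (corootSum n l) := by
        rw [← h1] at h3
        exact nonneg_of_mul_nonneg_right h3 (by linarith)
      have := e1 l hlm'
      linarith
    have hself := partialUnip_eq_self_of_mem_blockFixed (x := x) hfix
    refine ⟨z, h0, hz, hself, mem_of_weightProj_mem hρ _ fun ν => ?_⟩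
    by_cases hν : ν ∈ supp ρ (cut ρ {μ | μ (levelElt n m) = z} v)
    swap
    · rw [not_not.1 hν]; exact Submodule.zero_mem _
    have hνc : ∀ k, k ≤ m → 0 ≤ ν (corootSum n k) := fun k hk =>
      corootSum_nonneg_of_mem_blockFixed hρ (by omega) hfix hν hk
    have hνl : ν (corootSum n l) = 0 :=
      corootSum_eq_zero_of_mem_blockFixed hρ hlm' (by omega) hfix hν le_rfl
    have hνb := hb₀ ν hν
    have hνz : ν (levelElt n m) = z := by
      rw [supp_cut hρ] at hν
      exact hν.2
    refine mem_blockFixed_succ_right (by omega) hm (weightProj_mem_blockFixed hρ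
      (by omega) (by omega) hfix ν) ?_
    rw [weightProj_cut_eq_partialUnip hρ hm hself hνz]
    refine weightProj_mem_rootFixed_of_string hρ (by omega) hm (hx _ (by omega) hm)
      (fun c hc => weightProj_string_eq_zero hρ hm hb hz hνz hνb hc) fun c hc hs => ?_
    have hc0 := hd _ hs
    have hc1 := hνc m le_rfl
    have h4 := hΦ _ hs (admissible_succ (hd _ hs) (by
      rw [add_smul_firstRoot_HC hm, add_smul_firstRoot_corootSum_succ hm, hνb]
      linarith) fun k hk => by
      rw [add_smul_firstRoot_HC hm, add_smul_firstRoot_corootSum hm hk, hνb]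
      have := mul_nonneg (show (0 : ℝ) ≤ m + 1 by linarith) (hνc k hk)
      linarith)
    rw [add_smul_firstRoot_HC hm, add_smul_firstRoot_corootSum hm hlm', hνb, hνl] at h4
    push_cast at h4
    have h5 : c * (l : ℝ) = 0 := by linarith
    exact (mul_eq_zero.1 h5).resolve_right (by linarith)

/-- The equality for j ≤ m alone makes v₀ invariant under the first m root elements, as level
induction needs; the equality for l then enlarges the block. For l = m + 1 the new row is obtained
from the lowering root subgroup. -/
theorem mem_blockFixed_of_eq_on_cone {m : ℕ} (hm : m + 1 ≤ n) {j l : ℕ} (hj : 1 ≤ j)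
    (hjm : j ≤ m) (hjl : j ≤ l) (hl : l ≤ m + 1)
    {b : ℝ} {v : V} (hb : ∀ ν ∈ supp ρ v, ν (HC n) = b)
    (hΦ : ∀ μ ∈ supp ρ (partialUnip ρ x (m + 1) v),
      (∀ k : ℕ, k ≤ m + 1 → k * (μ (HC n) - b) ≤ ((m : ℝ) + 1) * μ (corootSum n k)) →
      ((m : ℝ) + 1) * μ (corootSum n j) = j * (μ (HC n) - b) ∧
      ((m : ℝ) + 1) * μ (corootSum n l) = l * (μ (HC n) - b)) : v ∈ blockFixed ρ l m := by
  have hm0 : (0 : ℝ) ≤ m := m.cast_nonneg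
  refine mem_of_level_induction hρ hm (blockFixed ρ l m)
    (fun μ => (∀ k : ℕ, k ≤ m + 1 → k * (μ (HC n) - b) ≤ ((m : ℝ) + 1) * μ (corootSum n k)) →
      ((m : ℝ) + 1) * μ (corootSum n j) = j * (μ (HC n) - b) ∧
      ((m : ℝ) + 1) * μ (corootSum n l) = l * (μ (HC n) - b))
    (fun v hv hb hΦ => ?_) hb hΦ
  obtain ⟨z, h0, hz, htop⟩ := exists_top_level hρ hm x hv
  have hb₀ : ∀ ν ∈ supp ρ (cut ρ {μ | μ (levelElt n m) = z} v), ν (HC n) = b := fun ν hν =>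
    hb ν (by rw [supp_cut hρ] at hν; exact hν.1)
  have hlift : ∀ κ ∈ supp ρ (partialUnip ρ x m (cut ρ {μ | μ (levelElt n m) = z} v)),
      Admissible b m κ → ∃ i : ℕ, ∃ μ : Module.Dual ℝ (cartan n),
      (((m : ℝ) + 1) * μ (corootSum n j) = j * (μ (HC n) - b) ∧
      ((m : ℝ) + 1) * μ (corootSum n l) = l * (μ (HC n) - b)) ∧
      (∀ k : ℕ, k ≤ m → ((m : ℝ) + 1) * μ (corootSum n k) - k * μ (HC n) =
        (m + 1) * κ (corootSum n k) - k * κ (HC n)) ∧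
      μ (corootSum n (m + 1)) - μ (HC n) = κ (corootSum n m) - κ (HC n) + i := by
    intro κ hκ hadm
    obtain ⟨i, μ, hμ, -, e1, e2, -⟩ :=
      exists_lift hρ hm (hx _ (by omega) hm) ((htop κ hκ).2.2 _)
    refine ⟨i, μ, hΦ μ hμ fun k hk => ?_, e1, e2⟩
    rcases Nat.lt_or_ge k (m + 1) with hkm | hkm
    · have := e1 k (by omega)
      have := hadm.2 k (by omega)
      linarith
    · obtain rfl : k = m + 1 := by omega
      have hi : (0 : ℝ) ≤ i := i.cast_nonneg
      have ha1 := hadm.1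
      push_cast
      exact mul_le_mul_of_nonneg_left (by linarith) (by linarith)
  have hfix := mem_blockFixed_of_corootSum_eq hρ hx (show m ≤ n by omega) hj hjm hb₀
    fun κ hκ hadm => by
      obtain ⟨i, μ, ⟨h1, -⟩, e1, -⟩ := hlift κ hκ hadm
      have := e1 j hjm
      linarith
  have hself := partialUnip_eq_self_of_mem_blockFixed (x := x) hfix
  refine ⟨z, h0, hz, hself, ?_⟩
  rcases Nat.lt_or_ge l (m + 1) with hlm | hlm
  · refine mem_blockFixed_of_corootSum_eq hρ hx (show m ≤ n by omega) (by omega) (by omega) hb₀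
      fun κ hκ hadm => ?_
    obtain ⟨i, μ, ⟨-, h1⟩, e1, -⟩ := hlift κ hκ hadm
    have := e1 l (by omega)
    linarith
  obtain rfl : l = m + 1 := by omega
  have hfix' := mem_blockFixed_of_corootSum_eq_zero hρ hx (show m ≤ n by omega) hb₀
    fun κ hκ hadm => by
      obtain ⟨i, μ, ⟨-, h1⟩, -, e2⟩ := hlift κ hκ hadm
      have h2 : μ (corootSum n (m + 1)) = μ (HC n) - b := by
        push_cast at h1
        exact mul_left_cancel₀ (show (m : ℝ) + 1 ≠ 0 by linarith) h1
      have hi : (0 : ℝ) ≤ i := i.cast_nonneg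
      have ha1 := hadm.1
      rw [hself] at hκ
      have h3 := hb₀ κ hκ
      exact ⟨by linarith, h3⟩
  refine mem_of_weightProj_mem hρ _ fun ν => ?_
  by_cases hν : ν ∈ supp ρ (cut ρ {μ | μ (levelElt n m) = z} v)
  swap
  · rw [not_not.1 hν]; exact Submodule.zero_mem _
  have hνc : ∀ k, k ≤ m → ν (corootSum n k) = 0 := fun k hk =>
    corootSum_eq_zero_of_mem_blockFixed hρ le_rfl (by omega) hfix' hν hk
  have hνb := hb₀ ν hν
  have hνz : ν (levelElt n m) = z := by
    rw [supp_cut hρ] at hν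
    exact hν.2
  refine mem_blockFixed_succ_left hm (by omega) (weightProj_mem_blockFixed hρ
    (by omega) (by omega) hfix' ν) ?_
  rw [weightProj_cut_eq_partialUnip hρ hm hself hνz]
  have hstring : ∀ c : ℝ, c ≠ 0 →
      weightProj ρ (ν + c • firstRoot n (m + 1)) (partialUnip ρ x m v) = 0 := fun c hc =>
    weightProj_string_eq_zero hρ hm hb hz hνz hνb hc
  have hr : root (nth n (m + 1)) 0 = -firstRoot n (m + 1) := root_swap 0 _
  -- A lift of ν − α would have C_{m+1} − d ≥ 1, while the equality for l = m + 1 says C_{m+1} = d.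
  have hn : ν - firstRoot n (m + 1) ∉
      supp ρ (ρ (rootElt (nth n (m + 1)) 0 (x (m + 1))⁻¹) (partialUnip ρ x m v)) := by
    intro hn
    obtain ⟨i, μ, hμ, e1, e2⟩ := exists_sub_firstRoot_lift hρ hx hm hn
    have hi : (0 : ℝ) ≤ i := i.cast_nonneg
    rw [hνc m le_rfl, hνb] at e2
    have h1 := (hΦ μ hμ fun k hk => by
      rcases Nat.lt_or_ge k (m + 1) with hkm | hkm
      · have := e1 k (by omega)
        rw [hνc k (by omega), hνb] at this
        linarith
      · obtain rfl : k = m + 1 := by omega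
        push_cast
        exact mul_le_mul_of_nonneg_left (by linarith) (by linarith)).2
    push_cast at h1
    have h2 := mul_left_cancel₀ (show (m : ℝ) + 1 ≠ 0 by linarith) h1
    linarith
  have h3 := weightProj_sub_mem_rootFixed hρ (zero_ne_nth (by omega) hm).symm
    (inv_ne_zero (hx _ (by omega) hm))
    (by
      have := hstring (-1) (by norm_num)
      rw [← this]; congr 2; module)
    (fun k hk => by
      have e : ν - firstRoot n (m + 1) - (k : ℝ) • root (nth n (m + 1)) 0 =
          ν + ((k : ℝ) - 1) • firstRoot n (m + 1) := by
        rw [hr]; module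
      rw [e]
      have : (2 : ℝ) ≤ k := by exact_mod_cast hk
      exact hstring _ (by linarith)) (not_not.1 hn)
  rwa [hr, sub_neg_eq_add, sub_add_cancel] at h3

/-- The condition d = 0 leaves only c = 0 on the upper half of each string, which yields the missing
last column. -/
theorem mem_blockFixed_succ_of_cone {m : ℕ} (hm : m + 1 ≤ n) {l : ℕ} (hl : l ≤ m + 1)
    {b : ℝ} {v : V} (hb : ∀ ν ∈ supp ρ v, ν (HC n) = b) (hv : v ∈ blockFixed ρ l m)
    (hΦ : ∀ μ ∈ supp ρ (partialUnip ρ x (m + 1) v),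
      (∀ k : ℕ, k ≤ m + 1 → k * (μ (HC n) - b) ≤ ((m : ℝ) + 1) * μ (corootSum n k)) →
      μ (HC n) = b) : v ∈ blockFixed ρ l (m + 1) := by
  have hm0 : (0 : ℝ) ≤ m := m.cast_nonneg
  have hself := partialUnip_eq_self_of_mem_blockFixed (x := x) hv
  refine mem_blockFixed_succ_right (by omega) hm hv (mem_of_weightProj_mem hρ _ fun ν => ?_)
  by_cases hν : ν ∈ supp ρ v
  swap
  · rw [not_not.1 hν]; exact Submodule.zero_mem _
  have hνc : ∀ k, k ≤ m → 0 ≤ ν (corootSum n k) := fun k hk =>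
    corootSum_nonneg_of_mem_blockFixed hρ (by omega) hv hν hk
  have hzero : ∀ c : ℝ, b + c * ((m : ℝ) + 1) = b → c = 0 := fun c hc =>
    (mul_eq_zero.1 (show c * ((m : ℝ) + 1) = 0 by linarith)).resolve_right (by linarith)
  refine weightProj_mem_rootFixed_of_string hρ (by omega) hm (hx _ (by omega) hm)
    (fun c hc => ?_) fun c hc hs => ?_
  · by_contra h
    have := hb _ h
    rw [add_smul_firstRoot_HC hm, hb ν hν] at this
    exact hc (hzero c this)
  · refine hzero c ?_
    have h1 := hΦ (ν + c • firstRoot n (m + 1)) (by rw [partialUnip_succ, hself]; exact hs)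
      fun k hk => by
        rcases Nat.lt_or_ge k (m + 1) with hkm | hkm
        · rw [add_smul_firstRoot_HC hm, add_smul_firstRoot_corootSum hm (by omega), hb ν hν]
          have := mul_nonneg (show (0 : ℝ) ≤ m + 1 by linarith) (hνc k (by omega))
          linarith
        · obtain rfl : k = m + 1 := by omega
          rw [add_smul_firstRoot_HC hm, add_smul_firstRoot_corootSum_succ hm, hb ν hν]
          have := hνc m le_rfl
          push_cast
          exact mul_le_mul_of_nonneg_left (by linarith) (by linarith)
    rwa [add_smul_firstRoot_HC hm, hb ν hν] at h1

end Stabilizer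

/-! ### Generation of G_m and Q_m by root elements. -/

section Generation

variable {n : ℕ} {K : Subgroup (Matrix.SpecialLinearGroup (Fin (n + 1)) ℝ)}

theorem exists_coe_eq_one_add_sum_single (p : Fin (n + 1)) (c : Fin (n + 1) → ℝ)
    (s : Finset (Fin (n + 1))) (hp : p ∉ s)
    (hK : ∀ k ∈ s, c k ≠ 0 → rootElt p k (c k) ∈ K) :
    ∃ h ∈ K, (h : Matrix (Fin (n + 1)) (Fin (n + 1)) ℝ) = 1 + ∑ k ∈ s, single p k (c k) := by
  classical
  induction s using Finset.induction_on with
  | empty => exact ⟨1, K.one_mem, by simp⟩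
  | insert a s ha ih =>
    have hpa : p ≠ a := fun e => hp (e ▸ Finset.mem_insert_self _ _)
    obtain ⟨h, hK', e⟩ := ih (fun h => hp (Finset.mem_insert_of_mem h))
      fun k hk => hK k (Finset.mem_insert_of_mem hk)
    refine ⟨rootElt p a (c a) * h, K.mul_mem ?_ hK', ?_⟩
    · by_cases h0 : c a = 0
      · rw [h0, rootElt_zero]; exact K.one_mem
      · exact hK a (Finset.mem_insert_self _ _) h0
    · have hz : single p a (c a) * ∑ k ∈ s, single p k (c k) = 0 := by
        rw [Finset.mul_sum]
        exact Finset.sum_eq_zero fun k _ => single_mul_single_of_ne _ _ _ _ hpa.symm _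
      rw [Matrix.SpecialLinearGroup.coe_mul, coe_rootElt hpa, e, Finset.sum_insert ha,
        add_mul, mul_add (single p a (c a)), hz, one_mul, mul_one]
      abel

/-- Column operations with the column `p`, which clear the row `p` if `g p p = 1`. -/
theorem mem_of_clear_row {g : Matrix.SpecialLinearGroup (Fin (n + 1)) ℝ} {p : Fin (n + 1)}
    (hK : ∀ k, k ≠ p → g p k ≠ 0 → ∀ t, rootElt p k t ∈ K)
    (h : ∀ g' : Matrix.SpecialLinearGroup (Fin (n + 1)) ℝ,
      (∀ i k, g' i k = g i k - if k = p then 0 else g p k * g i p) → g' ∈ K) : g ∈ K := by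
  classical
  obtain ⟨r, hr, e⟩ := exists_coe_eq_one_add_sum_single (K := K) p (fun k => -g p k)
    (Finset.univ.erase p) (Finset.notMem_erase _ _)
    fun k hk hk0 => hK k (Finset.ne_of_mem_erase hk) (by simpa using hk0) _
  refine (K.mul_mem_cancel_right hr).1 (h _ fun i k => ?_)
  rw [Matrix.SpecialLinearGroup.coe_mul, e, mul_add, mul_one, Matrix.add_apply, Finset.mul_sum,
    Matrix.sum_apply]
  by_cases hk : k = p
  · rw [if_pos hk, Finset.sum_eq_zero, add_zero, sub_zero]
    intro j hj
    exact mul_single_apply_of_ne _ _ _ _ _ (fun e => Finset.ne_of_mem_erase hj (e.symm.trans hk)) _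
  · rw [if_neg hk, Finset.sum_eq_single_of_mem k (Finset.mem_erase.2 ⟨hk, Finset.mem_univ _⟩),
      mul_single_apply_same]
    · ring
    · intro j _ hj
      exact mul_single_apply_of_ne _ _ _ _ _ hj.symm _

theorem rootElt_mul_apply {i k : Fin (n + 1)} (h : i ≠ k) (t : ℝ)
    (g : Matrix.SpecialLinearGroup (Fin (n + 1)) ℝ) (a b : Fin (n + 1)) :
    (rootElt i k t * g) a b = g a b + if a = i then t * g k b else 0 := by
  rw [Matrix.SpecialLinearGroup.coe_mul, coe_rootElt h, add_mul, one_mul, Matrix.add_apply]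
  congr 1
  split_ifs with e
  · subst e; simp
  · exact single_mul_apply_of_ne _ _ _ _ _ e _

/-- Gaussian elimination from the bottom row p of the block: a row operation makes the diagonal
entry 1, column operations clear the rest of row p, and the block loses a row. -/
theorem mem_of_block {N m : ℕ} (hmN : m < N) (hN : N ≤ n + 1)
    (hK : ∀ i k : Fin (n + 1), (i : ℕ) ≤ m → (k : ℕ) < N → i ≠ k → ∀ t, rootElt i k t ∈ K)
    {g : Matrix.SpecialLinearGroup (Fin (n + 1)) ℝ}
    (hg : ∀ i k : Fin (n + 1), m < (i : ℕ) ∨ N ≤ (k : ℕ) → g i k = if i = k then 1 else 0) :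
    g ∈ K := by
  induction m generalizing g with
  | zero =>
    have h00 : g 0 0 = 1 := by
      have hd := g.det_coe
      rw [det_of_isUpperTriangular (fun i j hij => by
        rw [hg i j (Or.inl (lt_of_le_of_lt (Nat.zero_le _) hij)), if_neg (ne_of_gt (show j < i from hij))]),
        Fin.prod_univ_succ, Finset.prod_eq_one, mul_one] at hd
      · exact hd
      · intro i _
        rw [hg _ _ (Or.inl (by simp)), if_pos rfl]
    refine mem_of_clear_row (p := 0) (fun k hk h0 => hK 0 k le_rfl ?_ hk.symm) fun g' hg' => ?_
    · by_contra h
      rw [hg 0 k (Or.inr (by omega)), if_neg hk.symm] at h0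
      exact h0 rfl
    · convert K.one_mem
      apply special_ext
      ext i k
      rw [hg', Matrix.SpecialLinearGroup.coe_one, one_apply]
      by_cases hi : i = 0
      · subst hi
        by_cases hk : k = 0
        · subst hk; simp [h00]
        · rw [h00, if_neg hk, if_neg (Ne.symm hk)]; ring
      · have hi0 : 0 < (i : ℕ) := Nat.pos_of_ne_zero fun e => hi (Fin.ext e)
        rw [hg i k (Or.inl hi0), hg i 0 (Or.inl hi0), if_neg hi]
        simp
  | succ m ih =>
    set p := nth n (m + 1) with hp
    have hpv : (p : ℕ) = m + 1 := val_nth (by omega)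
    have step1 : ∀ g : Matrix.SpecialLinearGroup (Fin (n + 1)) ℝ,
        (∀ i k : Fin (n + 1), m + 1 < (i : ℕ) ∨ N ≤ (k : ℕ) → g i k = if i = k then 1 else 0) →
        g p p = 1 → g ∈ K := by
      intro g hg h1
      refine mem_of_clear_row (p := p) (fun k hk h0 => hK p k hpv.le ?_ hk.symm) fun g' hg' =>
        ih (by omega) (fun i k hi => hK i k (by omega)) fun i k hik => ?_
      · by_contra h
        rw [hg p k (Or.inr (by omega)), if_neg hk.symm] at h0
        exact h0 rfl
      · rw [hg']
        by_cases hi : i = p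
        · rw [hi, h1]
          by_cases hk : k = p
          · rw [hk, h1]; simp
          · rw [if_neg hk, if_neg (Ne.symm hk)]; ring
        · have hi' : (i : ℕ) ≠ m + 1 := fun e => hi (Fin.ext (e.trans hpv.symm))
          rcases hik with hik | hik
          · rw [hg i k (Or.inl (by omega)), hg i p (Or.inl (by omega)), if_neg hi]
            simp
          · have hkp : p ≠ k := fun e => by rw [← e, hpv] at hik; omega
            rw [hg i k (Or.inr hik), hg p k (Or.inr hik), if_neg hkp]
            simp
    have pres : ∀ i k : Fin (n + 1), (i : ℕ) ≤ m + 1 → (k : ℕ) ≤ m + 1 → i ≠ k → ∀ t,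
        ∀ g : Matrix.SpecialLinearGroup (Fin (n + 1)) ℝ,
        (∀ i k : Fin (n + 1), m + 1 < (i : ℕ) ∨ N ≤ (k : ℕ) → g i k = if i = k then 1 else 0) →
        ∀ a b : Fin (n + 1), m + 1 < (a : ℕ) ∨ N ≤ (b : ℕ) →
          (rootElt i k t * g) a b = if a = b then 1 else 0 := by
      intro i k hi hk hik t g hg a b hab
      rw [rootElt_mul_apply hik, hg a b hab]
      split_ifs with h1 h2 h2
      · subst h1 h2
        rcases hab with hab | hab <;> omega
      · simp
      · subst h2
        rcases hab with hab | hab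
        · omega
        · rw [hg k b (Or.inr hab), if_neg (fun e => by subst e; omega)]; simp
      · simp
    have step2 : ∀ g : Matrix.SpecialLinearGroup (Fin (n + 1)) ℝ,
        (∀ i k : Fin (n + 1), m + 1 < (i : ℕ) ∨ N ≤ (k : ℕ) → g i k = if i = k then 1 else 0) →
        ∀ q : Fin (n + 1), q ≠ p → g q p ≠ 0 → g ∈ K := by
      intro g hg q hq hqp
      have hqm : (q : ℕ) ≤ m + 1 := by
        by_contra h
        rw [hg q p (Or.inl (by omega)), if_neg hq] at hqp
        exact hqp rfl
      refine (K.mul_mem_cancel_left (hK p q hpv.le (by omega) hq.symm ((1 - g p p) / g q p))).1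
        (step1 _ (pres p q hpv.le hqm hq.symm _ g hg) ?_)
      rw [rootElt_mul_apply hq.symm, if_pos rfl]
      field_simp
      ring
    by_cases h : ∃ q, q ≠ p ∧ g q p ≠ 0
    · obtain ⟨q, hq, hqp⟩ := h
      exact step2 g hg q hq hqp
    · push Not at h
      have h0p : (0 : Fin (n + 1)) ≠ p := zero_ne_nth (by omega) (by omega)
      have hpp : g p p ≠ 0 := by
        intro h0
        have := det_eq_zero_of_column_eq_zero (A := (g : Matrix (Fin (n + 1)) (Fin (n + 1)) ℝ)) p
          fun i => by
            by_cases hi : i = p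
            · subst hi; exact h0
            · exact h i hi
        rw [g.2] at this
        exact one_ne_zero this
      -- If column p is zero off the diagonal, adding row p to row 0 supplies the nonzero entry
      -- needed by `step2`.
      refine (K.mul_mem_cancel_left (hK 0 p (Nat.zero_le _) (by omega) h0p 1)).1
        (step2 _ (pres 0 p (Nat.zero_le _) hpv.le h0p _ g hg) 0 h0p ?_)
      rw [rootElt_mul_apply h0p, if_pos rfl, h 0 h0p]
      simpa using hpp

theorem mem_of_mem_subG {m : ℕ} (hm : m ≤ n)
    (hK : ∀ i k : Fin (n + 1), (i : ℕ) ≤ m → i ≠ k → ∀ t, rootElt i k t ∈ K)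
    {g : Matrix.SpecialLinearGroup (Fin (n + 1)) ℝ} (hg : g ∈ subG n m) : g ∈ K :=
  mem_of_block (N := n + 1) (by omega) le_rfl (fun i k hi _ => hK i k hi)
    fun i k hik => hg i k (hik.resolve_right (by omega))

theorem mem_of_mem_subQ_inter_subG {m : ℕ} (hn : 1 ≤ n) (hm : m ≤ n)
    (hK : ∀ i k : Fin (n + 1), (i : ℕ) ≤ m → (k : ℕ) < n → i ≠ k → ∀ t, rootElt i k t ∈ K)
    {g : Matrix.SpecialLinearGroup (Fin (n + 1)) ℝ} (hg : g ∈ subQ n ∩ subG n m) : g ∈ K := by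
  have hlast : ∀ i k : Fin (n + 1), n ≤ (k : ℕ) → g i k = if i = k then 1 else 0 := by
    intro i k hk
    obtain rfl : k = Fin.last n := Fin.ext (le_antisymm (Nat.le_of_lt_succ k.2) hk)
    exact hg.1 i
  rcases hm.lt_or_eq with hmn | rfl
  · exact mem_of_block hmn (Nat.le_succ n) hK
      fun i k hik => hik.elim (fun h => hg.2 i k h) (hlast i k)
  -- For G_n the last row is the free vector w; it is cleared with the last column, leaving a block
  -- of size n.
  · refine mem_of_clear_row (p := Fin.last m) (fun k hk _ => hK _ k le_rfl ?_ hk.symm)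
      fun g' hg' => mem_of_block (m := m - 1) (N := m) (by omega) (Nat.le_succ m)
        (fun i k hi => hK i k (by omega)) fun i k hik => ?_
    · exact lt_of_le_of_ne (Nat.le_of_lt_succ k.2) fun e => hk (Fin.ext e)
    · rw [hg']
      by_cases hk : k = Fin.last m
      · subst hk
        rw [if_pos rfl, hlast _ _ le_rfl, sub_zero]
      · have hkm : ¬ m ≤ (k : ℕ) := fun e =>
          hk (Fin.ext (le_antisymm (Nat.le_of_lt_succ k.2) e))
        have hi : i = Fin.last m :=
          Fin.ext (by have := hik.resolve_right hkm; have := i.2; simp only [Fin.val_last]; omega)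
        rw [hi, hlast (Fin.last m) (Fin.last m) le_rfl, if_pos rfl, if_neg hk, if_neg (Ne.symm hk)]
        ring

end Generation

/-! ### From fixed root subgroups to fixed subgroups. -/

section Stabilizer

variable {n : ℕ} {V : Type*} [NormedAddCommGroup V] [NormedSpace ℝ V]
  {ρ : Representation ℝ (Matrix.SpecialLinearGroup (Fin (n + 1)) ℝ) V}

variable (ρ) in
/-- The subgroup fixing a vector. -/
def vectorStabilizer (v : V) : Subgroup (Matrix.SpecialLinearGroup (Fin (n + 1)) ℝ) where
  carrier := {g | ρ g v = v}
  mul_mem' hg hh := by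
    rw [Set.mem_ofPred_eq] at *
    rw [rep_mul_apply, hh, hg]
  one_mem' := by simp
  inv_mem' hg := by
    rw [Set.mem_ofPred_eq] at *
    conv_lhs => rw [← hg]
    rw [← rep_mul_apply, inv_mul_cancel, map_one, Module.End.one_apply]

theorem rootElt_mem_vectorStabilizer {l m : ℕ} {v : V} (h : v ∈ blockFixed ρ l m)
    {i k : Fin (n + 1)} (hi : (i : ℕ) ≤ l) (hk : (k : ℕ) ≤ m) (hik : i ≠ k) (t : ℝ) :
    rootElt i k t ∈ vectorStabilizer ρ v := by
  have := mem_blockFixed.1 h i k hi hk (fun e => hik (Fin.ext e)) t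
  rwa [nth_val, nth_val] at this

theorem fixed_of_mem_subG {m : ℕ} (hm : m ≤ n) {v : V} (h : v ∈ blockFixed ρ m n) :
    ∀ g ∈ subG n m, ρ g v = v := fun _ hg =>
  mem_of_mem_subG (K := vectorStabilizer ρ v) hm (fun _ k hi hik t =>
    rootElt_mem_vectorStabilizer h hi (Nat.le_of_lt_succ k.2) hik t) hg

theorem fixed_of_mem_subQ_inter_subG {m p : ℕ} (hp : p + 1 = n) (hm : m ≤ n) {v : V}
    (h : v ∈ blockFixed ρ m p) : ∀ g ∈ subQ n ∩ subG n m, ρ g v = v := fun _ hg =>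
  mem_of_mem_subQ_inter_subG (K := vectorStabilizer ρ v) (by omega) hm (fun _ k hi hk hik t =>
    rootElt_mem_vectorStabilizer h hi (by omega) hik t) hg

end Stabilizer

/-! ### Translation to u(x), S_k and S. -/

section Main

variable {n : ℕ} {V : Type*} [NormedAddCommGroup V] [NormedSpace ℝ V]
  {ρ : Representation ℝ (Matrix.SpecialLinearGroup (Fin (n + 1)) ℝ) V}

/-- The sequence `x 1, …, x n` attached to the tuple `x`, extended by `1`. -/
def shiftedSeq (x : Fin n → ℝ) (k : ℕ) : ℝ :=
  -- The default 1 keeps every term nonzero.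
  if h : k - 1 < n then x ⟨k - 1, h⟩ else 1

theorem shiftedSeq_ne_zero {x : Fin n → ℝ} (hx : ∀ i, x i ≠ 0) (k : ℕ) : shiftedSeq x k ≠ 0 := by
  unfold shiftedSeq
  split_ifs
  · exact hx _
  · exact one_ne_zero

theorem exists_partialUnip_eq (x : ℕ → ℝ) {m : ℕ} (hm : m ≤ n) (v : V) :
    ∃ g : Matrix.SpecialLinearGroup (Fin (n + 1)) ℝ, partialUnip ρ x m v = ρ g v ∧
      ∀ i k, g i k = if i = k then 1 else if i = 0 ∧ (k : ℕ) ≤ m then x k else 0 := by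
  induction m with
  | zero =>
    refine ⟨1, by rw [partialUnip_zero, map_one, Module.End.one_apply], fun i k => ?_⟩
    rw [Matrix.SpecialLinearGroup.coe_one, one_apply]
    split_ifs with h1 h2
    · rfl
    · exact absurd (Fin.ext (by rw [h2.1, Nat.le_zero.1 h2.2]; rfl)) h1
    · rfl
  | succ m ih =>
    obtain ⟨g, hg, he⟩ := ih (by omega)
    have h0 := zero_ne_nth (n := n) (k := m + 1) (by omega) hm
    refine ⟨rootElt 0 (nth n (m + 1)) (x (m + 1)) * g,
      by rw [partialUnip_succ, hg, rep_mul_apply], fun i k => ?_⟩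
    rw [rootElt_mul_apply h0, he, he]
    have hk : nth n (m + 1) = k ↔ (k : ℕ) = m + 1 := by
      rw [Fin.ext_iff, val_nth hm, eq_comm]
    by_cases hi : i = 0
    · subst hi
      by_cases hkm : (k : ℕ) = m + 1
      · rw [if_neg (fun e => by subst e; simp at hkm), if_neg (by omega), if_pos rfl,
          if_pos (hk.2 hkm), if_neg (fun e => by subst e; simp at hkm), if_pos ⟨rfl, hkm.le⟩, hkm]
        ring
      · have : (k : ℕ) ≤ m + 1 ↔ (k : ℕ) ≤ m := by omega
        simp [this, hk, hkm, h0.symm]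
    · simp [hi]

theorem rep_unip (x : Fin n → ℝ) (v : V) :
    ρ (unip x) v = partialUnip ρ (shiftedSeq x) n v := by
  obtain ⟨g, hg, he⟩ := exists_partialUnip_eq (ρ := ρ) (shiftedSeq x) le_rfl v
  rw [hg]
  congr 2
  apply special_ext
  ext i k
  rw [he]
  simp only [unip, of_apply]
  refine Fin.cases ?_ (fun i => ?_) i
  · refine Fin.cases ?_ (fun k => ?_) k
    · simp
    · simp [shiftedSeq, (Fin.succ_ne_zero k).symm]
  · simp [one_apply]

variable [FiniteDimensional ℝ V] (hρ : ∀ w : V, Continuous fun g => ρ g w)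
include hρ

theorem mem_weightsOf_iff_mem_supp {w : V} {μ : Module.Dual ℝ (cartan n)} :
    μ ∈ weightsOf ρ w ↔ μ ∈ supp ρ w := mem_weightsOf_iff hρ

theorem apply_eq_of_actsTo {H : cartan n} {v : V} {b : ℝ} (h : ActsTo ρ H v (b • v)) :
    ∀ ν ∈ supp ρ v, ν H = b := by
  intro ν hν
  have h1 := actsTo_smul_iff.1 h 1
  rw [one_smul, one_mul] at h1
  have h2 := weightProj_map hρ (f := id) (T := ρ (expCartan H)) Function.injective_id
    (fun μ w hw => by
      rw [mem_weightSpace_iff.1 hw]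
      exact Submodule.smul_mem _ _ hw) ν v
  rw [id, h1, map_smul, mem_weightSpace_iff.1 (weightProj_mem hρ ν v)] at h2
  exact (Real.exp_injective (smul_left_injective ℝ hν h2)).symm

theorem mem_setSk_iff {x : Fin n → ℝ} {v : V} {b : ℝ} {k : ℕ} (hk : 1 ≤ k ∧ k ≤ n)
    {μ : Module.Dual ℝ (cartan n)} : μ ∈ setSk ρ x v b k hk ↔
      μ ∈ supp ρ (partialUnip ρ (shiftedSeq x) n v) ∧
        k * (μ (HC n) - b) ≤ n * μ (corootSum n k) := by
  have hk0 : (0 : ℝ) < k := by exact_mod_cast hk.1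
  rw [setSk, Set.mem_ofPred_eq, mem_weightsOf_iff_mem_supp hρ, rep_unip, Hk_eq, map_smul,
    smul_eq_mul, sub_nonneg, div_mul_eq_mul_div, le_div_iff₀' hk0]

theorem mem_setS_iff (hn : 1 ≤ n) {x : Fin n → ℝ} {v : V} {b : ℝ}
    {μ : Module.Dual ℝ (cartan n)} : μ ∈ setS ρ x v b ↔
      μ ∈ supp ρ (partialUnip ρ (shiftedSeq x) n v) ∧
        ∀ k : ℕ, k ≤ n → k * (μ (HC n) - b) ≤ n * μ (corootSum n k) := by
  simp only [setS, Set.mem_iInter, mem_setSk_iff hρ]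
  refine ⟨fun h => ⟨(h n ⟨hn, le_rfl⟩).1, fun k hk => ?_⟩, fun h k hk => ⟨h.1, h.2 k hk.2⟩⟩
  rcases Nat.eq_zero_or_pos k with rfl | h0
  · simp [corootSum_zero]
  · exact (h k ⟨h0, hk⟩).2

omit [FiniteDimensional ℝ V] hρ in
theorem apply_Hk_eq_iff {k : ℕ} (hk : 1 ≤ k ∧ k ≤ n) (μ : Module.Dual ℝ (cartan n)) (d : ℝ) :
    μ (Hk n k hk) - d = 0 ↔ n * μ (corootSum n k) = k * d := by
  have hk0 : (k : ℝ) ≠ 0 := by have := hk.1; positivity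
  rw [Hk_eq, map_smul, smul_eq_mul, sub_eq_zero, div_mul_eq_mul_div, div_eq_iff hk0, mul_comm d]

/-- The last lift is recorded with factor n = m + 1, which is what S asks for; `exists_admissible`
at rank n would give only n + 1. -/
theorem exists_mem_supp_cone {x : ℕ → ℝ} (hx : ∀ k, 1 ≤ k → k ≤ n → x k ≠ 0) {m : ℕ}
    (hm : m + 1 ≤ n) {b : ℝ} {v : V} (hv : v ≠ 0) (hb : ∀ ν ∈ supp ρ v, ν (HC n) = b) :
    ∃ μ ∈ supp ρ (partialUnip ρ x (m + 1) v),
      ∀ k : ℕ, k ≤ m + 1 → k * (μ (HC n) - b) ≤ ((m : ℝ) + 1) * μ (corootSum n k) := by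
  obtain ⟨z, h0, -, h2⟩ := exists_top_level hρ hm x hv
  obtain ⟨κ, hκ, ha⟩ := exists_admissible hρ hx (m := m) (by omega) h0
    (fun ν hν => hb ν (by rw [supp_cut hρ] at hν; exact hν.1))
  obtain ⟨j, μ, hμ, -, e1, e2, -⟩ := exists_lift hρ hm (hx _ (by omega) hm) ((h2 κ hκ).2.2 _)
  refine ⟨μ, hμ, fun k hk => ?_⟩
  rcases Nat.lt_or_ge k (m + 1) with hkm | hkm
  · have h3 := ha.2 k (by omega)
    have h4 := e1 k (by omega)
    linarith
  · obtain rfl : k = m + 1 := by omega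
    have h3 := ha.1
    have h4 : (0 : ℝ) ≤ j := j.cast_nonneg
    push_cast
    exact mul_le_mul_of_nonneg_left (by linarith) (by positivity)

end Main

end SLRep

theorem mainTheorem6 (n : ℕ) (hn : 1 ≤ n)
    {V : Type*} [NormedAddCommGroup V] [NormedSpace ℝ V] [FiniteDimensional ℝ V]
    (ρ : Representation ℝ (Matrix.SpecialLinearGroup (Fin (n + 1)) ℝ) V)
    (hρ : ∀ w : V, Continuous fun g => ρ g w)
    (v : V) (hv : v ≠ 0) (b : ℝ) (hvb : SLRep.ActsTo ρ (SLRep.HC n) v (b • v))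
    (x : Fin n → ℝ) (hx : ∀ i, x i ≠ 0) :
    (∀ μ ∈ SLRep.weightsOf ρ (ρ (SLRep.unip x) v), 0 ≤ μ (SLRep.HC n) - b) ∧
    (SLRep.setSk ρ x v b n ⟨hn, le_rfl⟩).Nonempty ∧
    ((∀ μ ∈ SLRep.setSk ρ x v b n ⟨hn, le_rfl⟩,
        μ (SLRep.Hk n n ⟨hn, le_rfl⟩) - (μ (SLRep.HC n) - b) = 0 ∧ μ (SLRep.HC n) - b = 0) →
      ∀ g : Matrix.SpecialLinearGroup (Fin (n + 1)) ℝ, ρ g v = v) ∧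
    (SLRep.setS ρ x v b).Nonempty ∧
    (∀ (j n₀ : ℕ) (hj : 1 ≤ j) (hjn : j < n) (hjn₀ : j ≤ n₀) (hn₀ : n₀ ≤ n),
      (∀ μ ∈ SLRep.setS ρ x v b,
        μ (SLRep.Hk n j ⟨hj, hjn.le⟩) - (μ (SLRep.HC n) - b) = 0 ∧
        μ (SLRep.Hk n n₀ ⟨hj.trans hjn₀, hn₀⟩) - (μ (SLRep.HC n) - b) = 0) →
      (∀ g ∈ SLRep.subQ n ∩ SLRep.subG n n₀, ρ g v = v) ∧
      ((∀ μ ∈ SLRep.setS ρ x v b, μ (SLRep.HC n) - b = 0) →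
        ∀ g ∈ SLRep.subG n n₀, ρ g v = v)) := by
  have hb := SLRep.apply_eq_of_actsTo hρ hvb
  have hx' : ∀ k, 1 ≤ k → k ≤ n → SLRep.shiftedSeq x k ≠ 0 := fun k _ _ =>
    SLRep.shiftedSeq_ne_zero hx k
  have hn0 : (0 : ℝ) < n := by exact_mod_cast hn
  obtain ⟨m, rfl⟩ : ∃ m, n = m + 1 := ⟨n - 1, by omega⟩
  have hcast : ((m + 1 : ℕ) : ℝ) = (m : ℝ) + 1 := by push_cast; rfl
  have hS : (SLRep.setS ρ x v b).Nonempty := by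
    obtain ⟨μ, hμ, h⟩ := SLRep.exists_mem_supp_cone hρ hx' le_rfl hv hb
    exact ⟨μ, (SLRep.mem_setS_iff hρ hn).2 ⟨hμ, by rwa [hcast]⟩⟩
  refine ⟨fun μ hμ => ?_, ?_, fun h => ?_, hS, fun j n₀ hj hjn hjn₀ hn₀ h => ?_⟩
  · rw [SLRep.mem_weightsOf_iff_mem_supp hρ, SLRep.rep_unip] at hμ
    exact sub_nonneg.2
      (SLRep.le_of_mem_supp_partialUnip hρ le_rfl (fun ν hν => (hb ν hν).ge) μ hμ)
  · exact hS.mono (Set.iInter₂_subset (m + 1) ⟨hn, le_rfl⟩)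
  · have hblock : v ∈ SLRep.blockFixed ρ (m + 1) (m + 1) := by
      refine SLRep.mem_blockFixed_of_corootSum_eq_zero hρ hx' le_rfl hb fun μ hμ ha => ?_
      have h1 := h μ ((SLRep.mem_setSk_iff hρ _).2
        ⟨hμ, mul_le_mul_of_nonneg_left ha.1 hn0.le⟩)
      have h2 := (SLRep.apply_Hk_eq_iff _ _ _).1 h1.1
      rw [h1.2, mul_zero] at h2
      exact ⟨(mul_eq_zero.1 h2).resolve_left hn0.ne', sub_eq_zero.1 h1.2⟩
    exact fun g => SLRep.fixed_of_mem_subG le_rfl hblock g fun i k hi => absurd i.2 (by omega)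
  · have hblock : v ∈ SLRep.blockFixed ρ n₀ m := by
      refine SLRep.mem_blockFixed_of_eq_on_cone hρ hx' le_rfl hj (by omega) hjn₀ hn₀ hb
        fun μ hμ hc => ?_
      have h1 := h μ ((SLRep.mem_setS_iff hρ hn).2 ⟨hμ, by rwa [hcast]⟩)
      rwa [SLRep.apply_Hk_eq_iff, SLRep.apply_Hk_eq_iff, hcast] at h1
    refine ⟨SLRep.fixed_of_mem_subQ_inter_subG rfl hn₀ hblock, fun h' =>
      SLRep.fixed_of_mem_subG hn₀ (SLRep.mem_blockFixed_succ_of_cone hρ hx' le_rfl hn₀ hb hblock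
        fun μ hμ hc => ?_)⟩
    exact sub_eq_zero.1 (h' μ ((SLRep.mem_setS_iff hρ hn).2 ⟨hμ, by rwa [hcast]⟩))
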